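/- Theorem 3.3. Let $\mathbb D$ be the open unit disc in $\mathbb C$. Call $h:\mathbb D\to(0,\infty)$ a conformal weight if $h=|\varphi'|^2$ for a conformal (holomorphic, injective) map $\varphi$ of $\mathbb D$ onto a conformal regular domain, i.e. $\varphi'\in L^\alpha(\mathbb D)$ for some $\alpha\in(2,\infty]$. For such $h$ let $W^{1,2}(\mathbb D,h,1)$ be the space of all real-valued, locally integrable, weakly differentiable functions $f$ on $\mathbb D$ with $\iint_{\mathbb D}|f|^2h\,dxdy<\infty$ and $\iint_{\mathbb D}|\nabla f|^2\,dxdy<\infty$, and put $f_{\mathbb D,h}=\big(\iint_{\mathbb D}h\,dxdy\big)^{-1}\iint_{\mathbb D}fh\,dxdy$. Let $\lambda_1[h]\le\lambda_2[h]\le\dots$ be the eigenvalues, repeated according to multiplicity, of the weighted Neumann problem: $\lambda$ is an eigenvalue if there is $0\neq f\in W^{1,2}(\mathbb D,h,1)$ with $$\iint_{\mathbb D}\nabla f\cdot\nabla g\,dxdy=\lambda\iint_{\mathbb D}h f g\,dxdy\qquad\text{for all } g\in W^{1,2}(\mathbb D,h,1);$$ thus $\lambda_n[h]$ is the least $t\in\mathbb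 R$ such that the eigenfunctions with eigenvalue at most $t$ span a space of dimension at least $n$. Let $h_1,h_2$ be conformal weights and let $1<s\le\infty$ be such that $$d_s(h_1,h_2):=\Big\|\,(h_1-h_2)\,(\min\{h_1,h_2\})^{\frac{1-s}{s}}\Big\|_{L^s(\mathbb D)}<\infty .$$ Let $q=\frac{2s}{s-1}$ (for $s=\infty$: $q=2$ and $\frac{1-s}{s}=-1$), and let $C(q)=\max\{C_1(q),C_2(q)\}$, where $C_k(q)\in[0,\infty]$ is the infimum of all $K\in[0,\infty]$ such that $$\Big(\iint_{\mathbb D}|f-f_{\mathbb D,h_k}|^q\,h_k\,dxdy\Big)^{1/q}\le K\Big(\iint_{\mathbb D}|\nabla f|^2\,dxdy\Big)^{1/2}\qquad\text{for all } f\in W^{1,2}(\mathbb D,h_k,1).$$ Then $C\big(\frac{2s}{s-1}\big)<\infty$, and for every integer $n\ge1$ the eigenvalues $\lambda_n[h_1]$ and $\lambda_n[h_2]$ exist (the least $t$ above is attained for $h_1$ and for $h_2$) and $$\big|\lambda_n[h_1]-\lambda_n[h_2]\big|\le\tilde c_n\,\Big[C\Big(\frac{2s}{s-1}\Big)\Big]^2\,d_s(h_1,h_2),\qquad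 \tilde c_n=\max\{\lambda_n^2[h_1],\lambda_n^2[h_2]\}.$$ -/

import Mathlib

open MeasureTheory
open scoped ENNReal ContDiff

noncomputable section

namespace NeumannDisc

/-- The open unit disc of the complex plane. -/
def disc : Set ℂ := Metric.ball 0 1

/-- Lebesgue measure on the unit disc. -/
def discMeasure : Measure ℂ := volume.restrict disc

/-- The measure with density `h` with respect to Lebesgue measure on the disc; the weighted space
`L^p` of the disc with weight `h` is the usual `L^p` space of this measure. -/
def weightMeasure (h : ℂ → ℝ) : Measure ℂ :=
  discMeasure.withDensity fun z => ENNReal.ofReal (h z)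

/-- `h` is the conformal weight `|φ'|^2` of a conformal (holomorphic and injective) map `φ` from the
disc onto a conformal regular domain, that is, `φ'` lies in `L^α` of the disc for some `α > 2`. -/
def IsConformalWeight (h : ℂ → ℝ) : Prop :=
  ∃ φ : ℂ → ℂ, DifferentiableOn ℂ φ disc ∧ Set.InjOn φ disc ∧
    (∃ α : ℝ≥0∞, 2 < α ∧ MemLp (deriv φ) α discMeasure) ∧
    ∀ z ∈ disc, h z = ‖deriv φ z‖ ^ 2

/-- `f` is locally integrable and weakly differentiable on the disc with weak gradient `G`, where
the vector `(∂f/∂x, ∂f/∂y)` is written as the complex number `∂f/∂x + i ∂f/∂y`. -/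
def IsWeakGradient (f : ℂ → ℝ) (G : ℂ → ℂ) : Prop :=
  LocallyIntegrableOn f disc ∧ LocallyIntegrableOn G disc ∧
    ∀ η : ℂ → ℝ, ContDiff ℝ ∞ η → HasCompactSupport η → tsupport η ⊆ disc →
      ∀ v : ℂ, ∫ z in disc, f z * fderiv ℝ η z v = -∫ z in disc, inner ℝ (G z) v * η z

/-- `f` belongs to the weighted Sobolev space `W^{1,2}(disc, h, 1)` and has weak gradient `G`. -/
def MemSobolev (h f : ℂ → ℝ) (G : ℂ → ℂ) : Prop :=
  IsWeakGradient f G ∧ MemLp f 2 (weightMeasure h) ∧ MemLp G 2 discMeasure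

/-- `f` is in `W^{1,2}(disc, h, 1)` and solves the weak form of the weighted Neumann problem
`-Δ f = lam h f` (the zero function is allowed here). -/
def IsEigenfunction (h : ℂ → ℝ) (lam : ℝ) (f : ℂ → ℝ) : Prop :=
  ∃ G : ℂ → ℂ, MemSobolev h f G ∧
    ∀ (g : ℂ → ℝ) (H : ℂ → ℂ), MemSobolev h g H →
      ∫ z in disc, inner ℝ (G z) (H z) = lam * ∫ z in disc, h z * f z * g z

/-- The number, counted with multiplicity, of eigenvalues that are at most `t`: the dimension of
the space of (almost everywhere classes of) functions spanned by their eigenfunctions. -/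
def eigenvalueCount (h : ℂ → ℝ) (t : ℝ) : Cardinal :=
  Module.rank ℝ (Submodule.span ℝ
    {f : ℂ →ₘ[discMeasure] ℝ | ∃ lam ≤ t, IsEigenfunction h lam f})

/-- The `n`-th eigenvalue (`n ≥ 1`) in the non-decreasing enumeration with multiplicities: the
least `t` such that at least `n` eigenvalues are at most `t`. -/
def eigenvalue (h : ℂ → ℝ) (n : ℕ) : ℝ :=
  sInf {t : ℝ | (n : Cardinal) ≤ eigenvalueCount h t}

/-- The best constant `K` in the inequality
`‖f - f_h‖_{L^q(disc, h)} ≤ K ‖∇ f‖_{L^2(disc)}`, for all `f` in `W^{1,2}(disc, h, 1)`,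
where `f_h` is the mean of `f` with respect to the weight `h`. -/
def sobolevConst (h : ℂ → ℝ) (q : ℝ≥0∞) : ℝ≥0∞ :=
  sInf {K : ℝ≥0∞ | ∀ (f : ℂ → ℝ) (G : ℂ → ℂ), MemSobolev h f G →
    eLpNorm (fun z => f z - ⨍ w, f w ∂(weightMeasure h)) q (weightMeasure h) ≤
      K * eLpNorm G 2 discMeasure}

/-- The exponent `2s/(s-1)`, in the form `2/(1-1/s)`, which is `2` for `s = ∞`. -/
def sobolevExponent (s : ℝ≥0∞) : ℝ≥0∞ := 2 / (1 - s⁻¹)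

/-- `d_s(h₁,h₂) = ‖(h₁ - h₂) (min h₁ h₂)^((1-s)/s)‖_{L^s(disc)}`; the exponent `(1-s)/s` is
written `1/s - 1`, which is `-1` for `s = ∞`. -/
def weightDist (s : ℝ≥0∞) (h₁ h₂ : ℂ → ℝ) : ℝ≥0∞ :=
  eLpNorm (fun z => (h₁ z - h₂ z) * (min (h₁ z) (h₂ z)) ^ ((s⁻¹).toReal - 1)) s discMeasure

end NeumannDisc

end

/-! Up to an additive constant, a Sobolev function on the disc is determined by its weak gradient. A
conformal weight is positive almost everywhere and lies in some L^r with r > 1, while the planar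
Sobolev inequality reaches every finite exponent. Square integrability against the weight is
therefore automatic, and both weights lead to the same Hilbert space, the closed subspace
`gradientSpace` of L². The weight h enters only through the operator J_h (`primitive`), which sends
a gradient field G to its primitive of zero h-mean in L²(h). For λ ≠ 0 the eigenvalue equation reads
⟨G, H⟩ = λ⟨J_h G, J_h H⟩ for all H. The nonzero Neumann eigenvalues are thus the reciprocals of the
eigenvalues of J_h†J_h, and λ = 0 contributes exactly the constants. Hence λ_{m+1}[h] = 1/c_m, where
c_m is the m-th largest eigenvalue of J_h†J_h (`eigenvalueCount_of_pos`, `isLeast_succ`). It exists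
because J_h is compact and injective on an infinite-dimensional space. For the comparison, let w be
the primitive of G with zero h₂-mean. The mean minimises the quadratic deviation, so ‖J_{h₁}G‖² ≤ ∫
w² h₁ ≤ ‖J_{h₂}G‖² + ∫ |h₁ - h₂| w². Hölder's inequality bounds the last integral by d_s times the
square of the L^q(h₂) norm of w, hence by C(q)² d_s ‖G‖². By symmetry and Weyl's inequality
(`isGreatest_highSpan_sub_le`) the numbers c_m differ by at most C(q)² d_s, and passing to
reciprocals produces the factor max(λ_n²[h₁], λ_n²[h₂]). The analytic input comes from the
fundamental theorem of calculus along segments of the disc, valid for weak gradients almost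
everywhere. It yields a Sobolev–Poincaré inequality with any finite exponent, which bounds J_h and
makes C(q) finite, and a Poincaré inequality on small convex pieces, which makes J_h compact. -/

namespace NeumannDisc

/-! ### Variational theory of the eigenvalues of J†J, and a compactness criterion -/

section Spectral

variable {K V V' : Type*} [NormedAddCommGroup K] [InnerProductSpace ℝ K] [CompleteSpace K]
  [NormedAddCommGroup V] [InnerProductSpace ℝ V] [CompleteSpace V]
  [NormedAddCommGroup V'] [InnerProductSpace ℝ V'] [CompleteSpace V']

/-- The span of the eigenvectors of `J† J` with eigenvalue at least `c`. -/
def highSpan (J : K →L[ℝ] V) (c : ℝ) : Submodule ℝ K :=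
  Submodule.span ℝ {x | ∃ μ : ℝ, c ≤ μ ∧ ∀ y, inner ℝ (J x) (J y) = μ * inner ℝ x y}

-- For T = J†J one has ‖T‖ = ‖J‖². This number lies in the spectrum because T is nonnegative, and a
-- nonzero spectral value of a compact operator is an eigenvalue.
open ContinuousLinearMap in
theorem exists_eigenvector_norm_sq {J : K →L[ℝ] V} (hJ : IsCompactOperator J) (h0 : J ≠ 0) :
    ∃ x : K, x ≠ 0 ∧ ∀ y, inner ℝ (J x) (J y) = ‖J‖ ^ 2 * inner ℝ x y := by
  have hK : Nontrivial K := by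
    by_contra h
    rw [not_nontrivial_iff_subsingleton] at h
    exact h0 (ContinuousLinearMap.ext fun x => by simp [Subsingleton.elim x 0])
  set T : K →L[ℝ] K := adjoint J ∘L J with hTdef
  have hT : IsCompactOperator T := hJ.clm_comp (adjoint J)
  have hTn : ‖T‖ = ‖J‖ ^ 2 := by
    rw [hTdef, ContinuousLinearMap.norm_adjoint_comp_self, sq]
  have hTpos : ‖T‖ ≠ 0 := by
    rw [hTn]; exact pow_ne_zero _ (norm_ne_zero_iff.2 h0)
  have hTi : ∀ x y, inner ℝ (T x) y = inner ℝ (J x) (J y) := fun x y => by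
    rw [hTdef, ContinuousLinearMap.comp_apply, adjoint_inner_left]
  have hTs : (T : K →ₗ[ℝ] K).IsSymmetric := fun x y => by
    change inner ℝ (T x) y = inner ℝ x (T y)
    rw [hTi, real_inner_comm (T y) x, hTi, real_inner_comm]
  -- Off the spectrum the Rayleigh quotient would stay below ‖T‖ - ε, although it is nonnegative
  -- here and the supremum of its absolute value is ‖T‖.
  have hspec : ‖T‖ ∈ spectrum ℝ T := by
    by_contra hn
    obtain ⟨ε, hε, h⟩ := T.rayleighQuotient_le_of_norm_mem_resolventSet (𝕜 := ℝ)
      (by rw [spectrum, Set.mem_compl_iff, not_not] at hn; exact hn)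
    have h1 : ‖T‖ ≤ ‖T‖ - ε := by
      nth_rewrite 1 [T.norm_eq_iSup_rayleighQuotient hTs]
      refine ciSup_le fun x => ?_
      rw [abs_of_nonneg]
      · exact h x
      · rw [rayleighQuotient, reApplyInnerSelf_apply, hTi]
        exact div_nonneg real_inner_self_nonneg (sq_nonneg _)
    linarith
  obtain ⟨x, hx⟩ := ((hT.hasEigenvalue_iff_mem_spectrum hTpos).2 hspec).exists_hasEigenvector
  refine ⟨x, hx.2, fun y => ?_⟩
  have : T x = ‖T‖ • x := hx.apply_eq_smul
  rw [← hTi, this, real_inner_smul_left, hTn]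

/-- The hard half of the min-max principle. Asking for subspaces only for every c' < c makes the
conclusion stable under suprema, which is how greatest values are shown to be attained. -/
theorem le_rank_highSpan {J : K →L[ℝ] V} (hJ : IsCompactOperator J) {c : ℝ} (hc : 0 < c) {m : ℕ}
    (h : ∀ c' < c, 0 < c' → ∃ L : Submodule ℝ K, Module.finrank ℝ L = m ∧
      ∀ x ∈ L, c' * ‖x‖ ^ 2 ≤ ‖J x‖ ^ 2) :
    (m : Cardinal) ≤ Module.rank ℝ (highSpan J c) := by
  by_contra! hlt
  set E := highSpan J c with hE
  have hfin : FiniteDimensional ℝ E :=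
    Module.rank_lt_aleph0_iff.1 (hlt.trans Cardinal.natCast_lt_aleph0)
  have hlt' : Module.finrank ℝ E < m := by
    rw [← Module.finrank_eq_rank] at hlt; exact_mod_cast hlt
  set J' : Eᗮ →L[ℝ] V := J ∘L Eᗮ.subtypeL with hJ'
  have hJ'c : IsCompactOperator J' := hJ.comp_clm _
  have horth : ∀ x ∈ Eᗮ, ∀ y ∈ E, inner ℝ (J x) (J y) = 0 := by
    intro x hx y hy
    rw [hE, highSpan] at hy
    induction hy using Submodule.span_induction with
    | mem y hy =>
      obtain ⟨μ, hμ, hy'⟩ := hy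
      have hyE : y ∈ E := Submodule.subset_span ⟨μ, hμ, hy'⟩
      rw [real_inner_comm, hy', Submodule.inner_right_of_mem_orthogonal hyE hx, mul_zero]
    | zero => simp
    | add y z _ _ h1 h2 => rw [map_add, inner_add_right, h1, h2, add_zero]
    | smul a y _ h1 => rw [map_smul, real_inner_smul_right, h1, mul_zero]
  -- Otherwise the restriction of J to Eᗮ has an eigenvector for ‖J'‖² ≥ c. Since J maps E and Eᗮ to
  -- orthogonal spaces, it is an eigenvector on all of K, hence lies in both E and Eᗮ.
  have hn : ‖J'‖ ^ 2 < c := by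
    by_contra! hcn
    have h0 : J' ≠ 0 := by
      rintro h0
      have : ‖J'‖ = 0 := by rw [h0, ContinuousLinearMap.opNorm_zero]
      rw [this] at hcn
      norm_num at hcn
      linarith
    obtain ⟨x, hx0, hx⟩ := exists_eigenvector_norm_sq hJ'c h0
    have hxE : (x : K) ∈ E := by
      refine Submodule.subset_span ⟨‖J'‖ ^ 2, hcn, fun y => ?_⟩
      obtain ⟨y1, hy1, y2, hy2, rfl⟩ := E.exists_add_mem_mem_orthogonal y
      have h2 := hx ⟨y2, hy2⟩
      rw [map_add, inner_add_right, inner_add_right, horth x x.2 y1 hy1,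
        Submodule.inner_left_of_mem_orthogonal hy1 x.2, zero_add, zero_add]
      exact h2
    have := Submodule.inner_right_of_mem_orthogonal hxE x.2
    rw [inner_self_eq_zero] at this
    exact hx0 (by ext; exact this)
  obtain ⟨c', h1, h2⟩ := exists_between hn
  have h0 : 0 < c' := lt_of_le_of_lt (sq_nonneg _) h1
  obtain ⟨L, hLm, hL⟩ := h c' h2 h0
  have hLfin : FiniteDimensional ℝ L := Module.finite_of_finrank_pos (by omega)
  -- L has larger dimension than E, so projecting L to E kills some nonzero vector of L. That vector
  -- lies in Eᗮ, where J is too small.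
  let P : L →ₗ[ℝ] E := (E.orthogonalProjectionOnto : K →ₗ[ℝ] E) ∘ₗ L.subtype
  have hker := LinearMap.ker_ne_bot_of_finrank_lt (f := P) (by rw [hLm]; exact hlt')
  obtain ⟨x, hx, hx0⟩ := Submodule.exists_mem_ne_zero_of_ne_bot hker
  have hxE : (x : K) ∈ Eᗮ := by
    rw [LinearMap.mem_ker] at hx
    exact Submodule.orthogonalProjectionOnto_eq_zero_iff.1 hx
  have h3 := hL x x.2
  have h4 : ‖J x‖ ≤ ‖J'‖ * ‖(x : K)‖ := J'.le_opNorm ⟨x, hxE⟩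
  have h5 : ‖J x‖ ^ 2 ≤ ‖J'‖ ^ 2 * ‖(x : K)‖ ^ 2 := by
    rw [← mul_pow]; exact pow_le_pow_left₀ (norm_nonneg _) h4 2
  have h6 : 0 < ‖(x : K)‖ ^ 2 := by
    have : (x : K) ≠ 0 := by simpa using hx0
    positivity
  nlinarith

-- Eigenspaces of J†J for distinct eigenvalues are orthogonal, so both sides are diagonal in the
-- eigenvector decomposition of x.
open ContinuousLinearMap in
theorem le_norm_sq_of_mem_highSpan (J : K →L[ℝ] V) {c : ℝ} {x : K} (hx : x ∈ highSpan J c) :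
    c * ‖x‖ ^ 2 ≤ ‖J x‖ ^ 2 := by
  set T : K →L[ℝ] K := adjoint J ∘L J with hTdef
  have hTi : ∀ x y, inner ℝ (T x) y = inner ℝ (J x) (J y) := fun x y => by
    rw [hTdef, ContinuousLinearMap.comp_apply, adjoint_inner_left]
  have hTs : (T : K →ₗ[ℝ] K).IsSymmetric := fun x y => by
    change inner ℝ (T x) y = inner ℝ x (T y)
    rw [hTi, real_inner_comm (T y) x, hTi, real_inner_comm]
  let W : {μ : ℝ // c ≤ μ} → Submodule ℝ K := fun μ => Module.End.eigenspace (T : K →ₗ[ℝ] K) μ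
  have hle : highSpan J c ≤ ⨆ μ, W μ := by
    refine Submodule.span_le.2 ?_
    rintro x ⟨μ, hμ, h⟩
    refine Submodule.mem_iSup_of_mem ⟨μ, hμ⟩ ?_
    change x ∈ Module.End.eigenspace (T : K →ₗ[ℝ] K) μ
    rw [Module.End.mem_eigenspace_iff]
    refine ext_inner_right ℝ fun y => ?_
    rw [real_inner_smul_left, ← h y]
    exact hTi x y
  have hW : OrthogonalFamily ℝ (fun μ => W μ) fun μ => (W μ).subtypeₗᵢ :=
    hTs.orthogonalFamily_eigenspaces.comp (f := fun μ : {μ : ℝ // c ≤ μ} => (μ : ℝ))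
      Subtype.coe_injective
  obtain ⟨f, hf, rfl⟩ := (Submodule.mem_iSup_iff_exists_finsupp _ _).1 (hle hx)
  let l : ∀ μ, W μ := fun μ => ⟨f μ, hf μ⟩
  have h1 : ‖f.sum fun _ y => y‖ ^ 2 = ∑ μ ∈ f.support, ‖f μ‖ ^ 2 := hW.norm_sum l f.support
  have h2 : ‖J (f.sum fun _ y => y)‖ ^ 2 = ∑ μ ∈ f.support, (μ : ℝ) * ‖f μ‖ ^ 2 := by
    rw [← real_inner_self_eq_norm_sq, ← hTi]
    have hT : T (f.sum fun _ y => y) = ∑ μ ∈ f.support, ((μ : ℝ) • f μ) := by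
      rw [Finsupp.sum, map_sum]
      refine Finset.sum_congr rfl fun μ _ => ?_
      exact Module.End.mem_eigenspace_iff.1 (hf μ)
    rw [hT]
    have := hW.inner_sum (fun μ => (μ : ℝ) • l μ) l f.support
    refine this.trans (Finset.sum_congr rfl fun μ _ => ?_)
    rw [real_inner_smul_left, real_inner_self_eq_norm_sq]
    rfl
  rw [h1, h2, Finset.mul_sum]
  exact Finset.sum_le_sum fun μ _ => mul_le_mul_of_nonneg_right μ.2 (sq_nonneg _)

theorem exists_finrank_eq_of_le_rank {K : Type*} [AddCommGroup K] [Module ℝ K] {W : Submodule ℝ K} {m : ℕ}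
    (h : (m : Cardinal) ≤ Module.rank ℝ W) :
    ∃ L : Submodule ℝ K, L ≤ W ∧ Module.finrank ℝ L = m := by
  obtain ⟨v, hv⟩ := Module.le_rank_iff.1 h
  have hv' : LinearIndependent ℝ (fun i => (v i : K)) := hv.map' W.subtype W.ker_subtype
  refine ⟨Submodule.span ℝ (Set.range fun i => (v i : K)), ?_, ?_⟩
  · refine Submodule.span_le.2 ?_
    rintro _ ⟨i, rfl⟩
    exact (v i).2
  · rw [finrank_span_eq_card hv', Fintype.card_fin]

theorem le_norm_sq_of_le_rank {J : K →L[ℝ] V} {m : ℕ} (hm : 1 ≤ m) {c : ℝ}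
    (h : (m : Cardinal) ≤ Module.rank ℝ (highSpan J c)) : c ≤ ‖J‖ ^ 2 := by
  obtain ⟨L, hL, hLm⟩ := exists_finrank_eq_of_le_rank h
  have : Nontrivial L := Module.nontrivial_of_finrank_pos (R := ℝ) (by omega)
  obtain ⟨x, hx⟩ := exists_ne (0 : L)
  have h1 := le_norm_sq_of_mem_highSpan J (hL x.2)
  have h5 : ‖J x‖ ^ 2 ≤ ‖J‖ ^ 2 * ‖(x : K)‖ ^ 2 := by
    rw [← mul_pow]; exact pow_le_pow_left₀ (norm_nonneg _) (J.le_opNorm _) 2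
  have h6 : 0 < ‖(x : K)‖ ^ 2 := by
    have : (x : K) ≠ 0 := by simpa using hx
    positivity
  exact le_of_mul_le_mul_right (h1.trans h5) h6

/-- The greatest c is the m-th largest eigenvalue of J†J, counted with multiplicity. The set is
bounded by ‖J‖², nonempty because J is bounded below on any m-dimensional subspace, and contains its
supremum by `le_rank_highSpan`. -/
theorem exists_isGreatest_le_rank_highSpan {J : K →L[ℝ] V} (hJ : IsCompactOperator J)
    (hinj : Function.Injective J) (hK : ¬ FiniteDimensional ℝ K) {m : ℕ} (hm : 1 ≤ m) :
    ∃ c, IsGreatest {c : ℝ | 0 < c ∧ (m : Cardinal) ≤ Module.rank ℝ (highSpan J c)} c := by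
  set B := {c : ℝ | 0 < c ∧ (m : Cardinal) ≤ Module.rank ℝ (highSpan J c)} with hB
  have hbdd : BddAbove B := ⟨‖J‖ ^ 2, fun c hc => le_norm_sq_of_le_rank hm hc.2⟩
  have hne : B.Nonempty := by
    have hrank : (m : Cardinal) ≤ Module.rank ℝ (⊤ : Submodule ℝ K) := by
      rw [rank_top]
      have := mt Module.rank_lt_aleph0_iff.1 hK
      exact Cardinal.natCast_lt_aleph0.le.trans (not_lt.1 this)
    obtain ⟨L, -, hL⟩ := exists_finrank_eq_of_le_rank hrank
    have : FiniteDimensional ℝ L := Module.finite_of_finrank_pos (by omega)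
    have : Nontrivial L := Module.nontrivial_of_finrank_pos (R := ℝ) (by omega)
    obtain ⟨κ, hκ, hanti⟩ := (J.toLinearMap ∘ₗ L.subtype).exists_antilipschitzWith
      (LinearMap.ker_eq_bot.2 (hinj.comp L.subtype_injective))
    have hκ' : (0 : ℝ) < κ := hκ
    refine ⟨(κ : ℝ)⁻¹ ^ 2, by positivity, le_rank_highSpan hJ (by positivity) fun c' hc' _ =>
      ⟨L, hL, fun x hx => ?_⟩⟩
    have h1 : ‖x‖ ≤ κ * ‖J x‖ := by simpa using hanti.le_mul_dist (⟨x, hx⟩ : L) 0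
    calc c' * ‖x‖ ^ 2 ≤ (κ : ℝ)⁻¹ ^ 2 * (κ * ‖J x‖) ^ 2 := by gcongr
      _ = ‖J x‖ ^ 2 := by field_simp
  refine ⟨sSup B, ?_, fun c hc => le_csSup hbdd hc⟩
  have hpos : 0 < sSup B := by
    obtain ⟨c, hc⟩ := hne
    exact hc.1.trans_le (le_csSup hbdd hc)
  refine ⟨hpos, le_rank_highSpan hJ hpos fun c' hc' _ => ?_⟩
  obtain ⟨c, hc, hlt⟩ := exists_lt_of_lt_csSup hne hc'
  obtain ⟨L, hL, hLm⟩ := exists_finrank_eq_of_le_rank hc.2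
  refine ⟨L, hLm, fun x hx => le_trans ?_ (le_norm_sq_of_mem_highSpan J (hL hx))⟩
  gcongr

/-- Weyl's inequality: the spectral subspace that realises c for J is a trial subspace for J' at
level c - δ. -/
theorem isGreatest_highSpan_sub_le {J : K →L[ℝ] V} {J' : K →L[ℝ] V'}
    (hJ' : IsCompactOperator J') {m : ℕ} {c c' δ : ℝ}
    (hc : IsGreatest {c : ℝ | 0 < c ∧ (m : Cardinal) ≤ Module.rank ℝ (highSpan J c)} c)
    (hc' : IsGreatest {c : ℝ | 0 < c ∧ (m : Cardinal) ≤ Module.rank ℝ (highSpan J' c)} c')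
    (hδ : ∀ x, ‖J x‖ ^ 2 - ‖J' x‖ ^ 2 ≤ δ * ‖x‖ ^ 2) : c - c' ≤ δ := by
  by_contra! h
  have hpos : 0 < c - δ := by linarith [hc'.1.1]
  obtain ⟨L, hL, hLm⟩ := exists_finrank_eq_of_le_rank hc.1.2
  have : c - δ ≤ c' := hc'.2 ⟨hpos, le_rank_highSpan hJ' hpos fun a ha _ => ⟨L, hLm, fun x hx => by
    have h1 := le_norm_sq_of_mem_highSpan J (hL hx)
    have h2 := hδ x
    have h3 : a * ‖x‖ ^ 2 ≤ (c - δ) * ‖x‖ ^ 2 := by gcongr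
    linarith⟩⟩
  linarith

/-- An operator is compact as soon as it is small on closed subspaces of finite codimension. -/
theorem isCompactOperator_of_small_on_ker (J : K →L[ℝ] V)
    (h : ∀ ε > 0, ∃ (ι : Type) (_ : Fintype ι) (l : K →L[ℝ] (ι → ℝ)), ∀ x, l x = 0 → ‖J x‖ ≤ ε * ‖x‖) :
    IsCompactOperator J := by
  have hε : ∀ k : ℕ, ∃ A : K →L[ℝ] V, IsCompactOperator A ∧ ‖A - J‖ ≤ 1 / ((k : ℝ) + 1) := by
    intro k
    obtain ⟨ι, _, l, hl⟩ := h (1 / ((k : ℝ) + 1)) (by positivity)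
    set M : Submodule ℝ K := LinearMap.ker (l : K →ₗ[ℝ] (ι → ℝ)) with hM
    have hMc : IsClosed (M : Set K) := l.isClosed_ker
    have : CompleteSpace M := hMc.completeSpace_coe
    have hfin : FiniteDimensional ℝ Mᗮ := by
      refine Module.Finite.of_injective ((l : K →ₗ[ℝ] (ι → ℝ)) ∘ₗ Mᗮ.subtype) ?_
      rw [← LinearMap.ker_eq_bot, LinearMap.ker_eq_bot']
      intro x hx
      have hxM : (x : K) ∈ M := hx
      have := Submodule.inner_right_of_mem_orthogonal hxM x.2
      rw [inner_self_eq_zero] at this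
      ext; exact this
    -- The finite-rank approximant is J after the projection to Mᗮ. The error is J after the
    -- projection to M = ker l, where J is small by hypothesis.
    refine ⟨J ∘L Mᗮ.subtypeL ∘L Mᗮ.orthogonalProjectionOnto, ?_, ?_⟩
    · exact ((isCompactOperator_of_locallyCompactSpace_rng
        (ContinuousLinearMap.id ℝ Mᗮ)).clm_comp (J ∘L Mᗮ.subtypeL)).comp_clm
          Mᗮ.orthogonalProjectionOnto
    · rw [← norm_neg]
      refine ContinuousLinearMap.opNorm_le_bound _ (by positivity) fun x => ?_
      have h1 : (M.orthogonalProjectionOnto x : K) + (Mᗮ.orthogonalProjectionOnto x : K) = x :=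
        M.starProjection_add_starProjection_orthogonal x
      have h2 : (-(J ∘L Mᗮ.subtypeL ∘L Mᗮ.orthogonalProjectionOnto - J)) x
          = J (M.orthogonalProjectionOnto x : K) := by
        have : J x = J (M.orthogonalProjectionOnto x : K) + J (Mᗮ.orthogonalProjectionOnto x : K) := by
          rw [← map_add, h1]
        change -(J (Mᗮ.orthogonalProjectionOnto x : K) - J x) = _
        rw [this]
        abel
      rw [h2]
      refine (hl _ (M.orthogonalProjectionOnto x).2).trans ?_
      gcongr
      exact M.norm_orthogonalProjectionOnto_apply_le x
  choose A hA hAn using hε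
  refine isCompactOperator_of_tendsto (l := Filter.atTop) (F := A) ?_ (Filter.Eventually.of_forall hA)
  rw [tendsto_iff_norm_sub_tendsto_zero]
  exact squeeze_zero (fun _ => norm_nonneg _) hAn tendsto_one_div_add_atTop_nhds_zero_nat

end Spectral

/-! ### The fundamental theorem of calculus for weak gradients along segments -/

theorem isOpen_disc : IsOpen disc := Metric.isOpen_ball

theorem measurableSet_disc : MeasurableSet disc := isOpen_disc.measurableSet

theorem convex_disc : Convex ℝ disc := convex_ball 0 1

theorem add_smul_mem_disc {x v : ℂ} (hx : x ∈ disc) (hv : x + v ∈ disc) {t : ℝ}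
    (ht : t ∈ Set.Icc (0 : ℝ) 1) : x + t • v ∈ disc :=
  convex_disc.add_smul_mem hx hv ht

theorem integrable_shear {g : ℂ → ℝ} (hg : Measurable g) (hgi : Integrable g) (v : ℂ) :
    Integrable (fun p : ℂ × ℝ => g (p.1 + p.2 • v))
      ((volume : Measure ℂ).prod (volume.restrict (Set.Ioc (0 : ℝ) 1))) := by
  have hm : Measurable fun p : ℂ × ℝ => g (p.1 + p.2 • v) :=
    hg.comp (measurable_fst.add (measurable_snd.smul_const v))
  rw [integrable_prod_iff' hm.aestronglyMeasurable]
  refine ⟨Filter.Eventually.of_forall fun t => hgi.comp_add_right (t • v), ?_⟩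
  have : (fun t : ℝ => ∫ x, ‖g (x + t • v)‖) = fun _ => ∫ x, ‖g x‖ := by
    ext t
    exact integral_add_right_eq_self (fun x => ‖g x‖) (t • v)
  simp only [this]
  exact integrable_const _

/-- The difference of the two sides is tested against smooth η. Moving the translation from f to η
turns the increment of f into an average over t of directional derivatives of translates of η, to
which the weak gradient identity applies; Fubini reassembles the result. -/
theorem ae_sub_eq_integral_of_isWeakGradient {f : ℂ → ℝ} {G : ℂ → ℂ}
    (hG : Measurable G) (hGi : Integrable G) (hfG : IsWeakGradient f G) (v : ℂ) :
    ∀ᵐ x, x ∈ disc → x + v ∈ disc →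
      f (x + v) - f x = ∫ t in (0 : ℝ)..1, inner ℝ (G (x + t • v)) v := by
  set g : ℂ → ℝ := fun z => inner ℝ (G z) v with hgdef
  have hg : Measurable g := hG.inner measurable_const
  have hgi : Integrable g := hGi.inner_const v
  have hsh := integrable_shear hg hgi v
  set U : Set ℂ := disc ∩ (fun x => x + v) ⁻¹' disc with hU
  have hUo : IsOpen U := isOpen_disc.inter (isOpen_disc.preimage (by fun_prop))
  have hR : Integrable (fun x => ∫ t in (0 : ℝ)..1, g (x + t • v)) := by
    simp only [intervalIntegral.integral_of_le zero_le_one]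
    exact hsh.integral_prod_left
  have hshift : LocallyIntegrableOn (fun x => f (x + v)) U := by
    rw [locallyIntegrableOn_iff hUo.isLocallyClosed]
    intro k hkU hk
    have h1 : IntegrableOn f ((fun x => x + v) '' k) :=
      hfG.1.integrableOn_compact_subset (by
        rintro _ ⟨x, hx, rfl⟩
        exact (hkU hx).2) (hk.image (by fun_prop))
    have := ((measurePreserving_add_right volume v).integrableOn_image
      (MeasurableEquiv.addRight v).measurableEmbedding (f := f) (s := k)).1 h1
    exact this
  have hloc : LocallyIntegrableOn
      (fun x => f (x + v) - f x - ∫ t in (0 : ℝ)..1, g (x + t • v)) U :=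
    (hshift.sub (hfG.1.mono_set Set.inter_subset_left)).sub
      (hR.locallyIntegrable.locallyIntegrableOn U)
  have key := hUo.ae_eq_zero_of_integral_contDiff_smul_eq_zero (μ := volume) hloc ?_
  · filter_upwards [key] with x hx h1 h2
    exact sub_eq_zero.1 (hx ⟨h1, h2⟩)
  intro η hη hηc hηU
  -- K' is the region swept by the support of η along the segments in direction v. It is compact
  -- and, by convexity, inside the disc; cutting f off to K' makes it integrable without changing
  -- any integral below.
  set K' : Set ℂ := (fun p : ℂ × ℝ => p.1 + p.2 • v) '' (tsupport η ×ˢ Set.Icc (0 : ℝ) 1) with hK'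
  have hK'c : IsCompact K' := (hηc.isCompact.prod isCompact_Icc).image (by fun_prop)
  have hK'D : K' ⊆ disc := by
    rintro _ ⟨⟨x, t⟩, ⟨hx, ht⟩, rfl⟩
    exact add_smul_mem_disc (hηU hx).1 (hηU hx).2 ht
  have hK'm : MeasurableSet K' := hK'c.isClosed.measurableSet
  have hmemK' : ∀ (x : ℂ) (t : ℝ), t ∈ Set.Icc (0 : ℝ) 1 → x - t • v ∈ tsupport η → x ∈ K' :=
    fun x t ht hx => ⟨(x - t • v, t), ⟨hx, ht⟩, by simp⟩
  set f₀ : ℂ → ℝ := K'.indicator f with hf₀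
  have hf₀i : Integrable f₀ :=
    (integrable_indicator_iff hK'm).2 (hfG.1.integrableOn_compact_subset hK'D hK'c)
  have hηcont : Continuous η := hη.continuous
  obtain ⟨Cη, hCη⟩ := hηcont.bounded_above_of_compact_support hηc
  have hdcont : Continuous (fderiv ℝ η) := hη.continuous_fderiv (by simp)
  obtain ⟨Cd, hCd⟩ := hdcont.bounded_above_of_compact_support (hηc.fderiv ℝ)
  have hbdη : ∀ {u : ℂ → ℝ}, Integrable u → Integrable fun x => η x * u x := fun hu =>
    hu.bdd_mul hηcont.aestronglyMeasurable (Filter.Eventually.of_forall hCη)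
  have hpt : ∀ x, η x • (f (x + v) - f x - ∫ t in (0 : ℝ)..1, g (x + t • v))
      = η x * f₀ (x + v) - η x * f₀ x - η x * ∫ t in (0 : ℝ)..1, g (x + t • v) := by
    intro x
    by_cases hx : x ∈ tsupport η
    · have h0 : x ∈ K' := hmemK' x 0 (by simp) (by simpa using hx)
      have h1 : x + v ∈ K' := hmemK' (x + v) 1 (by simp) (by simpa using hx)
      rw [hf₀, Set.indicator_of_mem h0, Set.indicator_of_mem h1, smul_eq_mul]
      ring
    · simp [image_eq_zero_of_notMem_tsupport hx]
  have i1 : Integrable fun x => η x * f₀ (x + v) := hbdη (hf₀i.comp_add_right v)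
  have i2 : Integrable fun x => η x * f₀ x := hbdη hf₀i
  have i3 := hbdη hR
  simp only [hpt]
  have i12 : Integrable fun x => η x * f₀ (x + v) - η x * f₀ x := i1.sub i2
  rw [integral_sub i12 i3, integral_sub i1 i2]
  have e1 : ∫ x, η x * f₀ (x + v) = ∫ x, η (x - v) * f₀ x := by
    rw [← integral_add_right_eq_self (fun x => η (x - v) * f₀ x) v]
    simp
  have i1' : Integrable fun x => η (x - v) * f₀ x := by
    have := i1.comp_sub_right v
    simpa using this
  have e2 : (∫ x, η x * f₀ (x + v)) - ∫ x, η x * f₀ x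
      = -∫ x, ∫ t in Set.Ioc (0 : ℝ) 1, f₀ x * fderiv ℝ η (x - t • v) v := by
    rw [e1, ← integral_sub i1' i2, ← integral_neg]
    congr 1
    ext x
    have hd : ∀ t ∈ Set.uIcc (0 : ℝ) 1,
        HasDerivAt (fun t : ℝ => η (x - t • v)) (-(fderiv ℝ η (x - t • v) v)) t := by
      intro t _
      have h1 : HasDerivAt (fun t : ℝ => x - t • v) (-v) t := by
        simpa using ((hasDerivAt_id t).smul_const v).const_sub x
      have h2 := ((hη.differentiable (by simp)) (x - t • v)).hasFDerivAt.comp_hasDerivAt t h1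
      rw [map_neg] at h2
      exact h2
    have hint := intervalIntegral.integral_eq_sub_of_hasDerivAt hd
      (Continuous.intervalIntegrable (by fun_prop) _ _)
    rw [intervalIntegral.integral_neg, intervalIntegral.integral_of_le zero_le_one] at hint
    rw [integral_const_mul, ← mul_neg, hint]
    simp
    ring
  have iΦ : Integrable (Function.uncurry fun (x : ℂ) (t : ℝ) => f₀ x * fderiv ℝ η (x - t • v) v)
      ((volume : Measure ℂ).prod (volume.restrict (Set.Ioc (0 : ℝ) 1))) := by
    have h1 : Integrable (fun p : ℂ × ℝ => f₀ p.1)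
        ((volume : Measure ℂ).prod (volume.restrict (Set.Ioc (0 : ℝ) 1))) := hf₀i.comp_fst _
    refine h1.mul_bdd (c := Cd * ‖v‖) ?_ (Filter.Eventually.of_forall fun p => ?_)
    · exact Continuous.aestronglyMeasurable (by fun_prop)
    · exact (ContinuousLinearMap.le_opNorm _ _).trans
        (mul_le_mul_of_nonneg_right (hCd _) (norm_nonneg _))
  rw [e2, integral_integral_swap iΦ]
  -- For fixed t this is the weak gradient identity for the translated test function η(· - tv),
  -- followed by a translation back.
  have e3 : ∀ t ∈ Set.Ioc (0 : ℝ) 1, (∫ x, f₀ x * fderiv ℝ η (x - t • v) v)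
      = -∫ x, η x * g (x + t • v) := by
    intro t ht
    have ht' : t ∈ Set.Icc (0 : ℝ) 1 := Set.Ioc_subset_Icc_self ht
    set ηt : ℂ → ℝ := fun x => η (x - t • v) with hηt
    have hηts : tsupport ηt ⊆ K' := by
      intro x hx
      refine hmemK' x t ht' ?_
      exact tsupport_comp_subset_preimage η (f := fun x => x - t • v) (by fun_prop) hx
    have hηtc : HasCompactSupport ηt := hK'c.of_isClosed_subset (isClosed_tsupport _) hηts
    have hηtd : ContDiff ℝ ∞ ηt := hη.comp (contDiff_id.sub contDiff_const)
    have hfd : ∀ x, fderiv ℝ ηt x = fderiv ℝ η (x - t • v) := fun x => fderiv_comp_sub _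
    have hw := hfG.2.2 ηt hηtd hηtc (hηts.trans hK'D) v
    have h1 : (∫ x, f₀ x * fderiv ℝ η (x - t • v) v) = ∫ z in disc, f z * fderiv ℝ ηt z v := by
      rw [← integral_indicator measurableSet_disc]
      congr 1
      ext x
      rw [← hfd]
      by_cases hx : x ∈ tsupport ηt
      · rw [Set.indicator_of_mem (hK'D (hηts hx)), hf₀, Set.indicator_of_mem (hηts hx)]
      · have h0 : fderiv ℝ ηt x = 0 := by
          have := mt (fun h => tsupport_fderiv_subset ℝ h) hx
          exact image_eq_zero_of_notMem_tsupport this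
        have : (disc.indicator fun z => f z * fderiv ℝ ηt z v) x = 0 := by
          rw [Set.indicator_apply_eq_zero]
          intro _
          simp [h0]
        rw [this, h0]
        simp
    have h2 : (∫ z in disc, inner ℝ (G z) v * ηt z) = ∫ x, η x * g (x + t • v) := by
      rw [← integral_indicator measurableSet_disc,
        ← integral_sub_right_eq_self (fun x => η x * g (x + t • v)) (t • v)]
      congr 1
      ext x
      by_cases hx : x ∈ disc
      · rw [Set.indicator_of_mem hx]
        simp [hgdef, hηt, mul_comm]
      · rw [Set.indicator_of_notMem hx]
        have : x ∉ tsupport ηt := fun h => hx (hK'D (hηts h))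
        have h0 : η (x - t • v) = 0 := image_eq_zero_of_notMem_tsupport (f := ηt) this
        rw [h0, zero_mul]
    rw [h1, hw, h2]
  rw [setIntegral_congr_fun measurableSet_Ioc e3, integral_neg, neg_neg]
  have iΨ : Integrable (Function.uncurry fun (x : ℂ) (t : ℝ) => η x * g (x + t • v))
      ((volume : Measure ℂ).prod (volume.restrict (Set.Ioc (0 : ℝ) 1))) :=
    hsh.bdd_mul (hηcont.comp continuous_fst).aestronglyMeasurable
      (Filter.Eventually.of_forall fun p => hCη p.1)
  rw [← integral_integral_swap iΨ, ← integral_sub]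
  · refine integral_eq_zero_of_ae (Filter.Eventually.of_forall fun x => ?_)
    simp [integral_const_mul, intervalIntegral.integral_of_le zero_le_one]
  · exact iΨ.integral_prod_left
  · exact i3

/-! ### Integral estimates over segments -/

theorem lintegral_sq_le {α : Type*} [MeasurableSpace α] (ν : Measure α) {a : α → ℝ≥0∞}
    (ha : AEMeasurable a ν) : (∫⁻ x, a x ∂ν) ^ 2 ≤ ν Set.univ * ∫⁻ x, a x ^ 2 ∂ν := by
  have h := ENNReal.lintegral_mul_le_Lp_mul_Lq ν Real.HolderConjugate.two_two
    (aemeasurable_const (b := (1 : ℝ≥0∞))) ha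
  simp only [Pi.mul_apply, one_mul, ENNReal.rpow_two, one_pow, lintegral_one] at h
  calc (∫⁻ x, a x ∂ν) ^ 2
      ≤ (ν Set.univ ^ (1 / 2 : ℝ) * (∫⁻ x, a x ^ 2 ∂ν) ^ (1 / 2 : ℝ)) ^ 2 := by gcongr
    _ = _ := by
      rw [mul_pow, ← ENNReal.rpow_natCast, ← ENNReal.rpow_natCast, ← ENNReal.rpow_mul,
        ← ENNReal.rpow_mul]
      norm_num

theorem lintegral_comp_smul_add {k : ℂ → ℝ≥0∞} (hk : Measurable k) {a : ℝ} (ha : a ≠ 0) (b : ℂ) :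
    ∫⁻ w, k (a • w + b) = ENNReal.ofReal ((a ^ 2)⁻¹) * ∫⁻ w, k w := by
  have h1 : ∫⁻ w, k (a • w + b) = ∫⁻ w, k (w + b) ∂(Measure.map (a • ·) (volume : Measure ℂ)) := by
    rw [lintegral_map (f := fun w => k (w + b)) (by fun_prop) (measurable_const_smul a)]
  rw [h1, Measure.map_addHaar_smul _ ha, lintegral_smul_measure, lintegral_add_right_eq_self,
    Complex.finrank_real_complex, abs_of_nonneg (by positivity), smul_eq_mul]

/-- `f` oscillates along almost every segment of the disc by at most the integral of `g`. -/
def SegmentBound (f : ℂ → ℝ) (g : ℂ → ℝ≥0∞) : Prop :=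
  ∀ᵐ x ∂discMeasure, ∀ᵐ y ∂discMeasure,
    ‖f x - f y‖ₑ ≤ ∫⁻ t in Set.Ioc (0 : ℝ) 1, ‖y - x‖ₑ * g (x + t • (y - x))

/-- The previous identity holds for every v and almost every x. Measurability of the exceptional set
allows exchanging the quantifiers, and the substitution y = x + v gives almost every pair of points.
-/
theorem segmentBound_of_isWeakGradient {f : ℂ → ℝ} {G : ℂ → ℂ} (hf : Measurable f)
    (hG : Measurable G) (hGi : Integrable G) (hfG : IsWeakGradient f G) :
    SegmentBound f fun z => ‖G z‖ₑ := by
  have hA : Measurable fun p : ℂ × ℂ =>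
      ∫⁻ t in Set.Ioc (0 : ℝ) 1, ‖p.1‖ₑ * ‖G (p.2 + t • p.1)‖ₑ :=
    Measurable.lintegral_prod_right' (f := fun q : (ℂ × ℂ) × ℝ =>
      ‖q.1.1‖ₑ * ‖G (q.1.2 + q.2 • q.1.1)‖ₑ) (by fun_prop)
  have hS : MeasurableSet {p : ℂ × ℂ | p.2 ∈ disc → p.2 + p.1 ∈ disc →
      ‖f (p.2 + p.1) - f p.2‖ₑ ≤ ∫⁻ t in Set.Ioc (0 : ℝ) 1, ‖p.1‖ₑ * ‖G (p.2 + t • p.1)‖ₑ} := by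
    have h1 : MeasurableSet {p : ℂ × ℂ | p.2 ∈ disc} := measurable_snd measurableSet_disc
    have h2 : MeasurableSet {p : ℂ × ℂ | p.2 + p.1 ∈ disc} :=
      (measurable_snd.add measurable_fst) measurableSet_disc
    have h3 := measurableSet_le (f := fun p : ℂ × ℂ => ‖f (p.2 + p.1) - f p.2‖ₑ) (by fun_prop) hA
    exact h1.imp (h2.imp h3)
  have hv : ∀ v : ℂ, ∀ᵐ x, x ∈ disc → x + v ∈ disc →
      ‖f (x + v) - f x‖ₑ ≤ ∫⁻ t in Set.Ioc (0 : ℝ) 1, ‖v‖ₑ * ‖G (x + t • v)‖ₑ := by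
    intro v
    filter_upwards [ae_sub_eq_integral_of_isWeakGradient hG hGi hfG v] with x hx h1 h2
    rw [hx h1 h2, intervalIntegral.integral_of_le zero_le_one]
    refine (enorm_integral_le_lintegral_enorm _).trans (lintegral_mono fun t => ?_)
    rw [mul_comm, ← ofReal_norm, ← ofReal_norm, ← ofReal_norm, ← ENNReal.ofReal_mul (norm_nonneg _)]
    exact ENNReal.ofReal_le_ofReal (norm_inner_le_norm _ _)
  have hswap : ∀ᵐ x : ℂ, ∀ᵐ v : ℂ, x ∈ disc → x + v ∈ disc →
      ‖f (x + v) - f x‖ₑ ≤ ∫⁻ t in Set.Ioc (0 : ℝ) 1, ‖v‖ₑ * ‖G (x + t • v)‖ₑ :=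
    Measure.ae_ae_comm hS |>.1 (Filter.Eventually.of_forall hv)
  rw [SegmentBound, discMeasure, ae_restrict_iff' measurableSet_disc]
  filter_upwards [hswap] with x hx hxD
  rw [ae_restrict_iff' measurableSet_disc]
  have := (measurePreserving_sub_right (volume : Measure ℂ) x).quasiMeasurePreserving.ae hx
  filter_upwards [this] with y hy hyD
  have h := hy hxD (by simpa using hyD)
  rw [add_sub_cancel] at h
  rwa [← enorm_neg, neg_sub]

/-- One substitutes for the variable with the larger coefficient: for y if t ≥ 1/2, for x otherwise.
The Jacobian factor is then at most (1/2)⁻² = 4, uniformly in t. -/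
theorem lintegral_lintegral_comp_segment_le {k : ℂ → ℝ≥0∞} (hk : Measurable k) {Q : Set ℂ}
    {t : ℝ} (ht : t ∈ Set.Ioc (0 : ℝ) 1) :
    ∫⁻ x in Q, ∫⁻ y in Q, k (x + t • (y - x)) ≤ 4 * volume Q * ∫⁻ w, k w := by
  have hinv : ∀ a : ℝ, 1 / 2 ≤ a → ENNReal.ofReal ((a ^ 2)⁻¹) ≤ 4 := by
    intro a ha
    have : (a ^ 2)⁻¹ ≤ 4 := by
      rw [inv_le_comm₀ (by positivity) (by norm_num)]
      nlinarith
    simpa using ENNReal.ofReal_le_ofReal this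
  rcases le_total (1 / 2) t with h | h
  · have h1 : ∀ x, ∫⁻ y in Q, k (x + t • (y - x)) ≤ 4 * ∫⁻ w, k w := by
      intro x
      calc ∫⁻ y in Q, k (x + t • (y - x)) ≤ ∫⁻ y, k (x + t • (y - x)) := setLIntegral_le_lintegral _ _
        _ = ∫⁻ y, k (t • y + (x - t • x)) := by
          congr 1; ext y; congr 1; rw [smul_sub]; ring
        _ = ENNReal.ofReal ((t ^ 2)⁻¹) * ∫⁻ w, k w :=
          lintegral_comp_smul_add hk ht.1.ne' _
        _ ≤ _ := by gcongr; exact hinv t h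
    calc _ ≤ ∫⁻ x in Q, 4 * ∫⁻ w, k w := lintegral_mono h1
      _ = _ := by rw [setLIntegral_const]; ring
  · rw [lintegral_lintegral_swap (by
      exact (hk.comp (by fun_prop : Measurable fun p : ℂ × ℂ => p.1 + t • (p.2 - p.1))).aemeasurable)]
    have h1 : ∀ y, ∫⁻ x in Q, k (x + t • (y - x)) ≤ 4 * ∫⁻ w, k w := by
      intro y
      calc ∫⁻ x in Q, k (x + t • (y - x)) ≤ ∫⁻ x, k (x + t • (y - x)) := setLIntegral_le_lintegral _ _
        _ = ∫⁻ x, k ((1 - t) • x + t • y) := by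
          congr 1; ext x; congr 1; rw [smul_sub, sub_smul, one_smul]; ring
        _ = ENNReal.ofReal (((1 - t) ^ 2)⁻¹) * ∫⁻ w, k w :=
          lintegral_comp_smul_add hk (by linarith) _
        _ ≤ _ := by gcongr; exact hinv (1 - t) (by linarith)
    calc _ ≤ ∫⁻ y in Q, 4 * ∫⁻ w, k w := lintegral_mono h1
      _ = _ := by rw [setLIntegral_const]; ring

theorem ae_restrict_of_subset_disc {Q : Set ℂ} (hQD : Q ⊆ disc) {P : ℂ → Prop}
    (h : ∀ᵐ x ∂discMeasure, P x) : ∀ᵐ x ∂(volume.restrict Q), P x :=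
  ae_mono (Measure.restrict_mono hQD le_rfl) h

/-- Convexity keeps the segments inside Q, so only the values of g on Q enter. The explicit
dependence on the diameter bound d later gives smallness on fine grids. -/
theorem SegmentBound.lintegral_sq_le {f : ℂ → ℝ} {g : ℂ → ℝ≥0∞} (hfg : SegmentBound f g)
    (hg : Measurable g) {Q : Set ℂ} (hQ : MeasurableSet Q) (hQc : Convex ℝ Q) (hQD : Q ⊆ disc)
    {d : ℝ≥0∞} (hd : ∀ x ∈ Q, ∀ y ∈ Q, ‖y - x‖ₑ ≤ d) :
    ∫⁻ x in Q, ∫⁻ y in Q, ‖f x - f y‖ₑ ^ 2 ≤ 4 * d ^ 2 * volume Q * ∫⁻ z in Q, g z ^ 2 := by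
  set k : ℂ → ℝ≥0∞ := Q.indicator fun z => g z ^ 2 with hk
  have hkm : Measurable k := (hg.pow_const 2).indicator hQ
  have hpt : ∀ᵐ x ∂(volume.restrict Q), ∀ᵐ y ∂(volume.restrict Q),
      ‖f x - f y‖ₑ ^ 2 ≤ d ^ 2 * ∫⁻ t in Set.Ioc (0 : ℝ) 1, k (x + t • (y - x)) := by
    filter_upwards [ae_restrict_of_subset_disc hQD hfg, ae_restrict_mem hQ] with x hx hxQ
    filter_upwards [ae_restrict_of_subset_disc hQD hx, ae_restrict_mem hQ] with y hy hyQ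
    calc ‖f x - f y‖ₑ ^ 2
        ≤ (∫⁻ t in Set.Ioc (0 : ℝ) 1, ‖y - x‖ₑ * g (x + t • (y - x))) ^ 2 := by gcongr
      _ ≤ ∫⁻ t in Set.Ioc (0 : ℝ) 1, (‖y - x‖ₑ * g (x + t • (y - x))) ^ 2 := by
        refine (NeumannDisc.lintegral_sq_le _ (by fun_prop)).trans ?_
        simp
      _ ≤ ∫⁻ t in Set.Ioc (0 : ℝ) 1, d ^ 2 * k (x + t • (y - x)) := by
        refine setLIntegral_mono' measurableSet_Ioc fun t ht => ?_
        have hmem : x + t • (y - x) ∈ Q :=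
          hQc.add_smul_sub_mem hxQ hyQ (Set.Ioc_subset_Icc_self ht)
        rw [hk, Set.indicator_of_mem hmem, mul_pow]
        gcongr
        exact hd x hxQ y hyQ
      _ = _ := lintegral_const_mul _ (by fun_prop)
  have hk3 : Measurable fun q : (ℂ × ℂ) × ℝ => k (q.1.1 + q.2 • (q.1.2 - q.1.1)) := by fun_prop
  calc ∫⁻ x in Q, ∫⁻ y in Q, ‖f x - f y‖ₑ ^ 2
      ≤ ∫⁻ x in Q, ∫⁻ y in Q, d ^ 2 * ∫⁻ t in Set.Ioc (0 : ℝ) 1, k (x + t • (y - x)) :=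
        lintegral_mono_ae (hpt.mono fun x hx => lintegral_mono_ae hx)
    _ = d ^ 2 * ∫⁻ x in Q, ∫⁻ y in Q, ∫⁻ t in Set.Ioc (0 : ℝ) 1, k (x + t • (y - x)) := by
        rw [← lintegral_const_mul]
        · congr 1
          ext x
          rw [lintegral_const_mul]
          exact (hk3.comp (by fun_prop : Measurable fun p : ℂ × ℝ => ((x, p.1), p.2))).lintegral_prod_right'
        · exact (hk3.lintegral_prod_right').lintegral_prod_right'
    _ = d ^ 2 * ∫⁻ t in Set.Ioc (0 : ℝ) 1, ∫⁻ x in Q, ∫⁻ y in Q, k (x + t • (y - x)) := by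
        congr 1
        have hs : ∀ x, ∫⁻ y in Q, ∫⁻ t in Set.Ioc (0 : ℝ) 1, k (x + t • (y - x))
            = ∫⁻ t in Set.Ioc (0 : ℝ) 1, ∫⁻ y in Q, k (x + t • (y - x)) := fun x =>
          lintegral_lintegral_swap (hk3.comp
            (by fun_prop : Measurable fun p : ℂ × ℝ => ((x, p.1), p.2))).aemeasurable
        simp_rw [hs]
        refine lintegral_lintegral_swap (Measurable.aemeasurable ?_)
        exact (hk3.comp (by fun_prop : Measurable fun p : (ℂ × ℝ) × ℂ =>
            ((p.1.1, p.2), p.1.2))).lintegral_prod_right'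
    _ ≤ d ^ 2 * ∫⁻ t in Set.Ioc (0 : ℝ) 1, 4 * volume Q * ∫⁻ w, k w := by
        exact mul_le_mul' le_rfl (setLIntegral_mono' measurableSet_Ioc fun t ht =>
          lintegral_lintegral_comp_segment_le hkm ht)
    _ = _ := by
        rw [setLIntegral_const, hk, lintegral_indicator hQ]
        simp
        ring

theorem rpow_sub_one_mul_self (a : ℝ≥0∞) {r : ℝ} (hr : 1 ≤ r) : a ^ (r - 1) * a = a ^ r := by
  nth_rewrite 2 [← ENNReal.rpow_one a]
  rw [← ENNReal.rpow_add_of_nonneg _ _ (by linarith) zero_le_one, sub_add_cancel]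

instance : IsFiniteMeasure discMeasure :=
  ⟨by rw [discMeasure, Measure.restrict_apply_univ]; exact measure_ball_lt_top⟩

theorem lintegral_ofReal_rpow_neg_lt_top {c : ℝ} (hc : c < 1) :
    ∫⁻ t in Set.Ioc (0 : ℝ) 1, ENNReal.ofReal t ^ (-c) < ⊤ := by
  have h := (intervalIntegral.intervalIntegrable_rpow' (a := 0) (b := 1) (r := -c)
    (by linarith)).1
  have h2 : ∫⁻ t in Set.Ioc (0 : ℝ) 1, ENNReal.ofReal t ^ (-c)
      = ∫⁻ t in Set.Ioc (0 : ℝ) 1, ‖t ^ (-c)‖ₑ := by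
    refine setLIntegral_congr_fun measurableSet_Ioc fun t ht => ?_
    rw [ENNReal.ofReal_rpow_of_pos ht.1, ← ofReal_norm,
      Real.norm_of_nonneg (Real.rpow_nonneg ht.1.le _)]
  rw [h2]
  exact h.hasFiniteIntegral

/-- Two-point averages of `g` over segments of length proportional to `t`. -/
theorem lintegral_segment_sq_le {g : ℂ → ℝ≥0∞} (hg : Measurable g) {x : ℂ} (hx : x ∈ disc) (t : ℝ) :
    (∫⁻ y in disc, ‖y - x‖ₑ * g (x + t • (y - x))) ^ 2 ≤
      4 * volume (Metric.ball (0 : ℂ) 2) * ∫⁻ w in Metric.ball (0 : ℂ) 2, g (x + t • w) ^ 2 := by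
  -- The substitution w = y - x moves the disc into the ball of radius 2, which also bounds ‖y - x‖
  -- by 2.
  have h1 : ∫⁻ y in disc, ‖y - x‖ₑ * g (x + t • (y - x))
      ≤ 2 * ∫⁻ w in Metric.ball (0 : ℂ) 2, g (x + t • w) := by
    rw [← lintegral_indicator measurableSet_disc,
      ← lintegral_add_right_eq_self _ x, ← lintegral_indicator measurableSet_ball,
      ← lintegral_const_mul _ (by
        exact (by fun_prop : Measurable fun w => g (x + t • w)).indicator measurableSet_ball)]
    refine lintegral_mono fun w => ?_
    by_cases hw : w + x ∈ disc
    · have hw2 : ‖w‖ < 2 := by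
        have h1 : ‖w + x‖ < 1 := by simpa [disc] using hw
        have h2 : ‖x‖ < 1 := by simpa [disc] using hx
        calc ‖w‖ = ‖(w + x) - x‖ := by simp
          _ ≤ ‖w + x‖ + ‖x‖ := norm_sub_le _ _
          _ < 2 := by linarith
      rw [Set.indicator_of_mem hw, Set.indicator_of_mem (by simpa using hw2), add_sub_cancel_right]
      gcongr
      rw [← ofReal_norm, ENNReal.ofReal_le_iff_le_toReal (by simp)]
      simpa using hw2.le
    · rw [Set.indicator_of_notMem hw]
      exact zero_le
  calc _ ≤ (2 * ∫⁻ w in Metric.ball (0 : ℂ) 2, g (x + t • w)) ^ 2 := by gcongr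
    _ = 4 * (∫⁻ w in Metric.ball (0 : ℂ) 2, g (x + t • w)) ^ 2 := by rw [mul_pow]; norm_num
    _ ≤ 4 * (volume (Metric.ball (0 : ℂ) 2) *
          ∫⁻ w in Metric.ball (0 : ℂ) 2, g (x + t • w) ^ 2) := by
        gcongr
        refine (lintegral_sq_le _ (by fun_prop)).trans ?_
        rw [Measure.restrict_apply_univ]
    _ = _ := by ring

/-- Writing E for the integral on the right, E^(p/2) is split as E^(p/2-1) E. The first factor is
bounded by scaling, E ≤ t⁻² N, which costs t^(-(p-2)) and is compensated by the power of t on the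
left; the second is kept, to be integrated in x. -/
theorem lintegral_segment_rpow_le {g : ℂ → ℝ≥0∞} (hg : Measurable g) {x : ℂ} (hx : x ∈ disc)
    {t : ℝ} (ht : 0 < t) {p : ℝ} (hp : 2 ≤ p) :
    (ENNReal.ofReal t ^ ((p - 2) / p) *
      ∫⁻ y in disc, ‖y - x‖ₑ * g (x + t • (y - x))) ^ p ≤
      (4 * volume (Metric.ball (0 : ℂ) 2)) ^ (p / 2) * (∫⁻ z, g z ^ 2) ^ (p / 2 - 1) *
        ∫⁻ w in Metric.ball (0 : ℂ) 2, g (x + t • w) ^ 2 := by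
  set E := ∫⁻ w in Metric.ball (0 : ℂ) 2, g (x + t • w) ^ 2 with hE
  set N := ∫⁻ z, g z ^ 2 with hN
  set V := volume (Metric.ball (0 : ℂ) 2) with hV
  have hp0 : 0 < p := by linarith
  have hEN : E ≤ ENNReal.ofReal t ^ (-2 : ℝ) * N := by
    calc E ≤ ∫⁻ w, g (x + t • w) ^ 2 := setLIntegral_le_lintegral _ _
      _ = ∫⁻ w, g (t • w + x) ^ 2 := by simp_rw [add_comm x]
      _ = ENNReal.ofReal ((t ^ 2)⁻¹) * N :=
        lintegral_comp_smul_add (k := fun z => g z ^ 2) (by fun_prop) ht.ne' x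
      _ = _ := by
        rw [ENNReal.ofReal_rpow_of_pos ht, Real.rpow_neg ht.le, Real.rpow_two]
  have hT0 : ENNReal.ofReal t ≠ 0 := by simpa using ht
  rw [ENNReal.mul_rpow_of_nonneg _ _ hp0.le, ← ENNReal.rpow_mul, div_mul_cancel₀ _ hp0.ne']
  have hA : (∫⁻ y in disc, ‖y - x‖ₑ * g (x + t • (y - x))) ^ p ≤ (4 * V * E) ^ (p / 2) := by
    calc _ = ((∫⁻ y in disc, ‖y - x‖ₑ * g (x + t • (y - x))) ^ 2) ^ (p / 2) := by
          rw [← ENNReal.rpow_two, ← ENNReal.rpow_mul]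
          congr 1; ring
      _ ≤ _ := ENNReal.rpow_le_rpow (lintegral_segment_sq_le hg hx t) (by positivity)
  have hEp : E ^ (p / 2) ≤ ENNReal.ofReal t ^ (-(p - 2)) * N ^ (p / 2 - 1) * E := by
    calc E ^ (p / 2) = E ^ (p / 2 - 1) * E := by
          rw [rpow_sub_one_mul_self _ (by linarith)]
      _ ≤ (ENNReal.ofReal t ^ (-2 : ℝ) * N) ^ (p / 2 - 1) * E :=
          mul_le_mul' (ENNReal.rpow_le_rpow hEN (by linarith)) le_rfl
      _ = _ := by
          rw [ENNReal.mul_rpow_of_nonneg _ _ (by linarith), ← ENNReal.rpow_mul]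
          congr 3; ring
  calc _ ≤ ENNReal.ofReal t ^ (p - 2) * ((4 * V) ^ (p / 2) *
        (ENNReal.ofReal t ^ (-(p - 2)) * N ^ (p / 2 - 1) * E)) := by
        refine mul_le_mul' le_rfl (hA.trans ?_)
        rw [ENNReal.mul_rpow_of_nonneg _ _ (by positivity)]
        exact mul_le_mul' le_rfl hEp
    _ = (ENNReal.ofReal t ^ (p - 2) * ENNReal.ofReal t ^ (-(p - 2))) *
        ((4 * V) ^ (p / 2) * N ^ (p / 2 - 1) * E) := by ring
    _ = _ := by
        rw [← ENNReal.rpow_add _ _ hT0 ENNReal.ofReal_ne_top, add_neg_cancel, ENNReal.rpow_zero,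
          one_mul]

/-- This is the Sobolev inequality in two-point form. It comes from Hölder's inequality in t against
t^(-(p-2)/p), followed by integration in x, where translation invariance removes the dependence on
t. -/
theorem exists_lintegral_rpow_le {p : ℝ} (hp : 2 ≤ p) : ∃ C : ℝ≥0∞, C < ⊤ ∧
    ∀ (f : ℂ → ℝ) (g : ℂ → ℝ≥0∞), Measurable g → SegmentBound f g →
      ∫⁻ x in disc, (∫⁻ y in disc, ‖f x - f y‖ₑ) ^ p ≤ C * (∫⁻ z, g z ^ 2) ^ (p / 2) := by
  set V := volume (Metric.ball (0 : ℂ) 2) with hV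
  have hVtop : V < ⊤ := measure_ball_lt_top
  have hp0 : 0 < p := by linarith
  have hp1 : 1 < p := by linarith
  set p' : ℝ := p / (p - 1) with hp'
  have hconj : p'.HolderConjugate p := (Real.HolderConjugate.conjExponent hp1).symm
  set κ := ∫⁻ t in Set.Ioc (0 : ℝ) 1, ENNReal.ofReal t ^ (-((p - 2) / (p - 1))) with hκ
  -- The exponent (p - 2)/(p - 1) stays below 1 for every finite p, so no finite exponent is
  -- excluded.
  have hκtop : κ < ⊤ := lintegral_ofReal_rpow_neg_lt_top (by
    rw [div_lt_one (by linarith)]; linarith)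
  have hκp : κ ^ (p / p') < ⊤ :=
    ENNReal.rpow_lt_top_of_nonneg (div_nonneg hp0.le hconj.nonneg) hκtop.ne
  have hVp : (4 * V) ^ (p / 2) < ⊤ := ENNReal.rpow_lt_top_of_nonneg (by positivity)
    (ENNReal.mul_lt_top (by simp) hVtop).ne
  refine ⟨κ ^ (p / p') * ((4 * V) ^ (p / 2) * V), ENNReal.mul_lt_top hκp
    (ENNReal.mul_lt_top hVp hVtop), fun f g hg hfg => ?_⟩
  set N := ∫⁻ z, g z ^ 2 with hN
  have hm3 : Measurable fun q : (ℂ × ℝ) × ℂ => ‖q.2 - q.1.1‖ₑ * g (q.1.1 + q.1.2 • (q.2 - q.1.1)) := by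
    fun_prop
  have hpt : ∀ᵐ x ∂(volume.restrict disc), (∫⁻ y in disc, ‖f x - f y‖ₑ) ^ p ≤
      κ ^ (p / p') * ((4 * V) ^ (p / 2) * N ^ (p / 2 - 1) * ∫⁻ t in Set.Ioc (0 : ℝ) 1,
        ∫⁻ w in Metric.ball (0 : ℂ) 2, g (x + t • w) ^ 2) := by
    filter_upwards [hfg, ae_restrict_mem measurableSet_disc] with x hx hxD
    have hA : Measurable fun t : ℝ => ∫⁻ y in disc, ‖y - x‖ₑ * g (x + t • (y - x)) :=
      (hm3.comp (by fun_prop : Measurable fun q : ℝ × ℂ => ((x, q.1), q.2))).lintegral_prod_right'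
    have h1 : ∫⁻ y in disc, ‖f x - f y‖ₑ ≤ ∫⁻ t in Set.Ioc (0 : ℝ) 1,
        ∫⁻ y in disc, ‖y - x‖ₑ * g (x + t • (y - x)) := by
      have hx' : ∀ᵐ y ∂(volume.restrict disc),
          ‖f x - f y‖ₑ ≤ ∫⁻ t in Set.Ioc (0 : ℝ) 1, ‖y - x‖ₑ * g (x + t • (y - x)) := hx
      refine (lintegral_mono_ae hx').trans_eq ?_
      exact lintegral_lintegral_swap (hm3.comp
        (by fun_prop : Measurable fun q : ℂ × ℝ => ((x, q.2), q.1))).aemeasurable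
    have h2 : ∫⁻ t in Set.Ioc (0 : ℝ) 1, ∫⁻ y in disc, ‖y - x‖ₑ * g (x + t • (y - x)) =
        ∫⁻ t in Set.Ioc (0 : ℝ) 1, ENNReal.ofReal t ^ (-((p - 2) / p)) *
          (ENNReal.ofReal t ^ ((p - 2) / p) *
            ∫⁻ y in disc, ‖y - x‖ₑ * g (x + t • (y - x))) := by
      refine setLIntegral_congr_fun measurableSet_Ioc fun t ht => ?_
      rw [← mul_assoc, ← ENNReal.rpow_add _ _ (by simpa using ht.1) ENNReal.ofReal_ne_top,
        neg_add_cancel, ENNReal.rpow_zero, one_mul]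
    have h3 := ENNReal.lintegral_mul_le_Lp_mul_Lq (volume.restrict (Set.Ioc (0 : ℝ) 1)) hconj
      (f := fun t => ENNReal.ofReal t ^ (-((p - 2) / p)))
      (g := fun t => ENNReal.ofReal t ^ ((p - 2) / p) *
            ∫⁻ y in disc, ‖y - x‖ₑ * g (x + t • (y - x)))
      (by fun_prop) (by fun_prop)
    have h4 : ∫⁻ t in Set.Ioc (0 : ℝ) 1, (ENNReal.ofReal t ^ (-((p - 2) / p))) ^ p' = κ := by
      rw [hκ]
      congr 1
      ext t
      rw [← ENNReal.rpow_mul]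
      congr 1
      rw [hp']
      field_simp
    simp only [Pi.mul_apply] at h3
    rw [h4] at h3
    calc _ ≤ (κ ^ (1 / p') * (∫⁻ t in Set.Ioc (0 : ℝ) 1, (ENNReal.ofReal t ^ ((p - 2) / p) *
            ∫⁻ y in disc, ‖y - x‖ₑ * g (x + t • (y - x))) ^ p) ^ (1 / p)) ^ p :=
          ENNReal.rpow_le_rpow (h1.trans (h2.trans_le h3)) hp0.le
      _ = κ ^ (p / p') * ∫⁻ t in Set.Ioc (0 : ℝ) 1, (ENNReal.ofReal t ^ ((p - 2) / p) *
            ∫⁻ y in disc, ‖y - x‖ₑ * g (x + t • (y - x))) ^ p := by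
          rw [ENNReal.mul_rpow_of_nonneg _ _ hp0.le, ← ENNReal.rpow_mul, ← ENNReal.rpow_mul,
            one_div_mul_cancel hp0.ne', ENNReal.rpow_one]
          congr 2; ring
      _ ≤ κ ^ (p / p') * ∫⁻ t in Set.Ioc (0 : ℝ) 1, (4 * V) ^ (p / 2) * N ^ (p / 2 - 1) *
            ∫⁻ w in Metric.ball (0 : ℂ) 2, g (x + t • w) ^ 2 :=
          mul_le_mul' le_rfl (setLIntegral_mono' measurableSet_Ioc fun t ht =>
            lintegral_segment_rpow_le hg hxD ht.1 hp)
      _ = _ := by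
          rw [lintegral_const_mul]
          exact (by fun_prop : Measurable fun q : ℝ × ℂ => g (x + q.1 • q.2) ^ 2).lintegral_prod_right'
  have hB : ∫⁻ x, ∫⁻ t in Set.Ioc (0 : ℝ) 1, ∫⁻ w in Metric.ball (0 : ℂ) 2, g (x + t • w) ^ 2
      = V * N := by
    rw [lintegral_lintegral_swap (by
      exact (by fun_prop : Measurable fun q : (ℂ × ℝ) × ℂ =>
        g (q.1.1 + q.1.2 • q.2) ^ 2).lintegral_prod_right'.aemeasurable)]
    have : ∀ t : ℝ, ∫⁻ x, ∫⁻ w in Metric.ball (0 : ℂ) 2, g (x + t • w) ^ 2 = V * N := by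
      intro t
      rw [lintegral_lintegral_swap (by
        exact (by fun_prop : Measurable fun q : ℂ × ℂ => g (q.1 + t • q.2) ^ 2).aemeasurable)]
      have : ∀ w : ℂ, ∫⁻ x, g (x + t • w) ^ 2 = N := fun w =>
        lintegral_add_right_eq_self (fun x => g x ^ 2) (t • w)
      simp_rw [this]
      rw [setLIntegral_const, mul_comm]
    simp_rw [this]
    simp
  have hBm : Measurable fun x : ℂ => ∫⁻ t in Set.Ioc (0 : ℝ) 1,
      ∫⁻ w in Metric.ball (0 : ℂ) 2, g (x + t • w) ^ 2 :=
    (by fun_prop : Measurable fun q : (ℂ × ℝ) × ℂ =>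
        g (q.1.1 + q.1.2 • q.2) ^ 2).lintegral_prod_right'.lintegral_prod_right'
  calc _ ≤ ∫⁻ x in disc, κ ^ (p / p') * ((4 * V) ^ (p / 2) * N ^ (p / 2 - 1) *
        ∫⁻ t in Set.Ioc (0 : ℝ) 1, ∫⁻ w in Metric.ball (0 : ℂ) 2, g (x + t • w) ^ 2) :=
        lintegral_mono_ae hpt
    _ = κ ^ (p / p') * ((4 * V) ^ (p / 2) * N ^ (p / 2 - 1) *
        ∫⁻ x in disc, ∫⁻ t in Set.Ioc (0 : ℝ) 1,
          ∫⁻ w in Metric.ball (0 : ℂ) 2, g (x + t • w) ^ 2) := by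
        rw [lintegral_const_mul _ (hBm.const_mul _), lintegral_const_mul _ hBm]
    _ ≤ κ ^ (p / p') * ((4 * V) ^ (p / 2) * N ^ (p / 2 - 1) * (V * N)) := by
        rw [← hB]
        exact mul_le_mul' le_rfl (mul_le_mul' le_rfl (setLIntegral_le_lintegral _ _))
    _ = κ ^ (p / p') * ((4 * V) ^ (p / 2) * V) * (N ^ (p / 2 - 1) * N) := by ring
    _ = _ := by
        congr 1
        exact rpow_sub_one_mul_self _ (by linarith)

/-! ### Poincaré and Sobolev inequalities for weak gradients -/

theorem LocallyIntegrableOn.congr_disc {E : Type*} [NormedAddCommGroup E] {f f' : ℂ → E}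
    (hf : LocallyIntegrableOn f disc) (h : f =ᵐ[discMeasure] f') : LocallyIntegrableOn f' disc := by
  rw [locallyIntegrableOn_iff isOpen_disc.isLocallyClosed] at hf ⊢
  exact fun k hk hkc => (hf k hk hkc).congr (ae_mono (Measure.restrict_mono hk le_rfl) h)

theorem IsWeakGradient.congr {f f' : ℂ → ℝ} {G G' : ℂ → ℂ} (h : IsWeakGradient f G)
    (hf : f =ᵐ[discMeasure] f') (hG : G =ᵐ[discMeasure] G') : IsWeakGradient f' G' := by
  refine ⟨LocallyIntegrableOn.congr_disc h.1 hf, LocallyIntegrableOn.congr_disc h.2.1 hG, fun η h1 h2 h3 v => ?_⟩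
  have e1 : ∫ z in disc, f' z * fderiv ℝ η z v = ∫ z in disc, f z * fderiv ℝ η z v :=
    integral_congr_ae (hf.mono fun z hz => by simp only; rw [hz])
  have e2 : ∫ z in disc, inner ℝ (G' z) v * η z = ∫ z in disc, inner ℝ (G z) v * η z :=
    integral_congr_ae (hG.mono fun z hz => by simp only; rw [hz])
  rw [e1, e2]
  exact h.2.2 η h1 h2 h3 v

theorem IsWeakGradient.aestronglyMeasurable {f : ℂ → ℝ} {G : ℂ → ℂ} (h : IsWeakGradient f G) :
    AEStronglyMeasurable f discMeasure :=
  h.1.aestronglyMeasurable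

theorem ae_discMeasure_mem : ∀ᵐ z ∂discMeasure, z ∈ disc := ae_restrict_mem measurableSet_disc

theorem SegmentBound.congr {f f' : ℂ → ℝ} {g : ℂ → ℝ≥0∞} (h : SegmentBound f g)
    (hf : f =ᵐ[discMeasure] f') : SegmentBound f' g := by
  filter_upwards [h, hf] with x hx hx'
  filter_upwards [hx, hf] with y hy hy'
  rwa [← hx', ← hy']

/-- Measurable representatives are chosen and the gradient is extended by zero, so that integrals of
g over the plane are integrals over the disc. -/
theorem IsWeakGradient.exists_segmentBound {f : ℂ → ℝ} {G : ℂ → ℂ} (h : IsWeakGradient f G)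
    (hG : MemLp G 2 discMeasure) : ∃ g : ℂ → ℝ≥0∞, Measurable g ∧ SegmentBound f g ∧
      (∀ z ∉ disc, g z = 0) ∧ g =ᵐ[discMeasure] fun z => ‖G z‖ₑ := by
  have hfm := h.aestronglyMeasurable
  set f' := hfm.mk f with hf'
  have hff' : f =ᵐ[discMeasure] f' := hfm.ae_eq_mk
  set G₀ := hG.1.mk G with hG₀
  have hGG₀ : G =ᵐ[discMeasure] G₀ := hG.1.ae_eq_mk
  set G' := disc.indicator G₀ with hG'
  have hGG' : G =ᵐ[discMeasure] G' := by
    filter_upwards [hGG₀, ae_discMeasure_mem] with z hz hzD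
    rw [hz, hG', Set.indicator_of_mem hzD]
  have hmG' : Measurable G' := hG.1.stronglyMeasurable_mk.measurable.indicator measurableSet_disc
  have hGi : Integrable G' := by
    rw [hG', integrable_indicator_iff measurableSet_disc]
    exact ((hG.integrable (by norm_num)).congr hGG₀)
  refine ⟨fun z => ‖G' z‖ₑ, by fun_prop, ?_, fun z hz => ?_, ?_⟩
  · exact (segmentBound_of_isWeakGradient hfm.stronglyMeasurable_mk.measurable hmG' hGi
      (h.congr hff' hGG')).congr hff'.symm
  · simp [hG', Set.indicator_of_notMem hz]
  · filter_upwards [hGG'] with z hz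
    rw [hz]

theorem discMeasure_ne_zero : discMeasure ≠ 0 := by
  rw [discMeasure, Ne, Measure.restrict_eq_zero]
  exact (Metric.measure_ball_pos volume 0 one_pos).ne'

instance : NeZero discMeasure := ⟨discMeasure_ne_zero⟩

theorem eLpNorm_two_sq {E : Type*} [NormedAddCommGroup E] (ν : Measure ℂ) (G : ℂ → E) :
    eLpNorm G 2 ν ^ 2 = ∫⁻ z, ‖G z‖ₑ ^ 2 ∂ν := by
  have := eLpNorm_nnreal_pow_eq_lintegral (f := G) (μ := ν) (p := 2) (by norm_num)
  simpa using this

theorem lintegral_sq_eq_of_ae {g : ℂ → ℝ≥0∞} {G : ℂ → ℂ} (h0 : ∀ z ∉ disc, g z = 0)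
    (h : g =ᵐ[discMeasure] fun z => ‖G z‖ₑ) : ∫⁻ z, g z ^ 2 = eLpNorm G 2 discMeasure ^ 2 := by
  rw [eLpNorm_two_sq, ← setLIntegral_eq_of_support_subset (s := disc)]
  · exact lintegral_congr_ae (h.mono fun z hz => by simp only; rw [hz])
  · intro z hz
    by_contra hzD
    simp [h0 z hzD] at hz

/-- Only local integrability is given. The two-point estimate with p = 2 makes ∫ |f x - f y| dy
finite for almost every x, and one such x suffices. -/
theorem IsWeakGradient.integrable {f : ℂ → ℝ} {G : ℂ → ℂ} (h : IsWeakGradient f G)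
    (hG : MemLp G 2 discMeasure) : Integrable f discMeasure := by
  obtain ⟨g, hg, hs, h0, hgG⟩ := h.exists_segmentBound hG
  obtain ⟨C, hC, hCf⟩ := exists_lintegral_rpow_le (le_refl 2)
  have h1 := hCf f g hg hs
  rw [lintegral_sq_eq_of_ae h0 hgG] at h1
  have h2 : ∫⁻ x in disc, (∫⁻ y in disc, ‖f x - f y‖ₑ) ^ (2 : ℝ) < ⊤ := by
    refine h1.trans_lt (ENNReal.mul_lt_top hC (ENNReal.rpow_lt_top_of_nonneg (by norm_num) ?_))
    exact ENNReal.pow_ne_top hG.2.ne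
  have hfm := h.aestronglyMeasurable
  have hm : AEMeasurable (fun x => (∫⁻ y, ‖f x - f y‖ₑ ∂discMeasure) ^ (2 : ℝ)) discMeasure := by
    refine AEMeasurable.pow_const ?_ _
    have : AEMeasurable (fun p : ℂ × ℂ => ‖f p.1 - f p.2‖ₑ) (discMeasure.prod discMeasure) :=
      (hfm.comp_fst.sub hfm.comp_snd).enorm
    exact this.lintegral_prod_right'
  obtain ⟨x, hx⟩ := (ae_lt_top' hm h2.ne).exists
  have hx' : ∫⁻ y, ‖f x - f y‖ₑ ∂discMeasure < ⊤ := by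
    by_contra hcon
    rw [not_lt, top_le_iff] at hcon
    rw [hcon] at hx
    simp at hx
  have hi : Integrable (fun y => f x - f y) discMeasure :=
    ⟨aestronglyMeasurable_const.sub hfm, hx'⟩
  have : f = fun y => f x - (f x - f y) := by ext; ring
  rw [this]
  exact (integrable_const _).sub hi

theorem enorm_sub_average_le {ν : Measure ℂ} [IsFiniteMeasure ν] [NeZero ν] {f : ℂ → ℝ}
    (hf : Integrable f ν) (a : ℝ) :
    ‖a - ⨍ y, f y ∂ν‖ₑ ≤ (ν Set.univ)⁻¹ * ∫⁻ y, ‖a - f y‖ₑ ∂ν := by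
  have h1 : a - ⨍ y, f y ∂ν = ⨍ y, (a - f y) ∂ν := by
    rw [average_eq, average_eq, integral_sub (integrable_const _) hf, integral_const, smul_sub,
      smul_smul, inv_mul_cancel₀, one_smul]
    rw [Measure.real, ENNReal.toReal_ne_zero]
    exact ⟨by simpa using NeZero.ne ν, measure_ne_top _ _⟩
  rw [h1, average_eq']
  refine (enorm_integral_le_lintegral_enorm _).trans_eq ?_
  rw [lintegral_smul_measure, smul_eq_mul]

/-- The Sobolev–Poincaré inequality on the disc. -/
theorem exists_eLpNorm_sub_average_le {p : ℝ≥0∞} (hp : 2 ≤ p) (hp' : p ≠ ⊤) :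
    ∃ C : ℝ≥0∞, C < ⊤ ∧ ∀ (f : ℂ → ℝ) (G : ℂ → ℂ), IsWeakGradient f G → MemLp G 2 discMeasure →
      eLpNorm (fun z => f z - ⨍ w, f w ∂discMeasure) p discMeasure
        ≤ C * eLpNorm G 2 discMeasure := by
  have hpr : 2 ≤ p.toReal := by
    have := ENNReal.toReal_mono hp' hp
    simpa using this
  have hp0 : 0 < p.toReal := by linarith
  obtain ⟨C, hC, hCf⟩ := exists_lintegral_rpow_le hpr
  set π' := (discMeasure Set.univ)⁻¹ with hπ
  have hπtop : π' ≠ ⊤ := ENNReal.inv_ne_top.2 (by simpa using discMeasure_ne_zero)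
  refine ⟨π' * C ^ (1 / p.toReal), ENNReal.mul_lt_top hπtop.lt_top
    (ENNReal.rpow_lt_top_of_nonneg (by positivity) hC.ne), fun f G h hG => ?_⟩
  obtain ⟨g, hg, hs, h0, hgG⟩ := h.exists_segmentBound hG
  have h1 := hCf f g hg hs
  rw [lintegral_sq_eq_of_ae h0 hgG] at h1
  rw [eLpNorm_eq_lintegral_rpow_enorm_toReal (by positivity) hp']
  have hfm := h.aestronglyMeasurable
  have hm : AEMeasurable (fun x => (∫⁻ y, ‖f x - f y‖ₑ ∂discMeasure) ^ p.toReal) discMeasure := by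
    refine AEMeasurable.pow_const ?_ _
    have : AEMeasurable (fun p : ℂ × ℂ => ‖f p.1 - f p.2‖ₑ) (discMeasure.prod discMeasure) :=
      (hfm.comp_fst.sub hfm.comp_snd).enorm
    exact this.lintegral_prod_right'
  calc _ ≤ (∫⁻ x, π' ^ p.toReal * (∫⁻ y, ‖f x - f y‖ₑ ∂discMeasure) ^ p.toReal ∂discMeasure)
        ^ (1 / p.toReal) := by
        gcongr with x
        rw [← ENNReal.mul_rpow_of_nonneg _ _ hp0.le]
        exact ENNReal.rpow_le_rpow (enorm_sub_average_le (h.integrable hG) _) hp0.le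
    _ = (π' ^ p.toReal * ∫⁻ x, (∫⁻ y, ‖f x - f y‖ₑ ∂discMeasure) ^ p.toReal ∂discMeasure)
        ^ (1 / p.toReal) := by
        rw [lintegral_const_mul'' _ hm]
    _ ≤ (π' ^ p.toReal * (C * (eLpNorm G 2 discMeasure ^ 2) ^ (p.toReal / 2)))
        ^ (1 / p.toReal) := by
        exact ENNReal.rpow_le_rpow (mul_le_mul' le_rfl h1) (by positivity)
    _ = _ := by
        rw [ENNReal.mul_rpow_of_nonneg _ _ (by positivity),
          ENNReal.mul_rpow_of_nonneg _ _ (by positivity), ← ENNReal.rpow_two, ← ENNReal.rpow_mul,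
          ← ENNReal.rpow_mul, ← ENNReal.rpow_mul, mul_one_div_cancel hp0.ne', ENNReal.rpow_one,
          mul_assoc]
        congr 2
        have : 2 * (p.toReal / 2) * (1 / p.toReal) = 1 := by field_simp
        rw [← mul_assoc, this, ENNReal.rpow_one]

/-- The Poincaré inequality on a convex part of the disc, with a constant that depends only on a
bound for the diameter. -/
theorem lintegral_sq_le_of_integral_eq_zero {f : ℂ → ℝ} (hf : Integrable f discMeasure)
    {g : ℂ → ℝ≥0∞} (hfg : SegmentBound f g)
    (hg : Measurable g) {Q : Set ℂ} (hQ : MeasurableSet Q) (hQc : Convex ℝ Q) (hQD : Q ⊆ disc)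
    {d : ℝ≥0∞} (hd : ∀ x ∈ Q, ∀ y ∈ Q, ‖y - x‖ₑ ≤ d) (h0 : ∫ z in Q, f z = 0) :
    ∫⁻ z in Q, ‖f z‖ₑ ^ 2 ≤ 4 * d ^ 2 * ∫⁻ z in Q, g z ^ 2 := by
  by_cases hQ0 : volume Q = 0
  · rw [Measure.restrict_eq_zero.2 hQ0]; simp
  have : NeZero (volume.restrict Q) := ⟨by rwa [Ne, Measure.restrict_eq_zero]⟩
  have hQtop : volume Q ≠ ⊤ :=
    ((measure_mono hQD).trans_lt measure_ball_lt_top).ne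
  have : IsFiniteMeasure (volume.restrict Q) :=
    ⟨by rw [Measure.restrict_apply_univ]; exact hQtop.lt_top⟩
  have hfQ : Integrable f (volume.restrict Q) := hf.mono_measure (Measure.restrict_mono hQD le_rfl)
  have hav : ⨍ y in Q, f y = 0 := by rw [average_eq, h0, smul_zero]
  have hpt : ∀ x, ‖f x‖ₑ ^ 2 ≤ (volume Q)⁻¹ * ∫⁻ y in Q, ‖f x - f y‖ₑ ^ 2 := by
    intro x
    have h1 := enorm_sub_average_le hfQ (f x)
    rw [hav, sub_zero, Measure.restrict_apply_univ] at h1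
    calc ‖f x‖ₑ ^ 2 ≤ ((volume Q)⁻¹ * ∫⁻ y in Q, ‖f x - f y‖ₑ) ^ 2 := by gcongr
      _ = (volume Q)⁻¹ ^ 2 * (∫⁻ y in Q, ‖f x - f y‖ₑ) ^ 2 := mul_pow _ _ _
      _ ≤ (volume Q)⁻¹ ^ 2 * (volume Q * ∫⁻ y in Q, ‖f x - f y‖ₑ ^ 2) := by
        refine mul_le_mul' le_rfl ?_
        refine (NeumannDisc.lintegral_sq_le _
          (aestronglyMeasurable_const.sub hfQ.1).enorm).trans ?_
        rw [Measure.restrict_apply_univ]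
        exact le_rfl
      _ = (volume Q)⁻¹ * ((volume Q)⁻¹ * volume Q) * ∫⁻ y in Q, ‖f x - f y‖ₑ ^ 2 := by ring
      _ = _ := by rw [ENNReal.inv_mul_cancel hQ0 hQtop, mul_one]
  calc ∫⁻ z in Q, ‖f z‖ₑ ^ 2 ≤ ∫⁻ x in Q, (volume Q)⁻¹ * ∫⁻ y in Q, ‖f x - f y‖ₑ ^ 2 :=
        lintegral_mono hpt
    _ = (volume Q)⁻¹ * ∫⁻ x in Q, ∫⁻ y in Q, ‖f x - f y‖ₑ ^ 2 :=
        lintegral_const_mul' _ _ (ENNReal.inv_ne_top.2 hQ0)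
    _ ≤ (volume Q)⁻¹ * (4 * d ^ 2 * volume Q * ∫⁻ z in Q, g z ^ 2) :=
        mul_le_mul' le_rfl (hfg.lintegral_sq_le hg hQ hQc hQD hd)
    _ = ((volume Q)⁻¹ * volume Q) * (4 * d ^ 2 * ∫⁻ z in Q, g z ^ 2) := by ring
    _ = _ := by rw [ENNReal.inv_mul_cancel hQ0 hQtop, one_mul]

/-! ### Admissible weights and weighted Sobolev inequalities -/

/-- The properties of conformal weights on which the spectral theory rests: almost everywhere
positivity and integrability to a power larger than one. -/
structure IsAdmissibleWeight (h : ℂ → ℝ) : Prop where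
  aemeasurable : AEMeasurable h discMeasure
  pos : ∀ᵐ z ∂discMeasure, 0 < h z
  exists_lintegral_rpow : ∃ r : ℝ, 1 < r ∧ ∫⁻ z, ENNReal.ofReal (h z) ^ r ∂discMeasure < ⊤

/-- The zeros of φ' are isolated unless φ' vanishes identically, in which case φ would be constant
and not injective. This weak form of φ' ≠ 0 is enough. -/
theorem ae_deriv_ne_zero {φ : ℂ → ℂ} (hφ : DifferentiableOn ℂ φ disc) (hinj : Set.InjOn φ disc) :
    ∀ᵐ z ∂discMeasure, deriv φ z ≠ 0 := by
  have han : AnalyticOnNhd ℂ (deriv φ) disc := (hφ.analyticOnNhd isOpen_disc).deriv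
  have h0 : (0 : ℂ) ∈ disc := by simp [disc]
  have h1 : (1 / 2 : ℂ) ∈ disc := by
    simp only [disc, Metric.mem_ball, dist_zero_right]
    norm_num
  rcases han.eqOn_zero_or_eventually_ne_zero_of_preconnected convex_disc.isPreconnected with h | h
  · have : φ 0 = φ (1 / 2) := isOpen_disc.is_const_of_deriv_eq_zero convex_disc.isPreconnected hφ
      h h0 h1
    exact absurd (hinj h0 h1 this) (by norm_num)
  · exact ae_restrict_le_codiscreteWithin measurableSet_disc h

theorem IsConformalWeight.isAdmissibleWeight {h : ℂ → ℝ} (hh : IsConformalWeight h) :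
    IsAdmissibleWeight h := by
  obtain ⟨φ, hφ, hinj, ⟨α, hα, hmem⟩, heq⟩ := hh
  have hae : h =ᵐ[discMeasure] fun z => ‖deriv φ z‖ ^ 2 := ae_discMeasure_mem.mono heq
  refine ⟨?_, ?_, ?_⟩
  · exact ((measurable_deriv φ).norm.pow_const 2).aemeasurable.congr hae.symm
  · filter_upwards [hae, ae_deriv_ne_zero hφ hinj] with z h1 h2
    rw [h1]
    exact pow_pos (norm_pos_iff.2 h2) 2
  -- Truncating α at 4 keeps the exponent finite when α = ∞ and still above 2; then |φ'|² has the
  -- integrable power β/2 > 1.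
  · set β := min α 4 with hβ
    have hβ2 : 2 < β := lt_min hα (by norm_num)
    have hβtop : β ≠ ⊤ := ne_top_of_le_ne_top (by simp) (min_le_right _ _)
    have hβ0 : β ≠ 0 := (zero_lt_two.trans hβ2).ne'
    have hmem' : MemLp (deriv φ) β discMeasure := hmem.mono_exponent (min_le_left _ _)
    have hβr : 2 < β.toReal := by
      have := (ENNReal.toReal_lt_toReal (by simp) hβtop).2 hβ2
      simpa using this
    refine ⟨β.toReal / 2, by linarith, ?_⟩
    have := lintegral_rpow_enorm_lt_top_of_eLpNorm_lt_top hβ0 hβtop hmem'.2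
    refine lt_of_le_of_lt (lintegral_mono_ae ?_) this
    filter_upwards [hae] with z hz
    rw [hz, ← ofReal_norm, ENNReal.ofReal_pow (norm_nonneg _), ← ENNReal.rpow_two,
      ← ENNReal.rpow_mul]
    apply le_of_eq
    congr 1; ring

section Weight

variable {h : ℂ → ℝ}

theorem IsAdmissibleWeight.aemeasurable_ofReal (hh : IsAdmissibleWeight h) :
    AEMeasurable (fun z => ENNReal.ofReal (h z)) discMeasure := hh.aemeasurable.ennreal_ofReal

theorem weightMeasure_absolutelyContinuous (h : ℂ → ℝ) : weightMeasure h ≪ discMeasure :=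
  withDensity_absolutelyContinuous _ _

theorem IsAdmissibleWeight.absolutelyContinuous (hh : IsAdmissibleWeight h) :
    discMeasure ≪ weightMeasure h :=
  withDensity_absolutelyContinuous' hh.aemeasurable_ofReal
    (hh.pos.mono fun z hz => by simpa using hz)

theorem IsAdmissibleWeight.ae_eq_iff (hh : IsAdmissibleWeight h) {E : Type*} {f f' : ℂ → E} :
    f =ᵐ[weightMeasure h] f' ↔ f =ᵐ[discMeasure] f' :=
  ⟨fun H => hh.absolutelyContinuous.ae_eq H,
    fun H => (weightMeasure_absolutelyContinuous h).ae_eq H⟩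

theorem IsAdmissibleWeight.lintegral_weightMeasure (hh : IsAdmissibleWeight h) (u : ℂ → ℝ≥0∞) :
    ∫⁻ z, u z ∂(weightMeasure h) = ∫⁻ z, ENNReal.ofReal (h z) * u z ∂discMeasure := by
  rw [weightMeasure, lintegral_withDensity_eq_lintegral_mul_non_measurable₀ _
    hh.aemeasurable_ofReal (Filter.Eventually.of_forall fun _ => ENNReal.ofReal_lt_top)]
  rfl

theorem IsAdmissibleWeight.integral_weightMeasure (hh : IsAdmissibleWeight h) (u : ℂ → ℝ) :
    ∫ z, u z ∂(weightMeasure h) = ∫ z in disc, h z * u z := by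
  rw [weightMeasure, integral_withDensity_eq_integral_toReal_smul₀ hh.aemeasurable_ofReal
    (Filter.Eventually.of_forall fun _ => ENNReal.ofReal_lt_top)]
  refine integral_congr_ae (hh.pos.mono fun z hz => ?_)
  simp only [smul_eq_mul]
  rw [ENNReal.toReal_ofReal hz.le]

theorem IsAdmissibleWeight.isFiniteMeasure (hh : IsAdmissibleWeight h) :
    IsFiniteMeasure (weightMeasure h) := by
  obtain ⟨r, hr, hfin⟩ := hh.exists_lintegral_rpow
  refine isFiniteMeasure_withDensity (ne_of_lt ?_)
  calc ∫⁻ z, ENNReal.ofReal (h z) ∂discMeasure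
      ≤ ∫⁻ z, (1 + ENNReal.ofReal (h z) ^ r) ∂discMeasure := by
        refine lintegral_mono fun z => ?_
        rcases le_total (ENNReal.ofReal (h z)) 1 with h1 | h1
        · exact h1.trans le_self_add
        · refine le_trans ?_ le_add_self
          nth_rewrite 1 [← ENNReal.rpow_one (ENNReal.ofReal (h z))]
          exact ENNReal.rpow_le_rpow_of_exponent_le h1 hr.le
    _ < ⊤ := by
        rw [lintegral_add_left measurable_const]
        exact ENNReal.add_lt_top.2 ⟨by simp, hfin⟩

theorem IsAdmissibleWeight.weightMeasure_ne_zero (hh : IsAdmissibleWeight h) :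
    weightMeasure h ≠ 0 := fun h0 => discMeasure_ne_zero (by
      have := hh.absolutelyContinuous (s := Set.univ) (by rw [h0]; rfl)
      exact Measure.measure_univ_eq_zero.1 this)

/-- Hölder's inequality for a power of a function against a weight. -/
theorem lintegral_weight_mul_rpow_le {r r' q : ℝ} (hr : r.HolderConjugate r') {ν : Measure ℂ}
    {H u : ℂ → ℝ≥0∞} (hH : AEMeasurable H ν) (hu : AEMeasurable u ν) :
    ∫⁻ z, H z * u z ^ q ∂ν ≤ (∫⁻ z, H z ^ r ∂ν) ^ (1 / r) * (∫⁻ z, u z ^ (q * r') ∂ν) ^ (1 / r') := by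
  refine (ENNReal.lintegral_mul_le_Lp_mul_Lq ν hr hH (hu.pow_const q)).trans_eq ?_
  simp only [ENNReal.rpow_mul]

/-- Embedding of an unweighted Lebesgue space of large exponent into a weighted one. -/
theorem IsAdmissibleWeight.exists_eLpNorm_le (hh : IsAdmissibleWeight h) {q : ℝ≥0∞}
    (hq : 1 ≤ q) (hq' : q ≠ ⊤) : ∃ p : ℝ≥0∞, q ≤ p ∧ p ≠ ⊤ ∧ ∃ C : ℝ≥0∞, C < ⊤ ∧
      ∀ u : ℂ → ℝ, AEStronglyMeasurable u discMeasure →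
        eLpNorm u q (weightMeasure h) ≤ C * eLpNorm u p discMeasure := by
  obtain ⟨r, hr, hfin⟩ := hh.exists_lintegral_rpow
  have hconj := Real.HolderConjugate.conjExponent hr
  set r' := r.conjExponent with hr'
  have hr'1 : 1 < r' := hconj.symm.lt
  have hqr : 1 ≤ q.toReal := by simpa using ENNReal.toReal_mono hq' hq
  have hq0 : 0 < q.toReal := by linarith
  have hpr : 0 < q.toReal * r' := by positivity
  -- Hölder's inequality puts h in L^r and |u|^q in L^(r'), which gives the unweighted exponent q
  -- r'.
  refine ⟨ENNReal.ofReal (q.toReal * r'), ?_, ENNReal.ofReal_ne_top,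
    (∫⁻ z, ENNReal.ofReal (h z) ^ r ∂discMeasure) ^ (1 / r * (1 / q.toReal)),
    ENNReal.rpow_lt_top_of_nonneg (by positivity) hfin.ne, fun u hu => ?_⟩
  · rw [← ENNReal.ofReal_toReal hq']
    exact ENNReal.ofReal_le_ofReal (by
      rw [ENNReal.toReal_ofReal hq0.le]; nlinarith)
  · have hq00 : q ≠ 0 := (zero_lt_one.trans_le hq).ne'
    rw [eLpNorm_eq_lintegral_rpow_enorm_toReal hq00 hq',
      eLpNorm_eq_lintegral_rpow_enorm_toReal (ENNReal.ofReal_pos.2 hpr).ne' ENNReal.ofReal_ne_top,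
      ENNReal.toReal_ofReal hpr.le, hh.lintegral_weightMeasure]
    have h1 := lintegral_weight_mul_rpow_le (q := q.toReal) hconj hh.aemeasurable_ofReal hu.enorm
    refine (ENNReal.rpow_le_rpow h1 (by positivity)).trans_eq ?_
    rw [ENNReal.mul_rpow_of_nonneg _ _ (by positivity), ← ENNReal.rpow_mul, ← ENNReal.rpow_mul]
    congr 2
    field_simp

/-- The Sobolev inequality on the disc, with a weighted norm on the left. -/
theorem IsAdmissibleWeight.exists_eLpNorm_sub_le (hh : IsAdmissibleWeight h) {q : ℝ≥0∞}
    (hq : 2 ≤ q) (hq' : q ≠ ⊤) : ∃ C : ℝ≥0∞, C < ⊤ ∧ ∀ (f : ℂ → ℝ) (G : ℂ → ℂ),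
      IsWeakGradient f G → MemLp G 2 discMeasure →
      eLpNorm (fun z => f z - ⨍ w, f w ∂discMeasure) q (weightMeasure h)
        ≤ C * eLpNorm G 2 discMeasure := by
  obtain ⟨p, hqp, hp, C₁, hC₁, h1⟩ := hh.exists_eLpNorm_le (one_le_two.trans hq) hq'
  obtain ⟨C₂, hC₂, h2⟩ := exists_eLpNorm_sub_average_le (hq.trans hqp) hp
  refine ⟨C₁ * C₂, ENNReal.mul_lt_top hC₁ hC₂, fun f G hf hG => ?_⟩
  refine (h1 _ (hf.aestronglyMeasurable.sub aestronglyMeasurable_const)).trans ?_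
  rw [mul_assoc]
  exact mul_le_mul' le_rfl (h2 f G hf hG)

theorem IsAdmissibleWeight.memLp_sub (hh : IsAdmissibleWeight h) {q : ℝ≥0∞}
    (hq : 2 ≤ q) (hq' : q ≠ ⊤) {f : ℂ → ℝ} {G : ℂ → ℂ} (hf : IsWeakGradient f G)
    (hG : MemLp G 2 discMeasure) (c : ℝ) : MemLp (fun z => f z - c) q (weightMeasure h) := by
  have := hh.isFiniteMeasure
  obtain ⟨C, hC, hCf⟩ := hh.exists_eLpNorm_sub_le hq hq'
  have hm : MemLp (fun z => f z - ⨍ w, f w ∂discMeasure) q (weightMeasure h) :=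
    ⟨((hf.aestronglyMeasurable.mono_ac (weightMeasure_absolutelyContinuous h)).sub
      aestronglyMeasurable_const), (hCf f G hf hG).trans_lt (ENNReal.mul_lt_top hC hG.2)⟩
  have := hm.add (memLp_const ((⨍ w, f w ∂discMeasure) - c))
  refine this.congr_norm ?_ ?_
  · exact ((hf.aestronglyMeasurable.mono_ac (weightMeasure_absolutelyContinuous h)).sub
      aestronglyMeasurable_const)
  · filter_upwards with z
    simp

theorem IsAdmissibleWeight.memLp (hh : IsAdmissibleWeight h) {q : ℝ≥0∞}
    (hq : 2 ≤ q) (hq' : q ≠ ⊤) {f : ℂ → ℝ} {G : ℂ → ℂ} (hf : IsWeakGradient f G)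
    (hG : MemLp G 2 discMeasure) : MemLp f q (weightMeasure h) := by
  simpa using hh.memLp_sub hq hq' hf hG 0

/-- The right side does not mention h: all admissible weights define the same Sobolev space, so
different weights can be compared on one Hilbert space. -/
theorem IsAdmissibleWeight.memSobolev_iff (hh : IsAdmissibleWeight h) {f : ℂ → ℝ} {G : ℂ → ℂ} :
    MemSobolev h f G ↔ IsWeakGradient f G ∧ MemLp G 2 discMeasure :=
  ⟨fun H => ⟨H.1, H.2.2⟩, fun H => ⟨H.1, hh.memLp le_rfl (by simp) H.1 H.2, H.2⟩⟩

theorem eLpNorm_sub_average_le_two_mul {ν : Measure ℂ} [IsFiniteMeasure ν] [NeZero ν] {u : ℂ → ℝ}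
    {q : ℝ≥0∞} (hq : 1 ≤ q) (hq' : q ≠ ⊤) (hu : MemLp u q ν) :
    eLpNorm (fun z => u z - ⨍ w, u w ∂ν) q ν ≤ 2 * eLpNorm u q ν := by
  have h0 : ν ≠ 0 := NeZero.ne ν
  have hq0 : q ≠ 0 := (zero_lt_one.trans_le hq).ne'
  have hqr : 1 ≤ q.toReal := by simpa using ENNReal.toReal_mono hq' hq
  have hu1 : Integrable u ν := hu.integrable hq
  have hν0 : ν Set.univ ≠ 0 := by simpa using h0
  have hconst : eLpNorm (fun _ => ⨍ w, u w ∂ν) q ν ≤ eLpNorm u q ν := by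
    rw [eLpNorm_const _ hq0 h0]
    have h1 : ‖⨍ w, u w ∂ν‖ₑ ≤ (ν Set.univ)⁻¹ * eLpNorm u 1 ν := by
      rw [average_eq', eLpNorm_one_eq_lintegral_enorm]
      refine (enorm_integral_le_lintegral_enorm _).trans_eq ?_
      rw [lintegral_smul_measure, smul_eq_mul]
    have h2 := eLpNorm_le_eLpNorm_mul_rpow_measure_univ hq hu.1
    calc ‖⨍ w, u w ∂ν‖ₑ * ν Set.univ ^ (1 / q.toReal)
        ≤ (ν Set.univ)⁻¹ * (eLpNorm u q ν * ν Set.univ ^ (1 / (1 : ℝ≥0∞).toReal - 1 / q.toReal))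
            * ν Set.univ ^ (1 / q.toReal) := by
          gcongr
          exact h1.trans (mul_le_mul' le_rfl h2)
      _ = (ν Set.univ)⁻¹ * (ν Set.univ ^ (1 / (1 : ℝ≥0∞).toReal - 1 / q.toReal)
            * ν Set.univ ^ (1 / q.toReal)) * eLpNorm u q ν := by ring
      _ = eLpNorm u q ν := by
          rw [← ENNReal.rpow_add _ _ hν0 (measure_ne_top _ _)]
          simp [ENNReal.inv_mul_cancel hν0 (measure_ne_top _ _)]
  calc _ ≤ eLpNorm u q ν + eLpNorm (fun _ => ⨍ w, u w ∂ν) q ν :=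
        eLpNorm_sub_le hu.1 aestronglyMeasurable_const hq
    _ ≤ eLpNorm u q ν + eLpNorm u q ν := by gcongr
    _ = _ := (two_mul _).symm

/-- Recentring from the unweighted mean to the weighted mean at most doubles the norm. -/
theorem IsAdmissibleWeight.exists_eLpNorm_sub_average_le (hh : IsAdmissibleWeight h) {q : ℝ≥0∞}
    (hq : 2 ≤ q) (hq' : q ≠ ⊤) : ∃ C : ℝ≥0∞, C < ⊤ ∧ ∀ (f : ℂ → ℝ) (G : ℂ → ℂ),
      IsWeakGradient f G → MemLp G 2 discMeasure →
      eLpNorm (fun z => f z - ⨍ w, f w ∂(weightMeasure h)) q (weightMeasure h)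
        ≤ C * eLpNorm G 2 discMeasure := by
  obtain ⟨C, hC, hCf⟩ := hh.exists_eLpNorm_sub_le hq hq'
  have := hh.isFiniteMeasure
  have : NeZero (weightMeasure h) := ⟨hh.weightMeasure_ne_zero⟩
  refine ⟨2 * C, ENNReal.mul_lt_top (by simp) hC, fun f G hf hG => ?_⟩
  have hfi : Integrable f (weightMeasure h) :=
    (hh.memLp hq hq' hf hG).integrable (one_le_two.trans hq)
  have h1 := eLpNorm_sub_average_le_two_mul (one_le_two.trans hq) hq'
    (hh.memLp_sub hq hq' hf hG (⨍ w, f w ∂discMeasure))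
  have h2 : ⨍ w, (f w - ⨍ w, f w ∂discMeasure) ∂(weightMeasure h)
      = (⨍ w, f w ∂(weightMeasure h)) - ⨍ w, f w ∂discMeasure := by
    have hν : (weightMeasure h).real Set.univ ≠ 0 := by
      rw [Measure.real, ENNReal.toReal_ne_zero]
      exact ⟨by simpa using hh.weightMeasure_ne_zero, measure_ne_top _ _⟩
    generalize (⨍ w, f w ∂discMeasure) = m
    rw [average_eq, average_eq _ f, integral_sub hfi (integrable_const _), integral_const, smul_sub,
      smul_smul, inv_mul_cancel₀ hν, one_smul]
  simp only [h2, sub_sub_sub_cancel_right] at h1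
  refine h1.trans ?_
  rw [mul_assoc]
  exact mul_le_mul' le_rfl (hCf f G hf hG)

theorem IsAdmissibleWeight.sobolevConst_lt_top (hh : IsAdmissibleWeight h) {q : ℝ≥0∞}
    (hq : 2 ≤ q) (hq' : q ≠ ⊤) : sobolevConst h q < ⊤ := by
  obtain ⟨C, hC, hCf⟩ := hh.exists_eLpNorm_sub_average_le hq hq'
  have hmem : C ∈ {K : ℝ≥0∞ | ∀ (f : ℂ → ℝ) (G : ℂ → ℂ), MemSobolev h f G →
      eLpNorm (fun z => f z - ⨍ w, f w ∂(weightMeasure h)) q (weightMeasure h) ≤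
        K * eLpNorm G 2 discMeasure} := fun f G H => hCf f G H.1 H.2.2
  exact (sInf_le hmem).trans_lt hC

/-- The infimum defining the best constant is itself admissible. A vanishing gradient is treated
apart, since the argument divides by its norm. -/
theorem IsAdmissibleWeight.eLpNorm_sub_average_le_sobolevConst (hh : IsAdmissibleWeight h)
    {q : ℝ≥0∞} (hq : 2 ≤ q) (hq' : q ≠ ⊤) {f : ℂ → ℝ} {G : ℂ → ℂ} (hf : IsWeakGradient f G)
    (hG : MemLp G 2 discMeasure) :
    eLpNorm (fun z => f z - ⨍ w, f w ∂(weightMeasure h)) q (weightMeasure h)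
      ≤ sobolevConst h q * eLpNorm G 2 discMeasure := by
  obtain ⟨C, hC, hCf⟩ := hh.exists_eLpNorm_sub_average_le hq hq'
  have hne : sobolevConst h q ≠ ⊤ := (hh.sobolevConst_lt_top hq hq').ne
  refine le_of_forall_gt_imp_ge_of_dense fun a ha => ?_
  by_cases hG0 : eLpNorm G 2 discMeasure = 0
  · have := hCf f G hf hG
    rw [hG0, mul_zero] at this
    exact this.trans zero_le
  · have h1 : sobolevConst h q < a / eLpNorm G 2 discMeasure :=
      (ENNReal.lt_div_iff_mul_lt (Or.inl hG0) (Or.inl hG.2.ne)).2 ha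
    obtain ⟨K, hK, hlt⟩ := sInf_lt_iff.1 h1
    refine (hK f G (hh.memSobolev_iff.2 ⟨hf, hG⟩)).trans ?_
    exact ((ENNReal.lt_div_iff_mul_lt (Or.inl hG0) (Or.inl hG.2.ne)).1 hlt).le

end Weight

/-! ### Calculus of weak gradients -/

theorem isWeakGradient_of_integrable {f : ℂ → ℝ} {G : ℂ → ℂ} (hf : Integrable f discMeasure)
    (hG : Integrable G discMeasure)
    (H : ∀ η : ℂ → ℝ, ContDiff ℝ ∞ η → HasCompactSupport η → tsupport η ⊆ disc →
      ∀ v : ℂ, ∫ z in disc, f z * fderiv ℝ η z v = -∫ z in disc, inner ℝ (G z) v * η z) :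
    IsWeakGradient f G :=
  ⟨IntegrableOn.locallyIntegrableOn hf, IntegrableOn.locallyIntegrableOn hG, H⟩

theorem integrable_mul_fderiv_of_test {f : ℂ → ℝ} (hf : Integrable f discMeasure) {η : ℂ → ℝ}
    (hη : ContDiff ℝ ∞ η) (hc : HasCompactSupport η) (v : ℂ) :
    Integrable (fun z => f z * fderiv ℝ η z v) discMeasure := by
  have hcont : Continuous fun z => fderiv ℝ η z v :=
    (hη.continuous_fderiv (by simp)).clm_apply continuous_const
  obtain ⟨C, hC⟩ := hcont.bounded_above_of_compact_support (hc.fderiv_apply ℝ v)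
  exact hf.mul_bdd hcont.aestronglyMeasurable (Filter.Eventually.of_forall hC)

theorem integrable_inner_mul_of_test {G : ℂ → ℂ} (hG : Integrable G discMeasure) {η : ℂ → ℝ}
    (hη : ContDiff ℝ ∞ η) (hc : HasCompactSupport η) (v : ℂ) :
    Integrable (fun z => inner ℝ (G z) v * η z) discMeasure := by
  obtain ⟨C, hC⟩ := hη.continuous.bounded_above_of_compact_support hc
  exact (hG.inner_const v).mul_bdd hη.continuous.aestronglyMeasurable
    (Filter.Eventually.of_forall hC)

theorem IsWeakGradient.add {f f' : ℂ → ℝ} {G G' : ℂ → ℂ} (h : IsWeakGradient f G)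
    (h' : IsWeakGradient f' G') (hG : MemLp G 2 discMeasure) (hG' : MemLp G' 2 discMeasure) :
    IsWeakGradient (fun z => f z + f' z) (fun z => G z + G' z) := by
  have hi := h.integrable hG
  have hi' := h'.integrable hG'
  have gi := hG.integrable one_le_two
  have gi' := hG'.integrable one_le_two
  refine isWeakGradient_of_integrable (hi.add hi') (gi.add gi') fun η h1 h2 h3 v => ?_
  simp only [add_mul, inner_add_left]
  have e1 := integral_add (integrable_mul_fderiv_of_test hi h1 h2 v)
    (integrable_mul_fderiv_of_test hi' h1 h2 v)
  have e2 := integral_add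
    (integrable_inner_mul_of_test gi h1 h2 v) (integrable_inner_mul_of_test gi' h1 h2 v)
  rw [discMeasure] at e1 e2
  rw [e1, e2, h.2.2 η h1 h2 h3 v, h'.2.2 η h1 h2 h3 v]
  ring

theorem IsWeakGradient.const_smul {f : ℂ → ℝ} {G : ℂ → ℂ} (h : IsWeakGradient f G) (c : ℝ) :
    IsWeakGradient (fun z => c * f z) (fun z => c • G z) := by
  refine ⟨h.1.smul c, h.2.1.smul c, fun η h1 h2 h3 v => ?_⟩
  simp only [mul_assoc, real_inner_smul_left]
  rw [integral_const_mul, integral_const_mul, h.2.2 η h1 h2 h3 v]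
  ring

theorem integral_disc_eq_integral {u : ℂ → ℝ} {η : ℂ → ℝ} (hη : tsupport η ⊆ disc)
    (hu : ∀ z ∉ tsupport η, u z = 0) : ∫ z in disc, u z = ∫ z, u z :=
  setIntegral_eq_integral_of_forall_compl_eq_zero fun z hz => hu z fun h => hz (hη h)

theorem fderiv_eq_zero_of_notMem_tsupport {η : ℂ → ℝ} {z : ℂ} (hz : z ∉ tsupport η) :
    fderiv ℝ η z = 0 :=
  image_eq_zero_of_notMem_tsupport (mt (fun h => tsupport_fderiv_subset ℝ h) hz)

/-- The classical gradient of a smooth function is its weak gradient. -/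
theorem isWeakGradient_of_contDiff {f : ℂ → ℝ} {G : ℂ → ℂ} (hf : ContDiff ℝ ∞ f)
    (hG : Continuous G) (hfG : ∀ z v, inner ℝ (G z) v = fderiv ℝ f z v) : IsWeakGradient f G := by
  refine ⟨(hf.continuous.locallyIntegrable).locallyIntegrableOn _,
    (hG.locallyIntegrable).locallyIntegrableOn _, fun η h1 h2 h3 v => ?_⟩
  rw [integral_disc_eq_integral h3 fun z hz => by
      rw [fderiv_eq_zero_of_notMem_tsupport hz]; simp,
    integral_disc_eq_integral h3 fun z hz => by
      rw [image_eq_zero_of_notMem_tsupport hz, mul_zero]]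
  simp only [hfG]
  have c1 : Continuous fun z => fderiv ℝ η z v :=
    (h1.continuous_fderiv (by simp)).clm_apply continuous_const
  have c2 : Continuous fun z => fderiv ℝ f z v :=
    (hf.continuous_fderiv (by simp)).clm_apply continuous_const
  refine integral_mul_fderiv_eq_neg_fderiv_mul_of_integrable ?_ ?_ ?_
    (fun z _ => hf.differentiable (by simp) z) (fun z _ => h1.differentiable (by simp) z)
  · exact (c2.mul h1.continuous).integrable_of_hasCompactSupport h2.mul_left
  · exact (hf.continuous.mul c1).integrable_of_hasCompactSupport (h2.fderiv_apply ℝ v).mul_left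
  · exact (hf.continuous.mul h1.continuous).integrable_of_hasCompactSupport h2.mul_left

theorem isWeakGradient_const (c : ℝ) : IsWeakGradient (fun _ => c) (fun _ => 0) :=
  isWeakGradient_of_contDiff contDiff_const continuous_const fun z v => by simp

/-- A weak gradient of the zero function vanishes. -/
theorem IsWeakGradient.ae_eq_zero {G : ℂ → ℂ} (h : IsWeakGradient (fun _ => 0) G) :
    G =ᵐ[discMeasure] 0 := by
  have hv : ∀ v : ℂ, ∀ᵐ z, z ∈ disc → inner ℝ (G z) v = 0 := by
    intro v
    refine isOpen_disc.ae_eq_zero_of_integral_contDiff_smul_eq_zero ?_ fun η h1 h2 h3 => ?_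
    · rw [locallyIntegrableOn_iff isOpen_disc.isLocallyClosed]
      exact fun k hk hkc => (h.2.1.integrableOn_compact_subset hk hkc).inner_const v
    · have := h.2.2 η h1 h2 h3 v
      simp only [zero_mul, integral_zero, zero_eq_neg] at this
      rw [integral_disc_eq_integral h3 fun z hz => by
        rw [image_eq_zero_of_notMem_tsupport hz, mul_zero]] at this
      simpa [mul_comm] using this
  rw [discMeasure, Filter.EventuallyEq, ae_restrict_iff' measurableSet_disc]
  -- The directions 1 and i recover the real and imaginary parts of G.
  filter_upwards [hv 1, hv Complex.I] with z h1 h2 hz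
  have e1 := h1 hz
  have e2 := h2 hz
  rw [Complex.inner] at e1 e2
  apply Complex.ext
  · simpa using e1
  · simpa using e2

theorem IsWeakGradient.sub_const {f : ℂ → ℝ} {G : ℂ → ℂ} (h : IsWeakGradient f G)
    (hG : MemLp G 2 discMeasure) (c : ℝ) : IsWeakGradient (fun z => f z - c) G := by
  have := h.add (isWeakGradient_const (-c)) hG (MemLp.zero (p := 2))
  simpa [sub_eq_add_neg] using this

/-- A function with vanishing weak gradient is constant. -/
theorem IsWeakGradient.ae_eq_average {f : ℂ → ℝ} {G : ℂ → ℂ} (h : IsWeakGradient f G)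
    (hG : G =ᵐ[discMeasure] 0) : f =ᵐ[discMeasure] fun _ => ⨍ z, f z ∂discMeasure := by
  obtain ⟨C, hC, hCf⟩ := exists_eLpNorm_sub_average_le (le_refl 2) (by simp)
  have hG2 : MemLp G 2 discMeasure := (MemLp.zero (p := 2)).ae_eq hG.symm
  have h1 := hCf f G h hG2
  have h0 : eLpNorm G 2 discMeasure = 0 := by
    rw [eLpNorm_congr_ae hG]; exact eLpNorm_zero
  have hm : AEStronglyMeasurable (fun z => f z - ⨍ w, f w ∂discMeasure) discMeasure :=
    h.aestronglyMeasurable.sub aestronglyMeasurable_const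
  rw [h0, mul_zero, nonpos_iff_eq_zero, eLpNorm_eq_zero_iff hm (by simp)] at h1
  filter_upwards [h1] with z hz
  exact sub_eq_zero.1 hz

/-! ### The Hilbert space of gradient fields and the primitive operator -/

/-- The space of square integrable weak gradients of functions on the disc. -/
def gradientSpace : Submodule ℝ (Lp ℂ 2 discMeasure) where
  carrier := {G | ∃ f : ℂ → ℝ, IsWeakGradient f G}
  add_mem' := by
    rintro G G' ⟨f, hf⟩ ⟨f', hf'⟩
    exact ⟨_, (hf.add hf' (Lp.memLp G) (Lp.memLp G')).congr Filter.EventuallyEq.rfl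
      (Lp.coeFn_add G G').symm⟩
  zero_mem' := ⟨_, (isWeakGradient_const 0).congr Filter.EventuallyEq.rfl
    (Lp.coeFn_zero ℂ 2 discMeasure).symm⟩
  smul_mem' := by
    rintro c G ⟨f, hf⟩
    exact ⟨_, (hf.const_smul c).congr Filter.EventuallyEq.rfl (Lp.coeFn_smul c G).symm⟩

theorem IsWeakGradient.toLp_mem {f : ℂ → ℝ} {G : ℂ → ℂ} (h : IsWeakGradient f G)
    (hG : MemLp G 2 discMeasure) : hG.toLp G ∈ gradientSpace :=
  ⟨f, h.congr Filter.EventuallyEq.rfl hG.coeFn_toLp.symm⟩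

section Weight

variable {h : ℂ → ℝ}

/-- The difference of the two functions has zero weak gradient, so it is constant, and its weighted
mean is zero. -/
theorem IsAdmissibleWeight.ae_eq_of_integral_eq_zero (hh : IsAdmissibleWeight h) {f f' : ℂ → ℝ}
    {G : ℂ → ℂ} (hG : MemLp G 2 discMeasure) (hf : IsWeakGradient f G) (hf' : IsWeakGradient f' G)
    (h0 : ∫ z, f z ∂(weightMeasure h) = 0) (h0' : ∫ z, f' z ∂(weightMeasure h) = 0) :
    f =ᵐ[discMeasure] f' := by
  have := hh.isFiniteMeasure
  have h1 := hf.add (hf'.const_smul (-1)) hG (hG.const_smul (-1 : ℝ))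
  have h2 := h1.ae_eq_average (Filter.Eventually.of_forall fun z => by simp)
  set m := ⨍ z, (f z + -1 * f' z) ∂discMeasure with hm
  have hi := (hh.memLp le_rfl (by simp) hf hG).integrable one_le_two
  have hi' := (hh.memLp le_rfl (by simp) hf' hG).integrable one_le_two
  have h3 : ∫ z, (f z + -1 * f' z) ∂(weightMeasure h) = 0 := by
    rw [integral_add hi (hi'.const_mul _), integral_const_mul, h0, h0']
    simp
  rw [integral_congr_ae ((weightMeasure_absolutelyContinuous h).ae_eq h2), integral_const] at h3
  have hν : (weightMeasure h).real Set.univ ≠ 0 := by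
    rw [Measure.real, ENNReal.toReal_ne_zero]
    exact ⟨by simpa using hh.weightMeasure_ne_zero, measure_ne_top _ _⟩
  have hm0 : m = 0 := by simpa [hν] using h3
  filter_upwards [h2] with z hz
  rw [hm0] at hz
  linarith

theorem IsAdmissibleWeight.exists_primitive (hh : IsAdmissibleWeight h) :
    ∃ J : gradientSpace →L[ℝ] Lp ℝ 2 (weightMeasure h), ∀ G : gradientSpace,
      IsWeakGradient (J G) (G : Lp ℂ 2 discMeasure) ∧ ∫ z, J G z ∂(weightMeasure h) = 0 := by
  have := hh.isFiniteMeasure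
  have hex : ∀ G : gradientSpace, ∃ u : Lp ℝ 2 (weightMeasure h),
      IsWeakGradient u (G : Lp ℂ 2 discMeasure) ∧ ∫ z, u z ∂(weightMeasure h) = 0 := by
    rintro ⟨G, f, hf⟩
    have hG := Lp.memLp G
    have hm := hh.memLp_sub le_rfl (by simp) hf hG (⨍ w, f w ∂(weightMeasure h))
    refine ⟨hm.toLp _, (hf.sub_const hG _).congr (hh.ae_eq_iff.1 hm.coeFn_toLp.symm)
      Filter.EventuallyEq.rfl, ?_⟩
    rw [integral_congr_ae hm.coeFn_toLp]
    exact integral_sub_average _ f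
  choose J hJ hJ0 using hex
  -- Uniqueness of the mean-zero primitive makes the chosen map linear; boundedness is the weighted
  -- Poincaré inequality.
  have huniq : ∀ (G : gradientSpace) (u : Lp ℝ 2 (weightMeasure h)),
      IsWeakGradient u (G : Lp ℂ 2 discMeasure) → ∫ z, u z ∂(weightMeasure h) = 0 → J G = u :=
    fun G u h1 h2 => Lp.ext (hh.ae_eq_iff.2
      (hh.ae_eq_of_integral_eq_zero (Lp.memLp _) (hJ G) h1 (hJ0 G) h2))
  have hint : ∀ u : Lp ℝ 2 (weightMeasure h), Integrable u (weightMeasure h) :=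
    fun u => (Lp.memLp u).integrable one_le_two
  obtain ⟨C, hC, hCf⟩ := hh.exists_eLpNorm_sub_average_le (le_refl 2) (by simp)
  let L : gradientSpace →ₗ[ℝ] Lp ℝ 2 (weightMeasure h) :=
    { toFun := J
      map_add' := fun G G' => by
        refine huniq _ _ (((hJ G).add (hJ G') (Lp.memLp _) (Lp.memLp _)).congr
          (hh.ae_eq_iff.1 (Lp.coeFn_add _ _).symm) (Lp.coeFn_add _ _).symm) ?_
        rw [integral_congr_ae (Lp.coeFn_add _ _)]
        simp only [Pi.add_apply]
        rw [integral_add (hint _) (hint _), hJ0, hJ0, add_zero]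
      map_smul' := fun c G => by
        refine huniq _ _ (((hJ G).const_smul c).congr
          (hh.ae_eq_iff.1 (Lp.coeFn_smul c (J G)).symm)
          (Lp.coeFn_smul c (G : Lp ℂ 2 discMeasure)).symm) ?_
        simp only [RingHom.id_apply]
        rw [integral_congr_ae (Lp.coeFn_smul _ _)]
        simp only [Pi.smul_apply, smul_eq_mul]
        rw [integral_const_mul, hJ0, mul_zero] }
  refine ⟨L.mkContinuous C.toReal fun G => ?_, fun G => ⟨hJ G, hJ0 G⟩⟩
  have h1 := hCf _ _ (hJ G) (Lp.memLp _)
  have h2 : ⨍ w, J G w ∂(weightMeasure h) = 0 := by rw [average_eq, hJ0, smul_zero]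
  simp only [h2, sub_zero] at h1
  have h3 := ENNReal.toReal_mono (ENNReal.mul_lt_top hC (Lp.memLp _).2).ne h1
  rw [ENNReal.toReal_mul] at h3
  exact h3

/-- The primitive of a gradient field with vanishing weighted mean. -/
noncomputable def IsAdmissibleWeight.primitive (hh : IsAdmissibleWeight h) :
    gradientSpace →L[ℝ] Lp ℝ 2 (weightMeasure h) := hh.exists_primitive.choose

theorem IsAdmissibleWeight.isWeakGradient_primitive (hh : IsAdmissibleWeight h)
    (G : gradientSpace) : IsWeakGradient (hh.primitive G) (G : Lp ℂ 2 discMeasure) :=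
  (hh.exists_primitive.choose_spec G).1

theorem IsAdmissibleWeight.integral_primitive (hh : IsAdmissibleWeight h)
    (G : gradientSpace) : ∫ z, hh.primitive G z ∂(weightMeasure h) = 0 :=
  (hh.exists_primitive.choose_spec G).2

theorem IsAdmissibleWeight.primitive_injective (hh : IsAdmissibleWeight h) :
    Function.Injective hh.primitive := by
  rw [injective_iff_map_eq_zero]
  intro G hG
  have h1 := hh.isWeakGradient_primitive G
  rw [hG] at h1
  have h2 := (h1.congr (hh.ae_eq_iff.1 (Lp.coeFn_zero ℝ 2 (weightMeasure h)))
    Filter.EventuallyEq.rfl).ae_eq_zero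
  exact Subtype.ext ((Lp.eq_zero_iff_ae_eq_zero).2 h2)

end Weight

/-! ### The gradient space is closed and infinite-dimensional -/

theorem isAdmissibleWeight_one : IsAdmissibleWeight fun _ => 1 :=
  ⟨aemeasurable_const, by simp, 2, by norm_num, by simp⟩

theorem continuous_integral_inner {E : Type*} [NormedAddCommGroup E] [InnerProductSpace ℝ E]
    {ν : Measure ℂ} {φ : ℂ → E} (hφ : MemLp φ 2 ν) :
    Continuous fun u : Lp E 2 ν => ∫ z, inner ℝ (u z) (φ z) ∂ν := by
  have : (fun u : Lp E 2 ν => ∫ z, inner ℝ (u z) (φ z) ∂ν) = fun u => inner ℝ u (hφ.toLp φ) := by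
    ext u
    rw [L2.inner_def]
    refine integral_congr_ae ?_
    filter_upwards [hφ.coeFn_toLp] with z hz
    rw [hz]
  rw [this]
  fun_prop

theorem weightMeasure_one : weightMeasure (fun _ => 1) = discMeasure := by
  simp only [weightMeasure, ENNReal.ofReal_one]
  exact withDensity_one

/-- Along a convergent sequence of gradients, the primitives for the weight 1 are Cauchy in L² by
the Poincaré inequality. The weak gradient identity passes to the limit, since both sides are
continuous in L². -/
theorem isClosed_gradientSpace : IsClosed (gradientSpace : Set (Lp ℂ 2 discMeasure)) := by
  refine IsSeqClosed.isClosed fun x G hx hxG => ?_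
  set h1 := isAdmissibleWeight_one
  let y : ℕ → gradientSpace := fun n => ⟨x n, hx n⟩
  have hy : CauchySeq y := by
    have := hxG.cauchySeq
    rw [Metric.cauchySeq_iff] at this ⊢
    exact this
  obtain ⟨u, hu⟩ := cauchySeq_tendsto_of_complete 
    (h1.primitive.uniformContinuous.comp_cauchySeq hy)
  have hfin := h1.isFiniteMeasure
  have hac : ∀ w : ℂ → ℝ, ∫ z, w z ∂(weightMeasure fun _ => 1) = ∫ z in disc, w z := fun w => by
    rw [weightMeasure_one, discMeasure]
  refine ⟨u, isWeakGradient_of_integrable ?_ ((Lp.memLp G).integrable one_le_two)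
    fun η hη hc hs v => ?_⟩
  · have hi : ∀ w : ℂ → ℝ, Integrable w (weightMeasure fun _ => 1) → Integrable w discMeasure :=
      fun w hw => by rwa [weightMeasure_one] at hw
    exact hi _ ((Lp.memLp u).integrable one_le_two)
  · have hcont : Continuous fun z => fderiv ℝ η z v :=
      (hη.continuous_fderiv (by simp)).clm_apply continuous_const
    have hm1 : MemLp (fun z => fderiv ℝ η z v) 2 (weightMeasure fun _ => 1) := by
      obtain ⟨C, hC⟩ := hcont.bounded_above_of_compact_support (hc.fderiv_apply ℝ v)
      exact MemLp.of_bound hcont.aestronglyMeasurable C (Filter.Eventually.of_forall hC)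
    have hcont2 : Continuous fun z => η z • v := hη.continuous.smul continuous_const
    have hm2 : MemLp (fun z => η z • v) 2 discMeasure := by
      obtain ⟨C, hC⟩ := hcont2.bounded_above_of_compact_support hc.smul_right
      exact MemLp.of_bound hcont2.aestronglyMeasurable C (Filter.Eventually.of_forall hC)
    have t1 := ((continuous_integral_inner hm1).tendsto u).comp hu
    have t2 := (((continuous_integral_inner hm2).tendsto G).comp hxG).neg
    have e1 : ∀ w : ℂ → ℝ, ∫ z, inner ℝ (w z) (fderiv ℝ η z v) ∂(weightMeasure fun _ => 1)
        = ∫ z in disc, w z * fderiv ℝ η z v := fun w => by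
      rw [hac]
      congr 1
      ext z
      rw [real_inner_comm]
      rfl
    have e2 : ∀ w : ℂ → ℂ, ∫ z, inner ℝ (w z) (η z • v) ∂discMeasure
        = ∫ z in disc, inner ℝ (w z) v * η z := fun w => by
      rw [discMeasure]
      simp only [real_inner_smul_right, mul_comm (η _)]
    rw [← e1, ← e2]
    refine tendsto_nhds_unique t1 (t2.congr fun n => ?_)
    have := (h1.isWeakGradient_primitive (y n)).2.2 η hη hc hs v
    rw [← e1, ← e2] at this
    exact this.symm

instance : CompleteSpace gradientSpace := isClosed_gradientSpace.completeSpace_coe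

-- The map p ↦ ∇(x p(x)) is linear and injective on polynomials. The factor x removes the constants:
-- if x p(x) has zero derivative, then p = 0 by degree.
open Polynomial in
theorem not_finiteDimensional_gradientSpace : ¬ FiniteDimensional ℝ gradientSpace := by
  intro hfin
  have hcont : ∀ p : ℝ[X], Continuous fun z : ℂ => ((p.eval z.re : ℝ) : ℂ) := fun p => by
    have := p.continuous
    fun_prop
  have hmem : ∀ p : ℝ[X], MemLp (fun z : ℂ => ((p.eval z.re : ℝ) : ℂ)) 2 discMeasure := fun p => by
    obtain ⟨C, hC⟩ := (isCompact_closedBall (0 : ℂ) 1).exists_bound_of_continuousOn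
      (hcont p).continuousOn
    exact MemLp.of_bound (hcont p).aestronglyMeasurable C
      (ae_discMeasure_mem.mono fun z hz => hC z (Metric.ball_subset_closedBall hz))
  have hgrad : ∀ p : ℝ[X], IsWeakGradient (fun z => (X * p).eval z.re)
      (fun z => (((derivative (X * p)).eval z.re : ℝ) : ℂ)) := fun p => by
    refine isWeakGradient_of_contDiff ?_ (hcont _) fun z v => ?_
    · exact (Polynomial.contDiff_aeval (X * p) ∞).comp Complex.reCLM.contDiff
    · have h1 : HasFDerivAt (fun z : ℂ => (X * p).eval z.re) _ z :=
        ((X * p).hasDerivAt z.re).comp_hasFDerivAt z Complex.reCLM.hasFDerivAt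
      rw [h1.fderiv, Complex.inner]
      simp [mul_comm]
  let P : ℝ[X] →ₗ[ℝ] gradientSpace :=
    { toFun := fun p => ⟨(hmem (derivative (X * p))).toLp _, (hgrad p).toLp_mem _⟩
      map_add' := fun p q => Subtype.ext (by
        change _ = (hmem (derivative (X * p))).toLp _ + (hmem (derivative (X * q))).toLp _
        rw [← MemLp.toLp_add]
        exact MemLp.toLp_congr (hmem _) _ (Filter.Eventually.of_forall fun z => by simp [mul_add]))
      map_smul' := fun c p => Subtype.ext (by
        change _ = c • (hmem (derivative (X * p))).toLp _
        rw [← MemLp.toLp_const_smul]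
        exact MemLp.toLp_congr (hmem _) _ (Filter.Eventually.of_forall fun z => by simp)) }
  have hinj : Function.Injective P := by
    rw [injective_iff_map_eq_zero]
    intro p hp
    have h1 : (hmem (derivative (X * p))).toLp _ = 0 := congrArg Subtype.val hp
    rw [Lp.eq_zero_iff_ae_eq_zero] at h1
    replace h1 := (hmem (derivative (X * p))).coeFn_toLp.symm.trans h1
    rw [discMeasure] at h1
    have h2 := Measure.eqOn_open_of_ae_eq h1 isOpen_disc (hcont _).continuousOn
      continuousOn_const
    have h3 : derivative (X * p) = 0 := by
      refine Polynomial.eq_zero_of_infinite_isRoot _ ((Set.Ioo_infinite (zero_lt_one' ℝ)).mono ?_)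
      intro t ht
      have : ((t : ℝ) : ℂ) ∈ disc := by
        simp only [disc, Metric.mem_ball, dist_zero_right, Complex.norm_real, Real.norm_eq_abs]
        rw [abs_of_pos ht.1]
        exact ht.2
      have h5 := h2 this
      simp only [Complex.ofReal_re, Pi.zero_apply, Complex.ofReal_eq_zero] at h5
      exact h5
    have h4 := Polynomial.derivative_eq_zero.1 h3
    by_contra hp0
    rw [Polynomial.natDegree_X_mul hp0] at h4
    omega
  have := Module.Finite.of_injective P hinj
  exact Polynomial.not_finite this

/-! ### Compactness of the primitive operator -/

/-- The part of the disc in a square of the grid of mesh `1 / n`. -/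
def gridPiece (n : ℕ) (i : ℤ × ℤ) : Set ℂ :=
  disc ∩ ((fun z => ⌊(n : ℝ) * z.re⌋) ⁻¹' {i.1} ∩ (fun z => ⌊(n : ℝ) * z.im⌋) ⁻¹' {i.2})

theorem gridPiece_subset (n : ℕ) (i : ℤ × ℤ) : gridPiece n i ⊆ disc := Set.inter_subset_left

theorem measurableSet_gridPiece (n : ℕ) (i : ℤ × ℤ) : MeasurableSet (gridPiece n i) := by
  have h1 : Measurable fun z : ℂ => ⌊(n : ℝ) * z.re⌋ :=
    (Complex.measurable_re.const_mul _).floor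
  have h2 : Measurable fun z : ℂ => ⌊(n : ℝ) * z.im⌋ :=
    (Complex.measurable_im.const_mul _).floor
  exact measurableSet_disc.inter ((h1 (measurableSet_singleton _)).inter
    (h2 (measurableSet_singleton _)))

theorem convex_gridPiece (n : ℕ) (i : ℤ × ℤ) : Convex ℝ (gridPiece n i) := by
  have h : ∀ (l : ℂ →ₗ[ℝ] ℝ) (k : ℤ), Convex ℝ ((fun z => ⌊(n : ℝ) * l z⌋) ⁻¹' {k}) := by
    intro l k
    have : (fun z => ⌊(n : ℝ) * l z⌋) ⁻¹' {k}
        = ((n : ℝ) • l) ⁻¹' (Set.Ico (k : ℝ) (k + 1)) := by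
      ext z
      simp [Int.floor_eq_iff]
    rw [this]
    exact (convex_Ico _ _).linear_preimage _
  exact convex_disc.inter ((h Complex.reLm i.1).inter (h Complex.imLm i.2))

theorem enorm_sub_le_of_mem_gridPiece {n : ℕ} (hn : 1 ≤ n) {i : ℤ × ℤ} {x y : ℂ}
    (hx : x ∈ gridPiece n i) (hy : y ∈ gridPiece n i) : ‖y - x‖ₑ ≤ 2 * (n : ℝ≥0∞)⁻¹ := by
  have hn' : (0 : ℝ) < n := by exact_mod_cast hn
  have h : ∀ a b : ℝ, ⌊(n : ℝ) * a⌋ = ⌊(n : ℝ) * b⌋ → |b - a| ≤ 1 / n := by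
    intro a b hab
    have h1 := Int.abs_sub_lt_one_of_floor_eq_floor hab.symm
    rw [← mul_sub, abs_mul, abs_of_pos hn'] at h1
    rw [le_div_iff₀ hn', mul_comm]
    exact h1.le
  have h1 := h x.re y.re (hx.2.1.trans hy.2.1.symm)
  have h2 := h x.im y.im (hx.2.2.trans hy.2.2.symm)
  have h3 : ‖y - x‖ ≤ 2 * (1 / n) := by
    refine (Complex.norm_le_abs_re_add_abs_im _).trans ?_
    rw [Complex.sub_re, Complex.sub_im]
    linarith
  rw [← ofReal_norm]
  refine (ENNReal.ofReal_le_ofReal h3).trans_eq ?_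
  rw [ENNReal.ofReal_mul zero_le_two, one_div, ENNReal.ofReal_inv_of_pos hn']
  simp

/-- Indices of the grid squares that meet the disc. -/
noncomputable def gridIndex (n : ℕ) : Finset (ℤ × ℤ) :=
  Finset.Icc (-(n : ℤ)) n ×ˢ Finset.Icc (-(n : ℤ)) n

theorem biUnion_gridPiece (n : ℕ) : ⋃ i ∈ gridIndex n, gridPiece n i = disc := by
  refine Set.Subset.antisymm (Set.iUnion₂_subset fun i _ => gridPiece_subset n i) fun z hz => ?_
  have hz1 : ‖z‖ < 1 := by simpa [disc] using hz
  have h : ∀ a : ℝ, |a| ≤ ‖z‖ → ⌊(n : ℝ) * a⌋ ∈ Finset.Icc (-(n : ℤ)) n := by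
    intro a ha
    have ha' := abs_le.1 (ha.trans hz1.le)
    have hn : (0 : ℝ) ≤ n := n.cast_nonneg
    rw [Finset.mem_Icc]
    constructor
    · rw [Int.le_floor]
      push_cast
      nlinarith
    · have : (⌊(n : ℝ) * a⌋ : ℝ) ≤ (n : ℝ) := (Int.floor_le _).trans (by nlinarith)
      exact_mod_cast this
  simp only [Set.mem_iUnion]
  exact ⟨(⌊(n : ℝ) * z.re⌋, ⌊(n : ℝ) * z.im⌋), Finset.mem_product.2
    ⟨h _ (Complex.abs_re_le_norm z), h _ (Complex.abs_im_le_norm z)⟩, hz, rfl, rfl⟩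

theorem lintegral_disc_eq_sum_gridPiece (n : ℕ) (u : ℂ → ℝ≥0∞) :
    ∫⁻ z in disc, u z = ∑ i ∈ gridIndex n, ∫⁻ z in gridPiece n i, u z := by
  rw [← lintegral_biUnion_finset _ (fun i _ => measurableSet_gridPiece n i), biUnion_gridPiece]
  intro i _ j _ hij
  refine Set.disjoint_left.2 fun z hz hz' => hij ?_
  exact Prod.ext (hz.2.1.symm.trans hz'.2.1) (hz.2.2.symm.trans hz'.2.2)

/-- Poincaré's inequality is applied on each piece, whose diameter is at most 2/n. The constant is 4
(2/n)² = 16/n². -/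
theorem lintegral_sq_le_of_gridPiece {f : ℂ → ℝ} {G : ℂ → ℂ} (hf : IsWeakGradient f G)
    (hG : MemLp G 2 discMeasure) {n : ℕ} (hn : 1 ≤ n)
    (h0 : ∀ i ∈ gridIndex n, ∫ z in gridPiece n i, f z = 0) :
    ∫⁻ z, ‖f z‖ₑ ^ 2 ∂discMeasure ≤ 16 * (n : ℝ≥0∞)⁻¹ ^ 2 * eLpNorm G 2 discMeasure ^ 2 := by
  obtain ⟨g, hg, hs, hg0, hgG⟩ := hf.exists_segmentBound hG
  have hN : ∫⁻ z in disc, g z ^ 2 ≤ eLpNorm G 2 discMeasure ^ 2 :=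
    (setLIntegral_le_lintegral _ _).trans_eq (lintegral_sq_eq_of_ae hg0 hgG)
  calc ∫⁻ z, ‖f z‖ₑ ^ 2 ∂discMeasure
      = ∑ i ∈ gridIndex n, ∫⁻ z in gridPiece n i, ‖f z‖ₑ ^ 2 :=
        lintegral_disc_eq_sum_gridPiece n _
    _ ≤ ∑ i ∈ gridIndex n, 4 * (2 * (n : ℝ≥0∞)⁻¹) ^ 2 * ∫⁻ z in gridPiece n i, g z ^ 2 :=
        Finset.sum_le_sum fun i hi => lintegral_sq_le_of_integral_eq_zero (hf.integrable hG) hs hg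
          (measurableSet_gridPiece n i) (convex_gridPiece n i) (gridPiece_subset n i)
          (fun x hx y hy => enorm_sub_le_of_mem_gridPiece hn hx hy) (h0 i hi)
    _ = 4 * (2 * (n : ℝ≥0∞)⁻¹) ^ 2 * ∫⁻ z in disc, g z ^ 2 := by
        rw [lintegral_disc_eq_sum_gridPiece n, Finset.mul_sum]
    _ ≤ 4 * (2 * (n : ℝ≥0∞)⁻¹) ^ 2 * eLpNorm G 2 discMeasure ^ 2 := mul_le_mul' le_rfl hN
    _ = _ := by ring

section Weight

variable {h : ℂ → ℝ}

/-- Interpolation: smallness in the unweighted norm gives smallness in the weighted norm. -/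
theorem IsAdmissibleWeight.exists_interpolation (hh : IsAdmissibleWeight h) :
    ∃ C : ℝ≥0∞, C < ⊤ ∧ ∃ a : ℝ, 0 < a ∧ ∀ (f : ℂ → ℝ) (G : ℂ → ℂ) (δ : ℝ≥0∞),
      IsWeakGradient f G → MemLp G 2 discMeasure → ⨍ z, f z ∂discMeasure = 0 →
      ∫⁻ z, ‖f z‖ₑ ^ 2 ∂discMeasure ≤ δ * eLpNorm G 2 discMeasure ^ 2 →
      eLpNorm f 2 (weightMeasure h) ^ 2 ≤ C * δ ^ a * eLpNorm G 2 discMeasure ^ 2 := by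
  obtain ⟨r, hr, hfin⟩ := hh.exists_lintegral_rpow
  -- With 1 < σ < r the power h^σ is again an admissible weight, with exponent r/σ, so the Sobolev
  -- inequality holds for it.
  set σ := (1 + r) / 2 with hσ
  have hσ1 : 1 < σ := by rw [hσ]; linarith
  have hσr : σ < r := by rw [hσ]; linarith
  have hσ0 : 0 < σ := by linarith
  have hconj := Real.HolderConjugate.conjExponent hσ1
  set σ' := σ.conjExponent with hσ'
  have hσ'0 : 0 < σ' := hconj.symm.pos
  have hpow : ∀ᵐ z ∂discMeasure, ENNReal.ofReal (h z ^ σ) = ENNReal.ofReal (h z) ^ σ := by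
    filter_upwards [hh.pos] with z hz
    rw [ENNReal.ofReal_rpow_of_pos hz]
  have hw : IsAdmissibleWeight fun z => h z ^ σ := by
    refine ⟨hh.aemeasurable.pow_const σ, hh.pos.mono fun z hz => Real.rpow_pos_of_pos hz σ,
      r / σ, (one_lt_div hσ0).2 hσr, lt_of_le_of_lt (lintegral_mono_ae ?_) hfin⟩
    filter_upwards [hpow] with z hz
    rw [hz, ← ENNReal.rpow_mul, mul_div_cancel₀ _ hσ0.ne']
  obtain ⟨C, hC, hCf⟩ := hw.exists_eLpNorm_sub_le (le_refl 2) (by simp)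
  refine ⟨(C ^ 2) ^ (1 / σ), ENNReal.rpow_lt_top_of_nonneg (by positivity)
    (ENNReal.pow_ne_top hC.ne), 1 / σ', by positivity, fun f G δ hf hG h0 hδ => ?_⟩
  have h1 := hCf f G hf hG
  simp only [h0, sub_zero] at h1
  set N := eLpNorm G 2 discMeasure with hN
  have h2 : ∫⁻ z, ENNReal.ofReal (h z) ^ σ * ‖f z‖ₑ ^ 2 ∂discMeasure ≤ C ^ 2 * N ^ 2 := by
    rw [← mul_pow]
    refine le_trans (le_of_eq ?_) (pow_le_pow_left' h1 2)
    rw [eLpNorm_two_sq, hw.lintegral_weightMeasure]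
    exact lintegral_congr_ae (hpow.mono fun z hz => by simp only; rw [hz])
  have hfm := hf.aestronglyMeasurable.enorm
  have hsum : 1 / σ + 1 / σ' = 1 := by simpa using hconj.inv_add_inv_eq_one
  have h3 := ENNReal.lintegral_mul_le_Lp_mul_Lq discMeasure hconj
    (f := fun z => ENNReal.ofReal (h z) * ‖f z‖ₑ ^ (2 * (1 / σ)))
    (g := fun z => ‖f z‖ₑ ^ (2 * (1 / σ'))) (hh.aemeasurable_ofReal.mul (hfm.pow_const _))
    (hfm.pow_const _)
  -- Splitting h f² as (h |f|^(2/σ)) · |f|^(2/σ'): the first factor is controlled by the weight h^σ,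
  -- the second by the small unweighted norm.
  have e1 : ∀ z, ((fun z => ENNReal.ofReal (h z) * ‖f z‖ₑ ^ (2 * (1 / σ))) *
      fun z => ‖f z‖ₑ ^ (2 * (1 / σ'))) z = ENNReal.ofReal (h z) * ‖f z‖ₑ ^ 2 := by
    intro z
    simp only [Pi.mul_apply]
    rw [mul_assoc, ← ENNReal.rpow_add_of_nonneg _ _ (by positivity) (by positivity), ← mul_add,
      hsum, mul_one, ENNReal.rpow_two]
  have e2 : ∀ z, (ENNReal.ofReal (h z) * ‖f z‖ₑ ^ (2 * (1 / σ))) ^ σ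
      = ENNReal.ofReal (h z) ^ σ * ‖f z‖ₑ ^ 2 := by
    intro z
    rw [ENNReal.mul_rpow_of_nonneg _ _ hσ0.le, ← ENNReal.rpow_mul, mul_assoc,
      one_div_mul_cancel hσ0.ne', mul_one, ENNReal.rpow_two]
  have e3 : ∀ z, (‖f z‖ₑ ^ (2 * (1 / σ'))) ^ σ' = ‖f z‖ₑ ^ 2 := by
    intro z
    rw [← ENNReal.rpow_mul, mul_assoc, one_div_mul_cancel hσ'0.ne', mul_one, ENNReal.rpow_two]
  simp only [e1, e2, e3] at h3
  rw [eLpNorm_two_sq, hh.lintegral_weightMeasure]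
  calc _ ≤ _ := h3
    _ ≤ (C ^ 2 * N ^ 2) ^ (1 / σ) * (δ * N ^ 2) ^ (1 / σ') := by gcongr
    _ = (C ^ 2) ^ (1 / σ) * δ ^ (1 / σ') * ((N ^ 2) ^ (1 / σ) * (N ^ 2) ^ (1 / σ')) := by
        rw [ENNReal.mul_rpow_of_nonneg _ _ (by positivity),
          ENNReal.mul_rpow_of_nonneg _ _ (by positivity)]
        ring
    _ = _ := by
        rw [← ENNReal.rpow_add_of_nonneg _ _ (by positivity) (by positivity), hsum,
          ENNReal.rpow_one]

/-- This allows any primitive of G, in particular the one of zero unweighted mean, to estimate the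
weighted one. -/
theorem IsAdmissibleWeight.eLpNorm_primitive_le (hh : IsAdmissibleWeight h) (G : gradientSpace)
    {f : ℂ → ℝ} (hf : IsWeakGradient f (G : Lp ℂ 2 discMeasure)) :
    ‖hh.primitive G‖ₑ ≤ 2 * eLpNorm f 2 (weightMeasure h) := by
  have := hh.isFiniteMeasure
  have : NeZero (weightMeasure h) := ⟨hh.weightMeasure_ne_zero⟩
  have hm := hh.memLp le_rfl (by simp) hf (Lp.memLp _)
  have h1 : hh.primitive G =ᵐ[discMeasure] fun z => f z - ⨍ w, f w ∂(weightMeasure h) :=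
    hh.ae_eq_of_integral_eq_zero (Lp.memLp _) (hh.isWeakGradient_primitive G)
      (hf.sub_const (Lp.memLp _) _) (hh.integral_primitive G) (integral_sub_average _ f)
  rw [Lp.enorm_def, eLpNorm_congr_ae (hh.ae_eq_iff.2 h1)]
  exact eLpNorm_sub_average_le_two_mul one_le_two (by simp) hm

theorem exists_small_rpow {C : ℝ≥0∞} (hC : C < ⊤) {a : ℝ} (ha : 0 < a) {ε : ℝ≥0∞} (hε : 0 < ε)
    (hε' : ε < ⊤) : ∃ n : ℕ, 1 ≤ n ∧ C * (16 * (n : ℝ≥0∞)⁻¹ ^ 2) ^ a ≤ ε := by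
  set e := ε / (C + 1) with he
  have hC1 : C + 1 ≠ ⊤ := ENNReal.add_ne_top.2 ⟨hC.ne, by simp⟩
  have he0 : 0 < e := ENNReal.div_pos hε.ne' hC1
  have hδ0 : 0 < e ^ (1 / a) / 16 :=
    ENNReal.div_pos (ENNReal.rpow_pos he0 (ENNReal.div_lt_top hε'.ne (by simp)).ne).ne' (by simp)
  obtain ⟨n, hn⟩ := ENNReal.exists_inv_nat_lt hδ0.ne'
  have hcast : (1 : ℝ≥0∞) ≤ ((n + 1 : ℕ) : ℝ≥0∞) := by simp
  refine ⟨n + 1, by omega, ?_⟩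
  have h1 : 16 * ((n + 1 : ℕ) : ℝ≥0∞)⁻¹ ^ 2 ≤ e ^ (1 / a) := by
    have h2 : ((n + 1 : ℕ) : ℝ≥0∞)⁻¹ ^ 2 ≤ e ^ (1 / a) / 16 := by
      calc ((n + 1 : ℕ) : ℝ≥0∞)⁻¹ ^ 2 ≤ ((n + 1 : ℕ) : ℝ≥0∞)⁻¹ := by
            rw [sq]
            exact mul_le_of_le_one_left' (ENNReal.inv_le_one.2 hcast)
        _ ≤ (n : ℝ≥0∞)⁻¹ := ENNReal.inv_le_inv.2 (by simp)
        _ ≤ _ := hn.le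
    calc _ ≤ 16 * (e ^ (1 / a) / 16) := mul_le_mul' le_rfl h2
      _ = _ := ENNReal.mul_div_cancel (by simp) (by simp)
  calc C * (16 * ((n + 1 : ℕ) : ℝ≥0∞)⁻¹ ^ 2) ^ a ≤ (C + 1) * (e ^ (1 / a)) ^ a :=
        mul_le_mul' le_self_add (ENNReal.rpow_le_rpow h1 ha.le)
    _ = (C + 1) * e := by rw [← ENNReal.rpow_mul, one_div_mul_cancel ha.ne', ENNReal.rpow_one]
    _ = ε := ENNReal.mul_div_cancel (by simp) hC1

/-- If the unweighted primitive has zero integral over each piece of a fine grid, it is small in L²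
by the local Poincaré inequality, and small in L²(h) by interpolation. These are finitely many
linear conditions on G. -/
theorem IsAdmissibleWeight.isCompactOperator_primitive (hh : IsAdmissibleWeight h) :
    IsCompactOperator hh.primitive := by
  refine isCompactOperator_of_small_on_ker _ fun ε hε => ?_
  obtain ⟨C, hC, a, ha, hCf⟩ := hh.exists_interpolation
  obtain ⟨n, hn, hsmall⟩ := exists_small_rpow (C := 4 * C) (ENNReal.mul_lt_top (by simp) hC) ha
    (ε := ENNReal.ofReal ε ^ 2) (by positivity) (by simp)
  have h1 := isAdmissibleWeight_one
  have hfin := h1.isFiniteMeasure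
  have hset : ∀ (Q : Set ℂ), Q ⊆ disc → ∀ w : ℂ → ℝ,
      ∫ z in Q, w z ∂(weightMeasure fun _ => 1) = ∫ z in Q, w z := fun Q hQ w => by
    rw [weightMeasure_one, discMeasure, Measure.restrict_restrict_of_subset hQ]
  -- The components of l are the integrals over the grid pieces of the primitive of zero unweighted
  -- mean.
  let l : gradientSpace →L[ℝ] ({i // i ∈ gridIndex n} → ℝ) := ContinuousLinearMap.pi fun i =>
    (innerSL ℝ (indicatorConstLp 2 (measurableSet_gridPiece n i)
      (measure_ne_top (weightMeasure fun _ => 1) _) (1 : ℝ))) ∘L h1.primitive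
  refine ⟨{i // i ∈ gridIndex n}, inferInstance, l, fun G hG => ?_⟩
  set w := h1.primitive G with hw
  have hwG := h1.isWeakGradient_primitive G
  have h0 : ∀ i ∈ gridIndex n, ∫ z in gridPiece n i, w z = 0 := by
    intro i hi
    have h2 := congrFun hG ⟨i, hi⟩
    simp only [l, ContinuousLinearMap.pi_apply, ContinuousLinearMap.comp_apply,
      innerSL_apply_apply, Pi.zero_apply] at h2
    rw [L2.inner_indicatorConstLp_one, hset _ (gridPiece_subset n i)] at h2
    exact h2
  have hmean : ⨍ z, w z ∂discMeasure = 0 := by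
    have h2 : ∀ w : ℂ → ℝ, ∫ z, w z ∂(weightMeasure fun _ => 1) = 0 → ⨍ z, w z ∂discMeasure = 0 :=
      fun w hw => by rw [weightMeasure_one] at hw; rw [average_eq, hw, smul_zero]
    exact h2 _ (h1.integral_primitive G)
  have hG2 : MemLp (G : Lp ℂ 2 discMeasure) 2 discMeasure := Lp.memLp _
  have h3 := hCf _ _ _ hwG hG2 hmean (lintegral_sq_le_of_gridPiece hwG hG2 hn h0)
  have h4 := hh.eLpNorm_primitive_le G hwG
  rw [← Lp.enorm_def] at h3
  have h5 : ‖hh.primitive G‖ₑ ^ 2 ≤ (ENNReal.ofReal ε * ‖(G : Lp ℂ 2 discMeasure)‖ₑ) ^ 2 := by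
    calc ‖hh.primitive G‖ₑ ^ 2 ≤ (2 * eLpNorm w 2 (weightMeasure h)) ^ 2 := by gcongr
      _ = 4 * eLpNorm w 2 (weightMeasure h) ^ 2 := by rw [mul_pow]; norm_num
      _ ≤ 4 * (C * (16 * (n : ℝ≥0∞)⁻¹ ^ 2) ^ a * ‖(G : Lp ℂ 2 discMeasure)‖ₑ ^ 2) := by gcongr
      _ = (4 * C * (16 * (n : ℝ≥0∞)⁻¹ ^ 2) ^ a) * ‖(G : Lp ℂ 2 discMeasure)‖ₑ ^ 2 := by ring
      _ ≤ ENNReal.ofReal ε ^ 2 * ‖(G : Lp ℂ 2 discMeasure)‖ₑ ^ 2 := by gcongr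
      _ = _ := (mul_pow _ _ _).symm
  have h6 := (ENNReal.pow_le_pow_left_iff two_ne_zero).1 h5
  rw [← ofReal_norm, ← ofReal_norm, ← ENNReal.ofReal_mul hε.le,
    ENNReal.ofReal_le_ofReal_iff (by positivity)] at h6
  exact h6

end Weight

/-! ### Arithmetic of the exponents s and 2s/(s-1) -/

section Exponent

variable {s : ℝ≥0∞}

theorem one_sub_inv_ne_zero (hs : 1 < s) : 1 - s⁻¹ ≠ 0 :=
  (tsub_pos_of_lt (ENNReal.inv_lt_one.2 hs)).ne'

theorem two_le_sobolevExponent (s : ℝ≥0∞) : 2 ≤ sobolevExponent s := by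
  rw [sobolevExponent]
  calc (2 : ℝ≥0∞) = 2 / 1 := by simp
    _ ≤ _ := ENNReal.div_le_div_left tsub_le_self 2

theorem sobolevExponent_ne_top (hs : 1 < s) : sobolevExponent s ≠ ⊤ :=
  (ENNReal.div_lt_top (by simp) (one_sub_inv_ne_zero hs)).ne

theorem toReal_one_sub_inv (hs : 1 < s) : (1 - s⁻¹).toReal = 1 - s⁻¹.toReal := by
  rw [ENNReal.toReal_sub_of_le (ENNReal.inv_lt_one.2 hs).le (by simp), ENNReal.toReal_one]

theorem toReal_one_sub_inv_pos (hs : 1 < s) : 0 < 1 - s⁻¹.toReal := by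
  rw [← toReal_one_sub_inv hs]
  exact ENNReal.toReal_pos (one_sub_inv_ne_zero hs) (ENNReal.sub_ne_top (by simp))

theorem holderTriple_one_sub_inv (hs : 1 < s) : ENNReal.HolderTriple s (1 - s⁻¹)⁻¹ 1 :=
  ⟨by rw [inv_inv, inv_one, add_tsub_cancel_of_le (ENNReal.inv_lt_one.2 hs).le]⟩

end Exponent

theorem weightDist_comm (s : ℝ≥0∞) (h₁ h₂ : ℂ → ℝ) : weightDist s h₁ h₂ = weightDist s h₂ h₁ := by
  rw [weightDist, weightDist, ← eLpNorm_neg]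
  congr 1
  ext z
  simp only [Pi.neg_apply]
  rw [min_comm]
  ring

/-! ### Dependence of the primitive operator on the weight -/

section Stability

variable {h₁ h₂ : ℂ → ℝ} {s : ℝ≥0∞}

/-- Hölder's inequality for the difference of two weights. -/
theorem lintegral_enorm_sub_mul_sq_le (hh₁ : IsAdmissibleWeight h₁) (hh₂ : IsAdmissibleWeight h₂)
    (hs : 1 < s) {u : ℂ → ℝ} (hu : AEStronglyMeasurable u discMeasure) :
    ∫⁻ z, ‖h₁ z - h₂ z‖ₑ * ‖u z‖ₑ ^ 2 ∂discMeasure ≤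
      weightDist s h₁ h₂ * eLpNorm u (sobolevExponent s) (weightMeasure h₂) ^ 2 := by
  set κ : ℝ := 1 - s⁻¹.toReal with hκ
  have hκ0 : 0 < κ := toReal_one_sub_inv_pos hs
  have hm : AEMeasurable (fun z => min (h₁ z) (h₂ z)) discMeasure :=
    hh₁.aemeasurable.min hh₂.aemeasurable
  set A : ℂ → ℝ := fun z => (h₁ z - h₂ z) * (min (h₁ z) (h₂ z)) ^ (s⁻¹.toReal - 1) with hA
  -- Here A · B = (h₁ - h₂) u², since the two powers of the minimum cancel. The L^s norm of A is
  -- d_s, and |B|^(1/κ) = min(h₁, h₂) |u|^(2/κ) ≤ h₂ |u|^q with q = 2/κ = 2s/(s-1), which is where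
  -- this exponent comes from.
  set B : ℂ → ℝ := fun z => (min (h₁ z) (h₂ z)) ^ κ * u z ^ 2 with hB
  have hAm : AEStronglyMeasurable A discMeasure :=
    ((hh₁.aemeasurable.sub hh₂.aemeasurable).mul (hm.pow_const _)).aestronglyMeasurable
  have hBm : AEStronglyMeasurable B discMeasure :=
    ((hm.pow_const _).mul (hu.aemeasurable.pow_const 2)).aestronglyMeasurable
  have := holderTriple_one_sub_inv hs
  have hHold := eLpNorm_smul_le_mul_eLpNorm (p := s) (q := (1 - s⁻¹)⁻¹) (r := 1) hBm hAm
  have hleft : eLpNorm (A • B) 1 discMeasure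
      = ∫⁻ z, ‖h₁ z - h₂ z‖ₑ * ‖u z‖ₑ ^ 2 ∂discMeasure := by
    rw [eLpNorm_one_eq_lintegral_enorm]
    refine lintegral_congr_ae ?_
    filter_upwards [hh₁.pos, hh₂.pos] with z h1 h2
    have hmin : 0 < min (h₁ z) (h₂ z) := lt_min h1 h2
    have : (A • B) z = (h₁ z - h₂ z) * u z ^ 2 := by
      simp only [Pi.smul_apply', hA, hB, smul_eq_mul]
      rw [mul_assoc, ← mul_assoc (_ ^ (s⁻¹.toReal - 1)), ← Real.rpow_add hmin, hκ]
      simp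
    rw [this, enorm_mul, enorm_pow]
  have hright : eLpNorm B (1 - s⁻¹)⁻¹ discMeasure
      ≤ eLpNorm u (sobolevExponent s) (weightMeasure h₂) ^ 2 := by
    have hq0 : sobolevExponent s ≠ 0 := (zero_lt_two.trans_le (two_le_sobolevExponent s)).ne'
    have hs'0 : (1 - s⁻¹)⁻¹ ≠ 0 := ENNReal.inv_ne_zero.2 (ENNReal.sub_ne_top (by simp))
    have hs't : (1 - s⁻¹)⁻¹ ≠ ⊤ := ENNReal.inv_ne_top.2 (one_sub_inv_ne_zero hs)
    have e1 : ((1 - s⁻¹)⁻¹).toReal = κ⁻¹ := by rw [ENNReal.toReal_inv, toReal_one_sub_inv hs]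
    have e2 : (sobolevExponent s).toReal = 2 / κ := by
      rw [sobolevExponent, ENNReal.toReal_div, toReal_one_sub_inv hs]; simp [hκ]
    rw [eLpNorm_eq_lintegral_rpow_enorm_toReal hs'0 hs't,
      eLpNorm_eq_lintegral_rpow_enorm_toReal hq0 (sobolevExponent_ne_top hs), e1, e2,
      hh₂.lintegral_weightMeasure, ← ENNReal.rpow_two, ← ENNReal.rpow_mul]
    have e3 : 1 / (2 / κ) * 2 = 1 / κ⁻¹ := by field_simp
    rw [e3]
    refine ENNReal.rpow_le_rpow (lintegral_mono_ae ?_) (by positivity)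
    filter_upwards [hh₁.pos, hh₂.pos] with z h1 h2
    have hmin : 0 < min (h₁ z) (h₂ z) := lt_min h1 h2
    rw [hB, enorm_mul, enorm_pow, ENNReal.mul_rpow_of_nonneg _ _ (by positivity),
      ← ENNReal.rpow_two, ← ENNReal.rpow_mul, ← div_eq_mul_inv]
    refine mul_le_mul' ?_ le_rfl
    rw [Real.enorm_of_nonneg (Real.rpow_nonneg hmin.le _), ENNReal.ofReal_rpow_of_nonneg
      (Real.rpow_nonneg hmin.le _) (by positivity), ← Real.rpow_mul hmin.le,
      mul_inv_cancel₀ hκ0.ne', Real.rpow_one]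
    exact ENNReal.ofReal_le_ofReal (min_le_right _ _)
  rw [← hleft]
  exact hHold.trans (mul_le_mul' le_rfl hright)

theorem eLpNorm_two_sq_le_add (hh₁ : IsAdmissibleWeight h₁) (hh₂ : IsAdmissibleWeight h₂)
    (hs : 1 < s) {u : ℂ → ℝ} (hu : AEStronglyMeasurable u discMeasure) :
    eLpNorm u 2 (weightMeasure h₁) ^ 2 ≤ eLpNorm u 2 (weightMeasure h₂) ^ 2 +
      weightDist s h₁ h₂ * eLpNorm u (sobolevExponent s) (weightMeasure h₂) ^ 2 := by
  rw [eLpNorm_two_sq, eLpNorm_two_sq, hh₁.lintegral_weightMeasure, hh₂.lintegral_weightMeasure]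
  refine le_trans ?_ (add_le_add le_rfl (lintegral_enorm_sub_mul_sq_le hh₁ hh₂ hs hu))
  have hm : AEMeasurable (fun z => ENNReal.ofReal (h₂ z) * ‖u z‖ₑ ^ 2) discMeasure :=
    hh₂.aemeasurable_ofReal.mul (hu.enorm.pow_const 2)
  rw [← lintegral_add_left' hm]
  refine lintegral_mono_ae ?_
  filter_upwards [hh₂.pos] with z h2
  rw [← add_mul]
  refine mul_le_mul' ?_ le_rfl
  rw [← ofReal_norm, ← ENNReal.ofReal_add h2.le (norm_nonneg _)]
  refine ENNReal.ofReal_le_ofReal ?_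
  have := le_abs_self (h₁ z - h₂ z)
  rw [Real.norm_eq_abs]
  linarith

/-- The mean minimises the quadratic deviation. -/
theorem eLpNorm_sub_average_le {ν : Measure ℂ} [IsFiniteMeasure ν] {u : ℂ → ℝ} (hu : MemLp u 2 ν) :
    eLpNorm (fun z => u z - ⨍ w, u w ∂ν) 2 ν ≤ eLpNorm u 2 ν := by
  set m := ⨍ w, u w ∂ν with hm
  have hu' : MemLp (fun z => u z - m) 2 ν := hu.sub (memLp_const m)
  have h0 : ∫ z, (u z - m) ∂ν = 0 := integral_sub_average ν u
  have h1 : ∫ z, u z ^ 2 ∂ν = ∫ z, (u z - m) ^ 2 ∂ν + ∫ z, m ^ 2 ∂ν := by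
    have i1 := hu'.integrable_sq
    have i2 : Integrable (fun z => 2 * m * (u z - m)) ν :=
      (hu'.integrable one_le_two).const_mul _
    have i12 : Integrable (fun z => (u z - m) ^ 2 + 2 * m * (u z - m)) ν := i1.add i2
    rw [← add_zero (∫ z, (u z - m) ^ 2 ∂ν)]
    nth_rewrite 1 [← mul_zero (2 * m)]
    rw [← h0, ← integral_const_mul, ← integral_add i1 i2,
      ← integral_add i12 (integrable_const _)]
    congr 1
    ext z
    ring
  have h2 : ∫ z, (u z - m) ^ 2 ∂ν ≤ ∫ z, u z ^ 2 ∂ν := by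
    rw [h1]
    exact le_add_of_nonneg_right (integral_nonneg fun z => sq_nonneg m)
  have h3 : ∀ w : ℂ → ℝ, MemLp w 2 ν →
      eLpNorm w 2 ν ^ 2 = ENNReal.ofReal (∫ z, w z ^ 2 ∂ν) := fun w hw => by
    rw [eLpNorm_two_sq, ofReal_integral_eq_lintegral_ofReal hw.integrable_sq
      (Filter.Eventually.of_forall fun z => sq_nonneg _)]
    refine lintegral_congr fun z => ?_
    rw [← enorm_pow, Real.enorm_of_nonneg (sq_nonneg _)]
  refine (ENNReal.pow_le_pow_left_iff two_ne_zero).1 ?_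
  rw [h3 _ hu', h3 _ hu]
  exact ENNReal.ofReal_le_ofReal h2

/-- The two primitives differ by a constant, and the one for h₁ has the least L²(h₁) norm among the
translates. The primitive for h₂ has zero h₂-mean, so the best Sobolev constant of h₂ applies to it
without loss. -/
theorem enorm_primitive_sq_le_add (hh₁ : IsAdmissibleWeight h₁) (hh₂ : IsAdmissibleWeight h₂)
    (hs : 1 < s) (G : gradientSpace) :
    ‖hh₁.primitive G‖ₑ ^ 2 ≤ ‖hh₂.primitive G‖ₑ ^ 2 +
      weightDist s h₁ h₂ * (sobolevConst h₂ (sobolevExponent s) * ‖G‖ₑ) ^ 2 := by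
  have := hh₁.isFiniteMeasure
  have hw := hh₂.isWeakGradient_primitive G
  set w := hh₂.primitive G with hwdef
  have hG2 : MemLp (G : Lp ℂ 2 discMeasure) 2 discMeasure := Lp.memLp _
  have h1 : hh₁.primitive G =ᵐ[discMeasure] fun z => w z - ⨍ y, w y ∂(weightMeasure h₁) :=
    hh₁.ae_eq_of_integral_eq_zero hG2 (hh₁.isWeakGradient_primitive G)
      (hw.sub_const hG2 _) (hh₁.integral_primitive G) (integral_sub_average _ _)
  have h2 : ‖hh₁.primitive G‖ₑ ≤ eLpNorm w 2 (weightMeasure h₁) := by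
    rw [Lp.enorm_def, eLpNorm_congr_ae (hh₁.ae_eq_iff.2 h1)]
    exact eLpNorm_sub_average_le (hh₁.memLp le_rfl (by simp) hw hG2)
  have h3 := hh₂.eLpNorm_sub_average_le_sobolevConst (two_le_sobolevExponent s)
    (sobolevExponent_ne_top hs) hw hG2
  have h4 : ⨍ y, w y ∂(weightMeasure h₂) = 0 := by
    rw [average_eq, hh₂.integral_primitive G, smul_zero]
  simp only [h4, sub_zero] at h3
  have hGn : eLpNorm (G : Lp ℂ 2 discMeasure) 2 discMeasure = ‖G‖ₑ := (Lp.enorm_def _).symm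
  rw [hGn] at h3
  calc ‖hh₁.primitive G‖ₑ ^ 2 ≤ eLpNorm w 2 (weightMeasure h₁) ^ 2 := by gcongr
    _ ≤ _ := eLpNorm_two_sq_le_add hh₁ hh₂ hs hw.aestronglyMeasurable
    _ ≤ _ := by
      rw [← Lp.enorm_def]
      gcongr

theorem norm_primitive_sq_sub_le (hh₁ : IsAdmissibleWeight h₁) (hh₂ : IsAdmissibleWeight h₂)
    (hs : 1 < s) (hd : weightDist s h₁ h₂ < ⊤) {C : ℝ≥0∞} (hC : C < ⊤)
    (hC₂ : sobolevConst h₂ (sobolevExponent s) ≤ C) (G : gradientSpace) :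
    ‖hh₁.primitive G‖ ^ 2 - ‖hh₂.primitive G‖ ^ 2 ≤
      C.toReal ^ 2 * (weightDist s h₁ h₂).toReal * ‖G‖ ^ 2 := by
  have h1 : ‖hh₁.primitive G‖ₑ ^ 2 ≤ ‖hh₂.primitive G‖ₑ ^ 2 +
      weightDist s h₁ h₂ * (C * ‖G‖ₑ) ^ 2 :=
    (enorm_primitive_sq_le_add hh₁ hh₂ hs G).trans (by gcongr)
  have hfin : weightDist s h₁ h₂ * (C * ‖G‖ₑ) ^ 2 ≠ ⊤ :=
    ENNReal.mul_ne_top hd.ne (ENNReal.pow_ne_top (ENNReal.mul_ne_top hC.ne (by simp)))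
  have hfin' : ‖hh₂.primitive G‖ₑ ^ 2 ≠ ⊤ := ENNReal.pow_ne_top (by simp)
  have h2 := ENNReal.toReal_mono (ENNReal.add_ne_top.2 ⟨hfin', hfin⟩) h1
  rw [ENNReal.toReal_add hfin' hfin] at h2
  simp only [ENNReal.toReal_pow, ENNReal.toReal_mul, toReal_enorm] at h2
  linarith

end Stability

/-! ### Neumann eigenvalues as reciprocals of eigenvalues of J†J -/

section Counting

variable {h : ℂ → ℝ}

theorem inner_gradientSpace (G H : gradientSpace) :
    inner ℝ G H = ∫ z in disc, inner ℝ ((G : Lp ℂ 2 discMeasure) z) ((H : Lp ℂ 2 discMeasure) z) :=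
  rfl

theorem IsAdmissibleWeight.inner_primitive (hh : IsAdmissibleWeight h) (G H : gradientSpace) :
    inner ℝ (hh.primitive G) (hh.primitive H) =
      ∫ z, hh.primitive G z * hh.primitive H z ∂(weightMeasure h) := by
  rw [L2.inner_def]
  refine integral_congr_ae (Filter.Eventually.of_forall fun z => ?_)
  simp [mul_comm]

theorem IsAdmissibleWeight.memSobolev_primitive (hh : IsAdmissibleWeight h) (G : gradientSpace) :
    MemSobolev h (hh.primitive G) (G : Lp ℂ 2 discMeasure) :=
  hh.memSobolev_iff.2 ⟨hh.isWeakGradient_primitive G, Lp.memLp _⟩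

theorem IsAdmissibleWeight.memSobolev_const (hh : IsAdmissibleWeight h) (c : ℝ) :
    MemSobolev h (fun _ => c) (fun _ => 0) :=
  hh.memSobolev_iff.2 ⟨isWeakGradient_const c, MemLp.zero (p := 2)⟩

theorem IsAdmissibleWeight.integral_mul_mul (hh : IsAdmissibleWeight h) (f g : ℂ → ℝ) :
    ∫ z in disc, h z * f z * g z = ∫ z, f z * g z ∂(weightMeasure h) := by
  rw [hh.integral_weightMeasure]
  simp only [mul_assoc]

/-- A Sobolev function is a constant plus the primitive of its weak gradient. -/
theorem IsAdmissibleWeight.exists_eq_primitive_add (hh : IsAdmissibleWeight h) {f : ℂ → ℝ}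
    {G : ℂ → ℂ} (hf : MemSobolev h f G) : ∃ G' : gradientSpace,
      (G' : Lp ℂ 2 discMeasure) =ᵐ[discMeasure] G ∧
      f =ᵐ[weightMeasure h] fun z => hh.primitive G' z + ⨍ w, f w ∂(weightMeasure h) := by
  have := hh.isFiniteMeasure
  refine ⟨⟨hf.2.2.toLp G, hf.1.toLp_mem hf.2.2⟩, hf.2.2.coeFn_toLp, ?_⟩
  have := hh.ae_eq_of_integral_eq_zero hf.2.2
    (hf.1.sub_const hf.2.2 (⨍ w, f w ∂(weightMeasure h)))
    ((hh.isWeakGradient_primitive ⟨_, hf.1.toLp_mem hf.2.2⟩).congr Filter.EventuallyEq.rfl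
      hf.2.2.coeFn_toLp) (integral_sub_average _ f) (hh.integral_primitive _)
  filter_upwards [hh.ae_eq_iff.2 this] with z hz
  rw [← hz, sub_add_cancel]

theorem IsAdmissibleWeight.isEigenfunction_congr (hh : IsAdmissibleWeight h) {lam : ℝ}
    {f f' : ℂ → ℝ} (hf : IsEigenfunction h lam f) (hff' : f =ᵐ[discMeasure] f') :
    IsEigenfunction h lam f' := by
  obtain ⟨G, hG, ht⟩ := hf
  refine ⟨G, hh.memSobolev_iff.2 ⟨hG.1.congr hff' Filter.EventuallyEq.rfl, hG.2.2⟩,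
    fun g H hg => ?_⟩
  rw [ht g H hg, hh.integral_mul_mul, hh.integral_mul_mul]
  congr 1
  refine integral_congr_ae ?_
  filter_upwards [hh.ae_eq_iff.2 hff'] with z hz
  rw [hz]

/-- Testing with f itself shows that its gradient vanishes. -/
theorem IsAdmissibleWeight.isEigenfunction_zero_iff (hh : IsAdmissibleWeight h) {f : ℂ → ℝ} :
    IsEigenfunction h 0 f ↔ ∃ c : ℝ, f =ᵐ[discMeasure] fun _ => c := by
  constructor
  · rintro ⟨G, hG, ht⟩
    have h0 := ht f G hG
    rw [zero_mul] at h0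
    have h1 : inner ℝ (hG.2.2.toLp G) (hG.2.2.toLp G) = (0 : ℝ) := by
      rw [L2.inner_def, ← h0]
      refine integral_congr_ae ?_
      filter_upwards [hG.2.2.coeFn_toLp] with z hz
      rw [hz]
    have h2 : hG.2.2.toLp G = 0 := inner_self_eq_zero.1 h1
    have h3 : G =ᵐ[discMeasure] 0 := by
      refine hG.2.2.coeFn_toLp.symm.trans ?_
      rw [h2]
      exact Lp.coeFn_zero _ _ _
    exact ⟨_, hG.1.ae_eq_average h3⟩
  · rintro ⟨c, hc⟩
    refine hh.isEigenfunction_congr ⟨_, hh.memSobolev_const c, fun g H _ => ?_⟩ hc.symm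
    simp

theorem IsAdmissibleWeight.isEigenfunction_iff (hh : IsAdmissibleWeight h) {lam : ℝ}
    (hlam : lam ≠ 0) {f : ℂ → ℝ} :
    IsEigenfunction h lam f ↔ ∃ G : gradientSpace, f =ᵐ[discMeasure] hh.primitive G ∧
      ∀ H, inner ℝ G H = lam * inner ℝ (hh.primitive G) (hh.primitive H) := by
  constructor
  · rintro ⟨G, hG, ht⟩
    obtain ⟨G', hG', hf⟩ := hh.exists_eq_primitive_add hG
    -- Testing with the constant 1 gives zero weighted mean, because lam ≠ 0; hence f is the
    -- primitive of its gradient.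
    have h0 := ht _ _ (hh.memSobolev_const 1)
    rw [hh.integral_mul_mul] at h0
    simp only [inner_zero_right, integral_zero, mul_one, zero_eq_mul, hlam, false_or] at h0
    rw [average_eq, h0, smul_zero] at hf
    simp only [add_zero] at hf
    refine ⟨G', hh.ae_eq_iff.1 hf, fun H => ?_⟩
    have h1 := ht _ _ (hh.memSobolev_primitive H)
    rw [hh.integral_mul_mul] at h1
    rw [inner_gradientSpace, hh.inner_primitive]
    convert h1 using 1
    · refine integral_congr_ae ?_
      filter_upwards [hG'] with z hz
      rw [hz]
    · congr 1
      refine integral_congr_ae ?_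
      filter_upwards [hf] with z hz
      rw [hz]
  · rintro ⟨G, hf, ht⟩
    refine hh.isEigenfunction_congr ⟨_, hh.memSobolev_primitive G, fun g H hg => ?_⟩ hf.symm
    obtain ⟨H', hH', hg'⟩ := hh.exists_eq_primitive_add hg
    have h1 := ht H'
    rw [inner_gradientSpace, hh.inner_primitive] at h1
    rw [hh.integral_mul_mul]
    convert h1 using 1
    · refine integral_congr_ae ?_
      filter_upwards [hH'] with z hz
      rw [hz]
    · congr 1
      have := hh.isFiniteMeasure
      have i1 : Integrable (fun z => hh.primitive G z * hh.primitive H' z) (weightMeasure h) :=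
        (Lp.memLp (hh.primitive G)).integrable_mul (Lp.memLp (hh.primitive H'))
      have i2 : Integrable (hh.primitive G) (weightMeasure h) :=
        (Lp.memLp (hh.primitive G)).integrable one_le_two
      -- The constant part of the test function g contributes nothing, since the primitive has zero
      -- weighted mean.
      have h2 := integral_add i1 (i2.mul_const (⨍ w, g w ∂(weightMeasure h)))
      rw [integral_mul_const, hh.integral_primitive, zero_mul, add_zero] at h2
      rw [← h2]
      refine integral_congr_ae ?_
      filter_upwards [hg'] with z hz
      rw [hz, mul_add]

theorem IsAdmissibleWeight.ae_eq_zero_of_isEigenfunction (hh : IsAdmissibleWeight h) {lam : ℝ}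
    (hlam : lam < 0) {f : ℂ → ℝ} (hf : IsEigenfunction h lam f) : f =ᵐ[discMeasure] 0 := by
  obtain ⟨G, hfG, hG⟩ := (hh.isEigenfunction_iff hlam.ne).1 hf
  have h1 := hG G
  rw [real_inner_self_eq_norm_sq, real_inner_self_eq_norm_sq] at h1
  have h2 : ‖G‖ ^ 2 ≤ 0 := h1.trans_le (mul_nonpos_of_nonpos_of_nonneg hlam.le (sq_nonneg _))
  have h3 : G = 0 := by simpa using le_antisymm h2 (sq_nonneg _)
  rw [h3, map_zero] at hfG
  exact hfG.trans (hh.ae_eq_iff.1 (Lp.coeFn_zero _ _ _))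

theorem IsAdmissibleWeight.aestronglyMeasurable_primitive (hh : IsAdmissibleWeight h)
    (G : gradientSpace) : AEStronglyMeasurable (hh.primitive G) discMeasure :=
  (hh.isWeakGradient_primitive G).aestronglyMeasurable

/-- The class of the primitive with prescribed gradient and weighted mean. -/
noncomputable def IsAdmissibleWeight.primitiveClass (hh : IsAdmissibleWeight h) :
    ℝ × gradientSpace →ₗ[ℝ] (ℂ →ₘ[discMeasure] ℝ) where
  toFun p := AEEqFun.mk (fun z => p.1 + hh.primitive p.2 z)
    (aestronglyMeasurable_const.add (hh.aestronglyMeasurable_primitive p.2))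
  map_add' p q := by
    rw [AEEqFun.mk_add_mk, AEEqFun.mk_eq_mk]
    simp only [Prod.fst_add, Prod.snd_add, map_add]
    filter_upwards [hh.ae_eq_iff.1 (Lp.coeFn_add (hh.primitive p.2) (hh.primitive q.2))] with z hz
    simp only [hz, Pi.add_apply]
    ring
  map_smul' c p := by
    rw [RingHom.id_apply]
    refine (AEEqFun.mk_eq_mk.2 ?_).trans (AEEqFun.smul_mk c (fun z => p.1 + hh.primitive p.2 z)
      (aestronglyMeasurable_const.add (hh.aestronglyMeasurable_primitive p.2))).symm
    simp only [Prod.smul_fst, Prod.smul_snd, map_smul]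
    filter_upwards [hh.ae_eq_iff.1 (Lp.coeFn_smul c (hh.primitive p.2))] with z hz
    simp only [hz, Pi.smul_apply, smul_eq_mul]
    ring

theorem IsAdmissibleWeight.coeFn_primitiveClass (hh : IsAdmissibleWeight h)
    (p : ℝ × gradientSpace) :
    hh.primitiveClass p =ᵐ[discMeasure] fun z => p.1 + hh.primitive p.2 z :=
  AEEqFun.coeFn_mk _ _

theorem IsAdmissibleWeight.coeFn_primitiveClass_const (hh : IsAdmissibleWeight h) (c : ℝ) :
    hh.primitiveClass (c, 0) =ᵐ[discMeasure] fun _ => c := by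
  have h0 : hh.primitive 0 =ᵐ[discMeasure] 0 := by
    rw [map_zero]
    exact hh.ae_eq_iff.1 (Lp.coeFn_zero _ _ _)
  filter_upwards [hh.coeFn_primitiveClass (c, 0), h0] with z h1 h2
  rw [h1, h2, Pi.zero_apply, add_zero]

theorem IsAdmissibleWeight.coeFn_primitiveClass_zero (hh : IsAdmissibleWeight h)
    (G : gradientSpace) : hh.primitiveClass (0, G) =ᵐ[discMeasure] hh.primitive G := by
  filter_upwards [hh.coeFn_primitiveClass (0, G)] with z h1
  rw [h1, zero_add]

theorem IsAdmissibleWeight.primitiveClass_injective (hh : IsAdmissibleWeight h) :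
    Function.Injective hh.primitiveClass := by
  have := hh.isFiniteMeasure
  rw [injective_iff_map_eq_zero]
  rintro ⟨c, G⟩ hp
  have h1 : (fun z => c + hh.primitive G z) =ᵐ[discMeasure] 0 := by
    refine (hh.coeFn_primitiveClass (c, G)).symm.trans ?_
    rw [hp]
    exact AEEqFun.coeFn_zero
  have h2 : ∫ z, (c + hh.primitive G z) ∂(weightMeasure h) = 0 := by
    rw [integral_congr_ae (hh.ae_eq_iff.2 h1)]
    simp
  have i2 : Integrable (hh.primitive G) (weightMeasure h) :=
    (Lp.memLp (hh.primitive G)).integrable one_le_two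
  rw [integral_add (integrable_const _) i2, hh.integral_primitive, integral_const, add_zero] at h2
  have hν : (weightMeasure h).real Set.univ ≠ 0 := by
    rw [Measure.real, ENNReal.toReal_ne_zero]
    exact ⟨by simpa using hh.weightMeasure_ne_zero, measure_ne_top _ _⟩
  have hc : c = 0 := by simpa [hν] using h2
  subst hc
  have h3 : hh.primitive G = 0 := by
    refine Lp.ext ((hh.ae_eq_iff.2 ?_).trans (Lp.coeFn_zero _ _ _).symm)
    simpa using h1
  rw [Prod.mk_eq_zero]
  exact ⟨rfl, hh.primitive_injective (by rw [h3, map_zero])⟩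

theorem IsAdmissibleWeight.exists_of_isEigenfunction (hh : IsAdmissibleWeight h) {lam : ℝ}
    {f : ℂ →ₘ[discMeasure] ℝ} (hf : IsEigenfunction h lam f) :
    (lam < 0 ∧ f = 0) ∨ (lam = 0 ∧ ∃ c, f = hh.primitiveClass (c, 0)) ∨
      (0 < lam ∧ ∃ G, f = hh.primitiveClass (0, G) ∧
        ∀ H, inner ℝ G H = lam * inner ℝ (hh.primitive G) (hh.primitive H)) := by
  rcases lt_trichotomy lam 0 with hlam | rfl | hlam
  · exact Or.inl ⟨hlam, AEEqFun.ext
      ((hh.ae_eq_zero_of_isEigenfunction hlam hf).trans AEEqFun.coeFn_zero.symm)⟩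
  · obtain ⟨c, hc⟩ := hh.isEigenfunction_zero_iff.1 hf
    exact Or.inr (Or.inl ⟨rfl, c, AEEqFun.ext (hc.trans (hh.coeFn_primitiveClass_const c).symm)⟩)
  · obtain ⟨G, hfG, hG⟩ := (hh.isEigenfunction_iff hlam.ne').1 hf
    exact Or.inr (Or.inr ⟨hlam, G, AEEqFun.ext (hfG.trans (hh.coeFn_primitiveClass_zero G).symm),
      hG⟩)

theorem IsAdmissibleWeight.isEigenfunction_primitiveClass_const (hh : IsAdmissibleWeight h)
    (c : ℝ) : IsEigenfunction h 0 (hh.primitiveClass (c, 0)) :=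
  hh.isEigenfunction_zero_iff.2 ⟨c, hh.coeFn_primitiveClass_const c⟩

theorem IsAdmissibleWeight.eigenvalueCount_of_neg (hh : IsAdmissibleWeight h) {t : ℝ}
    (ht : t < 0) : eigenvalueCount h t = 0 := by
  have : Submodule.span ℝ {f : ℂ →ₘ[discMeasure] ℝ | ∃ lam ≤ t, IsEigenfunction h lam f} = ⊥ := by
    rw [Submodule.span_eq_bot]
    rintro f ⟨lam, hlam, hf⟩
    rcases hh.exists_of_isEigenfunction hf with h1 | h1 | h1
    · exact h1.2
    · linarith [h1.1]
    · linarith [h1.1]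
  rw [eigenvalueCount, this, rank_bot]

theorem IsAdmissibleWeight.one_le_eigenvalueCount (hh : IsAdmissibleWeight h) {t : ℝ}
    (ht : 0 ≤ t) : 1 ≤ eigenvalueCount h t := by
  rw [eigenvalueCount, Cardinal.one_le_iff_pos, rank_pos_iff_exists_ne_zero]
  refine ⟨⟨hh.primitiveClass (1, 0), Submodule.subset_span
    ⟨0, ht, hh.isEigenfunction_primitiveClass_const 1⟩⟩, fun h0 => ?_⟩
  have h1 : hh.primitiveClass (1, 0) = 0 := congrArg Subtype.val h0
  have h2 := hh.primitiveClass_injective (h1.trans (map_zero _).symm)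
  simp at h2

theorem IsAdmissibleWeight.eigenvalueCount_zero_le (hh : IsAdmissibleWeight h) :
    eigenvalueCount h 0 ≤ 1 := by
  rw [eigenvalueCount]
  have hle : Submodule.span ℝ {f : ℂ →ₘ[discMeasure] ℝ | ∃ lam ≤ 0, IsEigenfunction h lam f} ≤
      Submodule.span ℝ {hh.primitiveClass (1, 0)} := by
    rw [Submodule.span_le]
    rintro f ⟨lam, hlam, hf⟩
    rcases hh.exists_of_isEigenfunction hf with h1 | ⟨-, c, rfl⟩ | h1
    · rw [h1.2]; exact zero_mem _
    · refine Submodule.mem_span_singleton.2 ⟨c, ?_⟩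
      rw [← map_smul, Prod.smul_mk, smul_zero, smul_eq_mul, mul_one]
    · linarith [h1.1]
  exact (Submodule.rank_mono hle).trans ((rank_span_le _).trans (by simp))

/-- The summand 1 counts the constants, with eigenvalue 0. Eigenvalues in (0, t] correspond under
inversion to eigenvalues of J†J that are at least t⁻¹. -/
theorem IsAdmissibleWeight.eigenvalueCount_of_pos (hh : IsAdmissibleWeight h) {t : ℝ}
    (ht : 0 < t) : eigenvalueCount h t = 1 + Module.rank ℝ (highSpan hh.primitive t⁻¹) := by
  set P := highSpan hh.primitive t⁻¹ with hP
  set S := Submodule.span ℝ {f : ℂ →ₘ[discMeasure] ℝ | ∃ lam ≤ t, IsEigenfunction h lam f} with hS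
  set Φ : ℝ × P →ₗ[ℝ] (ℂ →ₘ[discMeasure] ℝ) :=
    hh.primitiveClass ∘ₗ LinearMap.prodMap LinearMap.id P.subtype with hΦ
  have hinj : Function.Injective Φ :=
    hh.primitiveClass_injective.comp (Function.injective_id.prodMap P.injective_subtype)
  have hrange : S = LinearMap.range Φ := by
    apply le_antisymm
    · rw [hS, Submodule.span_le]
      rintro f ⟨lam, hlam, hf⟩
      rcases hh.exists_of_isEigenfunction hf with h1 | ⟨-, c, rfl⟩ | ⟨hpos, G, rfl, hG⟩
      · rw [h1.2]; exact zero_mem _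
      · exact ⟨(c, 0), rfl⟩
      · refine ⟨(0, ⟨G, Submodule.subset_span ⟨lam⁻¹, inv_anti₀ hpos hlam, fun H => ?_⟩⟩), rfl⟩
        rw [hG H, inv_mul_cancel_left₀ hpos.ne']
    · have hP' : P ≤ S.comap (hh.primitiveClass ∘ₗ LinearMap.inr ℝ ℝ gradientSpace) := by
        rw [hP, highSpan, Submodule.span_le]
        rintro G ⟨μ, hμ, hG⟩
        have hμ0 : 0 < μ := (inv_pos.2 ht).trans_le hμ
        refine Submodule.subset_span ⟨μ⁻¹, inv_le_of_inv_le₀ ht hμ, ?_⟩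
        refine (hh.isEigenfunction_iff (inv_ne_zero hμ0.ne')).2
          ⟨G, hh.coeFn_primitiveClass_zero G, fun H => ?_⟩
        rw [hG H, inv_mul_cancel_left₀ hμ0.ne']
      rintro _ ⟨⟨c, G⟩, rfl⟩
      have h1 : Φ (c, G) = hh.primitiveClass (c, 0) + hh.primitiveClass (0, (G : gradientSpace)) := by
        rw [← map_add, Prod.mk_add_mk, add_zero, zero_add]
        rfl
      rw [h1]
      exact add_mem (Submodule.subset_span
        ⟨0, ht.le, hh.isEigenfunction_primitiveClass_const c⟩) (hP' G.2)
  change Module.rank ℝ S = _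
  rw [hrange, rank_range_of_injective Φ hinj, rank_prod', Module.rank_self]

theorem IsAdmissibleWeight.isLeast_one (hh : IsAdmissibleWeight h) :
    IsLeast {t : ℝ | ((1 : ℕ) : Cardinal) ≤ eigenvalueCount h t} 0 := by
  refine ⟨by simpa using hh.one_le_eigenvalueCount le_rfl, fun t ht => ?_⟩
  by_contra! hlt
  simp [hh.eigenvalueCount_of_neg hlt] at ht

/-- The shift from m to m + 1 is due to the eigenvalue 0. Since inversion reverses the order, the
greatest c becomes the least t. -/
theorem IsAdmissibleWeight.isLeast_succ (hh : IsAdmissibleWeight h) {m : ℕ} (hm : 1 ≤ m) {c : ℝ}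
    (hc : IsGreatest {c : ℝ | 0 < c ∧ (m : Cardinal) ≤ Module.rank ℝ (highSpan hh.primitive c)} c) :
    IsLeast {t : ℝ | ((m + 1 : ℕ) : Cardinal) ≤ eigenvalueCount h t} c⁻¹ := by
  have key : ∀ t : ℝ, 0 < t → (((m + 1 : ℕ) : Cardinal) ≤ eigenvalueCount h t ↔
      (m : Cardinal) ≤ Module.rank ℝ (highSpan hh.primitive t⁻¹)) := fun t ht => by
    rw [hh.eigenvalueCount_of_pos ht, add_comm 1, Nat.cast_add, Nat.cast_one,
      Cardinal.add_one_le_add_one_iff]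
  refine ⟨(key _ (inv_pos.2 hc.1.1)).2 (by rw [inv_inv]; exact hc.1.2), fun t ht => ?_⟩
  have ht' : ((m + 1 : ℕ) : Cardinal) ≤ eigenvalueCount h t := ht
  -- For t ≤ 0 at most the constants are counted, which is fewer than m + 1 because m ≥ 1.
  have htpos : 0 < t := by
    by_contra! hle
    have h1 : eigenvalueCount h t ≤ 1 := by
      rcases hle.lt_or_eq with hlt | rfl
      · rw [hh.eigenvalueCount_of_neg hlt]; exact zero_le_one
      · exact hh.eigenvalueCount_zero_le
    have h2 := ht'.trans h1
    norm_cast at h2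
    omega
  exact inv_le_of_inv_le₀ htpos (hc.2 ⟨inv_pos.2 htpos, (key t htpos).1 ht'⟩)

end Counting

/-! ### From the operator comparison to the eigenvalue estimate -/

section Comparison

variable {h₁ h₂ : ℂ → ℝ} {s : ℝ≥0∞}

/-- The difference of reciprocals is (b - a)/(ab), and 1/(ab) is at most the larger of 1/a² and
1/b². This is the source of the factor max(λ_n²[h₁], λ_n²[h₂]). -/
theorem abs_inv_sub_inv_le {a b δ : ℝ} (ha : 0 < a) (hb : 0 < b) (h : |a - b| ≤ δ) :
    |a⁻¹ - b⁻¹| ≤ max (a⁻¹ ^ 2) (b⁻¹ ^ 2) * δ := by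
  have h1 : a⁻¹ - b⁻¹ = a⁻¹ * b⁻¹ * (b - a) := by field_simp
  have h2 : a⁻¹ * b⁻¹ ≤ max (a⁻¹ ^ 2) (b⁻¹ ^ 2) := by
    have := le_max_left (a⁻¹ ^ 2) (b⁻¹ ^ 2)
    have := le_max_right (a⁻¹ ^ 2) (b⁻¹ ^ 2)
    nlinarith [sq_nonneg (a⁻¹ - b⁻¹)]
  rw [h1, abs_mul, abs_of_pos (by positivity), abs_sub_comm]
  exact mul_le_mul h2 h (abs_nonneg _) (le_max_of_le_left (sq_nonneg _))

theorem eigenvalue_eq_of_isLeast {h : ℂ → ℝ} {n : ℕ} {a : ℝ}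
    (ha : IsLeast {t : ℝ | (n : Cardinal) ≤ eigenvalueCount h t} a) : eigenvalue h n = a :=
  ha.csInf_eq

theorem isGreatest_highSpan_primitive_sub_le (hh₁ : IsAdmissibleWeight h₁)
    (hh₂ : IsAdmissibleWeight h₂) (hs : 1 < s) (hd : weightDist s h₁ h₂ < ⊤) {m : ℕ} {c₁ c₂ : ℝ}
    (hc₁ : IsGreatest
      {c : ℝ | 0 < c ∧ (m : Cardinal) ≤ Module.rank ℝ (highSpan hh₁.primitive c)} c₁)
    (hc₂ : IsGreatest
      {c : ℝ | 0 < c ∧ (m : Cardinal) ≤ Module.rank ℝ (highSpan hh₂.primitive c)} c₂)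
    {C : ℝ≥0∞} (hC : C < ⊤) (hC₂ : sobolevConst h₂ (sobolevExponent s) ≤ C) :
    c₁ - c₂ ≤ C.toReal ^ 2 * (weightDist s h₁ h₂).toReal :=
  isGreatest_highSpan_sub_le hh₂.isCompactOperator_primitive hc₁ hc₂
    (norm_primitive_sq_sub_le hh₁ hh₂ hs hd hC hC₂)

end Comparison

end NeumannDisc

/-! ### The main theorem -/

open NeumannDisc in
theorem theorem3p3 (h₁ h₂ : ℂ → ℝ)
    (hh₁ : NeumannDisc.IsConformalWeight h₁) (hh₂ : NeumannDisc.IsConformalWeight h₂)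
    (s : ℝ≥0∞) (hs : 1 < s) (hd : NeumannDisc.weightDist s h₁ h₂ < ⊤)
    (n : ℕ) (hn : 1 ≤ n) :
    IsLeast {t : ℝ | (n : Cardinal) ≤ NeumannDisc.eigenvalueCount h₁ t}
      (NeumannDisc.eigenvalue h₁ n) ∧
    IsLeast {t : ℝ | (n : Cardinal) ≤ NeumannDisc.eigenvalueCount h₂ t}
      (NeumannDisc.eigenvalue h₂ n) ∧
    max (NeumannDisc.sobolevConst h₁ (NeumannDisc.sobolevExponent s))
      (NeumannDisc.sobolevConst h₂ (NeumannDisc.sobolevExponent s)) < ⊤ ∧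
    |NeumannDisc.eigenvalue h₁ n - NeumannDisc.eigenvalue h₂ n| ≤
      max (NeumannDisc.eigenvalue h₁ n ^ 2) (NeumannDisc.eigenvalue h₂ n ^ 2) *
        (max (NeumannDisc.sobolevConst h₁ (NeumannDisc.sobolevExponent s))
          (NeumannDisc.sobolevConst h₂ (NeumannDisc.sobolevExponent s))).toReal ^ 2 *
        (NeumannDisc.weightDist s h₁ h₂).toReal := by
  have ha₁ := hh₁.isAdmissibleWeight
  have ha₂ := hh₂.isAdmissibleWeight
  have hC : max (sobolevConst h₁ (sobolevExponent s)) (sobolevConst h₂ (sobolevExponent s)) < ⊤ :=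
    max_lt (ha₁.sobolevConst_lt_top (two_le_sobolevExponent s) (sobolevExponent_ne_top hs))
      (ha₂.sobolevConst_lt_top (two_le_sobolevExponent s) (sobolevExponent_ne_top hs))
  -- For n = 1 both eigenvalues are 0, with constant eigenfunctions, and the estimate is trivial.
  obtain rfl | hn1 := hn.eq_or_lt
  · have l₁ := ha₁.isLeast_one
    have l₂ := ha₂.isLeast_one
    have e₁ := eigenvalue_eq_of_isLeast l₁
    have e₂ := eigenvalue_eq_of_isLeast l₂
    refine ⟨e₁.symm ▸ l₁, e₂.symm ▸ l₂, hC, ?_⟩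
    rw [e₁, e₂]
    simp
  · obtain ⟨m, rfl⟩ : ∃ m, n = m + 1 := ⟨n - 1, by omega⟩
    have hm : 1 ≤ m := by omega
    obtain ⟨c₁, hc₁⟩ := exists_isGreatest_le_rank_highSpan ha₁.isCompactOperator_primitive
      ha₁.primitive_injective not_finiteDimensional_gradientSpace hm
    obtain ⟨c₂, hc₂⟩ := exists_isGreatest_le_rank_highSpan ha₂.isCompactOperator_primitive
      ha₂.primitive_injective not_finiteDimensional_gradientSpace hm
    have l₁ := ha₁.isLeast_succ hm hc₁
    have l₂ := ha₂.isLeast_succ hm hc₂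
    have e₁ := eigenvalue_eq_of_isLeast l₁
    have e₂ := eigenvalue_eq_of_isLeast l₂
    refine ⟨e₁.symm ▸ l₁, e₂.symm ▸ l₂, hC, ?_⟩
    rw [e₁, e₂, mul_assoc]
    refine abs_inv_sub_inv_le hc₁.1.1 hc₂.1.1 (abs_sub_le_iff.2 ⟨?_, ?_⟩)
    · exact isGreatest_highSpan_primitive_sub_le ha₁ ha₂ hs hd hc₁ hc₂ hC (le_max_right _ _)
    -- The opposite inequality exchanges the roles of the weights and uses the Sobolev constant of
    -- h₁, which is why the maximum of the two constants appears.
    · rw [weightDist_comm]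
      exact isGreatest_highSpan_primitive_sub_le ha₂ ha₁ hs (weightDist_comm s h₁ h₂ ▸ hd)
        hc₂ hc₁ hC (le_max_left _ _)
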